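/- Let $m,n\ge 0$. Let $T^*\mathbb R^m$ have coordinates $(\kappa,\lambda)$, symplectic form $\omega=\sum_i d\kappa_i\wedge d\lambda_i$, projection $\pi(\kappa,\lambda)=\lambda$ and involution $\zeta(\kappa,\lambda)=(-\kappa,\lambda)$. All maps are $C^\infty$, and function spaces carry the Whitney $C^\infty$ topology. *Lagrangian side.* A (germ of a) Lagrangian submanifold $L\subset T^*\mathbb R^m$ is fibred-$\mathbb Z_2$-symmetric if it is invariant under $\zeta$ (for a germ at $p$ this includes $\zeta(p)=p$, so $p=(0,\lambda_0)$); its Lagrangian map-germ is $\pi|_L$. Two fibred-$\mathbb Z_2$-symmetric Lagrangian map-germs, given by $(L,p)$ and $(\tilde L,\tilde p)$, are $\mathbb Z_2$-symmetrically Lagrangian equivalent if some germ at $p$ of a symplectic diffeomorphism of $T^*\mathbb R^m$ that maps fibres of $\pi$ to fibres of $\pi$ and commutes with $\zeta$ takes $(L,p)$ to $(\tilde L,\tilde p)$. The map-germ given by $(L,p)$ is $\mathbb Z_2$-symmetrically Lagrangian stable if for every representative, that is, every embedding $\iota:U\to T^*\mathbb R^m$ of an open $U\subset\mathbb R^m$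 onto a fibred-$\mathbb Z_2$-symmetric Lagrangian submanifold with germ $L$ at $p=\iota(u_0)$, and for every neighbourhood $N$ of $u_0$, there is a Whitney neighbourhood $W$ of $\iota$ such that for each embedding $\iota'\in W$ of $U$ onto a fibred-$\mathbb Z_2$-symmetric Lagrangian submanifold there is $u_1\in U\cap N$ for which the germ of $\iota'(U)$ at $\iota'(u_1)$ is $\mathbb Z_2$-symmetrically Lagrangian equivalent to that of $L$ at $p$. *Generating families.* An odd generating family on an open set $V\subset\mathbb R^n\times\mathbb R^m$ that is invariant under $(\beta,\lambda)\mapsto(-\beta,\lambda)$ is a function $F:V\to\mathbb R$ with $F(-\beta,\lambda)=-F(\beta,\lambda)$ such that $d\big(\frac{\partial F}{\partial\beta}\big)$ has rank $n$ at each point of $V$ where $\frac{\partial F}{\partial\beta}=0$. Its germ at $(0,\lambda_0)$ is an odd generating family of the germ $(L,(0,\lambda_0))$ if $\frac{\partial F}{\partial\beta}(0,\lambda_0)=0$ and, as germs, $$L=\Big\{(\kappa,\lambda)\ \Big|\ \exists\,\beta:\ \tfrac{\partial F}{\partial\beta}(\beta,\lambda)=0,\ \kappa=\tfrac{\partial F}{\partial\lambda}(\beta,\lambda)\Big\},\qquad(\beta,\lambda)\text{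 near }(0,\lambda_0).$$ The germs of $F$ at $(0,\lambda_0)$ and of $G$ at $(0,\lambda_1)$ are fibred $\mathcal R^{odd}$-equivalent if $F=G\circ\Psi$ for a diffeomorphism-germ $\Psi(\beta,\lambda)=(\Phi(\beta,\lambda),\Lambda(\lambda))$ from $(0,\lambda_0)$ to $(0,\lambda_1)$ with $\Phi(-\beta,\lambda)=-\Phi(\beta,\lambda)$. The germ of $F$ at $(0,\lambda_0)$ is $\mathcal R^{odd}$-stable if for every representative $F':V\to\mathbb R$ of it that is an odd generating family on $V$, and for every neighbourhood $N$ of $(0,\lambda_0)$, there is a Whitney neighbourhood $W$ of $F'$ such that for each odd generating family $G\in W$ on $V$ there is $(0,\lambda_1)\in V\cap N$ for which the germ of $G$ at $(0,\lambda_1)$ is fibred $\mathcal R^{odd}$-equivalent to that of $F$ at $(0,\lambda_0)$. **Statement.** Let $(L,p)$, $p=(0,\lambda_0)$, be a germ of a fibred-$\mathbb Z_2$-symmetric Lagrangian submanifold of $T^*\mathbb R^m$, and let the germ at $(0,\lambda_0)$ of $F:\mathbb R^n\times\mathbb R^m\to\mathbb R$ be an odd generating family of $(L,p)$. Then the Lagrangian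 map-germ $\pi|_L$ at $p$ is $\mathbb Z_2$-symmetrically Lagrangian stable if and only if $F$ is $\mathcal R^{odd}$-stable. -/

import Mathlib

open Set Filter Topology
open scoped ContDiff

namespace OddLagrangian

/-- The Euclidean space `ℝᵏ`. -/
abbrev Euc (k : ℕ) : Type := EuclideanSpace ℝ (Fin k)

/-- The cotangent bundle `T*ℝᵐ = (ℝᵐ)* × ℝᵐ`, with points `(κ, l)`; the bundle projection onto
the base `ℝᵐ` is `Prod.snd`. -/
abbrev Cot (m : ℕ) : Type := StrongDual ℝ (Euc m) × Euc m

/-- The canonical symplectic form `ω = ∑ dκᵢ ∧ dlᵢ` on `T*ℝᵐ`. -/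
def symp {m : ℕ} (v w : Cot m) : ℝ := v.1 w.2 - w.1 v.2

/-- The fibrewise involution `(κ, l) ↦ (-κ, l)` of `T*ℝᵐ`. -/
def zeta {m : ℕ} (p : Cot m) : Cot m := (-p.1, p.2)

/-- `Φ` represents the germ of a smooth diffeomorphism `(X, x) → (X, y)`. -/
def IsDiffeoGerm {X : Type*} [NormedAddCommGroup X] [NormedSpace ℝ X]
    (Φ : X → X) (x y : X) : Prop :=
  ∃ e : OpenPartialHomeomorph X X, x ∈ e.source ∧ e x = y ∧
    ContDiffOn ℝ ∞ e e.source ∧ ContDiffOn ℝ ∞ e.symm e.target ∧ Φ =ᶠ[𝓝 x] e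

/-- `W` is a neighbourhood of `f` in the (strong) Whitney `C^∞` topology on smooth maps with
open domain `V`: for some order `k` and some positive continuous function `δ` on `V`, it contains
every `g` all of whose derivatives up to order `k` differ from those of `f` by less than `δ x` at
every point `x` of `V`. -/
def IsWhitneyNhd {X Y : Type*} [NormedAddCommGroup X] [NormedSpace ℝ X]
    [NormedAddCommGroup Y] [NormedSpace ℝ Y] (V : Set X) (f : X → Y) (W : Set (X → Y)) : Prop :=
  ∃ (k : ℕ) (δ : X → ℝ), ContinuousOn δ V ∧ (∀ x ∈ V, 0 < δ x) ∧
    ∀ g : X → Y, ContDiffOn ℝ ∞ g V →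
      (∀ x ∈ V, ∀ i ≤ k, ‖iteratedFDeriv ℝ i (fun y => g y - f y) x‖ < δ x) → g ∈ W

/-! ### Lagrangian submanifolds, Lagrangian equivalence and stability -/

/-- `ι` restricted to the open set `U ⊆ ℝᵐ` is a smooth embedding onto a Lagrangian submanifold
of `T*ℝᵐ`. -/
structure IsLagrangianEmbedding {m : ℕ} (U : Set (Euc m)) (ι : Euc m → Cot m) : Prop where
  isOpen : IsOpen U
  smooth : ContDiffOn ℝ ∞ ι U
  immersion : ∀ u ∈ U, Function.Injective (fderiv ℝ ι u)
  isEmbedding : IsEmbedding (fun u : U => ι u)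
  isotropic : ∀ u ∈ U, ∀ v w : Euc m, symp (fderiv ℝ ι u v) (fderiv ℝ ι u w) = 0

/-- A Lagrangian embedding whose image is a fibred-`ℤ₂`-symmetric submanifold. -/
structure IsSymLagrangianEmbedding {m : ℕ} (U : Set (Euc m)) (ι : Euc m → Cot m) : Prop
    extends IsLagrangianEmbedding U ι where
  symm : ∀ q ∈ ι '' U, zeta q ∈ ι '' U

/-- The germ of the set `L` at `p` is the germ of a fibred-`ℤ₂`-symmetric Lagrangian submanifold.
(Invariance of a germ at `p` under the involution includes that `p` is a fixed point of it.)
The Lagrangian map-germ that belongs to it is the germ of `Prod.snd` on `L` at `p`. -/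
structure IsSymLagrangianGerm {m : ℕ} (L : Set (Cot m)) (p : Cot m) : Prop where
  lagrangian : ∃ (U : Set (Euc m)) (ι : Euc m → Cot m) (u₀ : Euc m),
    IsLagrangianEmbedding U ι ∧ u₀ ∈ U ∧ ι u₀ = p ∧ ι '' U =ᶠ[𝓝 p] L
  fixed : zeta p = p
  symm : ∀ᶠ q in 𝓝 p, q ∈ L → zeta q ∈ L

/-- `ℤ₂`-symmetric Lagrangian equivalence of the germ of `L` at `p` and the germ of `L'` at `p'`:
an odd fibred symplectomorphism-germ of `T*ℝᵐ` takes the first to the second. -/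
def SymLagrangianEquiv {m : ℕ} (L : Set (Cot m)) (p : Cot m) (L' : Set (Cot m)) (p' : Cot m) :
    Prop :=
  ∃ Φ : Cot m → Cot m, IsDiffeoGerm Φ p p' ∧
    (∃ φ : Euc m → Euc m, ∀ᶠ q in 𝓝 p, (Φ q).2 = φ q.2) ∧
    (∀ᶠ q in 𝓝 p, ∀ v w : Cot m, symp (fderiv ℝ Φ q v) (fderiv ℝ Φ q w) = symp v w) ∧
    (∀ᶠ q in 𝓝 p, Φ (zeta q) = zeta (Φ q)) ∧
    (∀ᶠ q in 𝓝 p, q ∈ L ↔ Φ q ∈ L')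

/-- `ℤ₂`-symmetric Lagrangian stability of the germ of `L` at `p`: for every representative, every
fibred-`ℤ₂`-symmetric Lagrangian submanifold that is close enough to it in the Whitney topology
has, at some point near the base point, a germ equivalent to the given one. -/
def IsSymLagrangianStable {m : ℕ} (L : Set (Cot m)) (p : Cot m) : Prop :=
  ∀ (U : Set (Euc m)) (ι : Euc m → Cot m) (u₀ : Euc m),
    IsSymLagrangianEmbedding U ι → u₀ ∈ U → ι u₀ = p → ι '' U =ᶠ[𝓝 p] L →
    ∀ N ∈ 𝓝 u₀, ∃ W : Set (Euc m → Cot m), IsWhitneyNhd U ι W ∧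
      ∀ ι' ∈ W, IsSymLagrangianEmbedding U ι' →
        ∃ u₁ ∈ U ∩ N, SymLagrangianEquiv L p (ι' '' U) (ι' u₁)

/-! ### Odd generating families -/

/-- The derivative `∂F/∂β` of a family `F (β, l)` in the variables. -/
noncomputable def fibreDeriv {n m : ℕ} (F : Euc n × Euc m → ℝ) (x : Euc n × Euc m) :
    StrongDual ℝ (Euc n) :=
  (fderiv ℝ F x).comp (ContinuousLinearMap.inl ℝ (Euc n) (Euc m))

/-- The derivative `∂F/∂l` of a family `F (β, l)` in the parameters. -/
noncomputable def baseDeriv {n m : ℕ} (F : Euc n × Euc m → ℝ) (x : Euc n × Euc m) :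
    StrongDual ℝ (Euc m) :=
  (fderiv ℝ F x).comp (ContinuousLinearMap.inr ℝ (Euc n) (Euc m))

/-- The set `Σ(F)` of critical points of the family. -/
def critSet {n m : ℕ} (F : Euc n × Euc m → ℝ) : Set (Euc n × Euc m) :=
  {x | fibreDeriv F x = 0}

/-- The map `(β, l) ↦ (∂F/∂l (β, l), l)` into `T*ℝᵐ`. -/
noncomputable def genMap {n m : ℕ} (F : Euc n × Euc m → ℝ) (x : Euc n × Euc m) : Cot m :=
  (baseDeriv F x, x.2)

/-- `F` is an odd generating family on the open set `V`, which is symmetric in `β`: it is smooth,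
odd in `β`, and the section `dF` of the big phase space `T*ℝⁿ⁺ᵐ` is transversal to the mixed space
`{∂F/∂β = 0}`, that is, the derivative of `∂F/∂β` is onto at each critical point. -/
structure IsOddFamilyOn {n m : ℕ} (F : Euc n × Euc m → ℝ) (V : Set (Euc n × Euc m)) : Prop where
  isOpen : IsOpen V
  symm : ∀ x ∈ V, (-x.1, x.2) ∈ V
  smooth : ContDiffOn ℝ ∞ F V
  odd : ∀ x ∈ V, F (-x.1, x.2) = -F x
  regular : ∀ x ∈ V ∩ critSet F, Function.Surjective (fderiv ℝ (fibreDeriv F) x)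

/-- The germ of `F` at `(0, l₀)` is an odd generating family of the germ of `L` at `(0, l₀)`,
i.e. `L = {(κ, l) | ∃ β, ∂F/∂β (β, l) = 0, κ = ∂F/∂l (β, l)}` as germs, where `(β, l)` runs over
any small enough neighbourhood `O` of `(0, l₀)`. -/
def IsOddGeneratingFamilyOf {n m : ℕ} (F : Euc n × Euc m → ℝ) (l₀ : Euc m) (L : Set (Cot m)) :
    Prop :=
  (∃ V, (0, l₀) ∈ V ∧ IsOddFamilyOn F V) ∧ (0, l₀) ∈ critSet F ∧
    ∃ O₀ ∈ 𝓝 ((0, l₀) : Euc n × Euc m), ∀ O ∈ 𝓝 ((0, l₀) : Euc n × Euc m), O ⊆ O₀ →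
      genMap F '' (critSet F ∩ O) =ᶠ[𝓝 ((0, l₀) : Cot m)] L

/-- Fibred `R^odd`-equivalence of the germ of `F` at `(0, l₀)` and the germ of `G` at `(0, l₁)`:
`F = G ∘ Ψ` for a diffeomorphism-germ `Ψ (β, l) = (Φ (β, l), Λ l)` with `Φ` odd in `β`. -/
def RoddEquiv {n m : ℕ} (F : Euc n × Euc m → ℝ) (l₀ : Euc m) (G : Euc n × Euc m → ℝ)
    (l₁ : Euc m) : Prop :=
  ∃ (Φ : Euc n × Euc m → Euc n) (Λ : Euc m → Euc m),
    IsDiffeoGerm (fun x : Euc n × Euc m => (Φ x, Λ x.2)) (0, l₀) (0, l₁) ∧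
    (∀ᶠ x in 𝓝 ((0, l₀) : Euc n × Euc m), Φ (-x.1, x.2) = -Φ x) ∧
    ∀ᶠ x in 𝓝 ((0, l₀) : Euc n × Euc m), F x = G (Φ x, Λ x.2)

/-- `R^odd`-stability of the germ of `F` at `(0, l₀)`: for every representative `F'` on an open
set `V`, every odd generating family on `V` that is close enough to `F'` in the Whitney topology
has, at some point near the base point, a germ that is fibred `R^odd`-equivalent to the given one
(germs of odd families are taken at points with `β = 0`). -/
def IsRoddStable {n m : ℕ} (F : Euc n × Euc m → ℝ) (l₀ : Euc m) : Prop :=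
  ∀ (V : Set (Euc n × Euc m)) (F' : Euc n × Euc m → ℝ),
    (0, l₀) ∈ V → IsOddFamilyOn F' V → F' =ᶠ[𝓝 (0, l₀)] F →
    ∀ N ∈ 𝓝 ((0, l₀) : Euc n × Euc m),
      ∃ W : Set (Euc n × Euc m → ℝ), IsWhitneyNhd V F' W ∧
        ∀ G ∈ W, IsOddFamilyOn G V → ∃ l₁ : Euc m, (0, l₁) ∈ V ∩ N ∧ RoddEquiv F l₀ G l₁

end OddLagrangian

/-! Both notions of stability are read off one object, an odd generating function. Oddness in `β`
makes the fibre Hessian of an odd family vanish on `β = 0`, so regularity there means that the mixed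
derivative in `β` and `l` has rank `n`. Hence there are linear coordinates `T : ℝᵐ ≃ ℝⁿ × ℝᵏ` of the
base in which the Lagrangian germ is a graph over the `n` momenta dual to the first block and the
positions of the second block (`lin T`). It is then given by an odd function `S` (`lagParam T S`),
the Legendre transform of the family, and the family is equivalent to its normal form `⟪(T l).1, β⟫
+ S (β, (T l).2)` (`IsLegendre.roddEquiv`). Unlike in the general theory of generating families, no
quadratic forms in extra variables and no additive constants enter: the Lagrangian germ determines
`dS`, and oddness fixes the constant.

Equivalences match. A fibred odd equivalence of families lifts to the cotangent bundle and carries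
one Lagrangian germ to the other (`SymLagrangianEquiv.of_roddEquiv`). Conversely, a fibred
symplectomorphism that commutes with the involution preserves the zero section, hence is a pure
cotangent lift; pulling one normal form back along its base map gives a family whose Legendre
transform in the same coordinates `T` is the generating function of the other germ
(`roddEquiv_of_symLagrangianEquiv`).

Perturbations match too. By an inverse function theorem with neighbourhoods uniform in the
perturbation (`exists_famInverse`), families near `F` have Legendre transforms near `S` on a common
ball (`exists_legendre_family`), and symmetric embeddings near a given one have nearby odd
generating functions (`exists_genFun_family`). These correspondences are local, while a Whitney
neighbourhood concerns the whole domain. Therefore the difference of generating functions is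
multiplied by an even bump function and added to the unperturbed object; on its compact support the
Whitney topology only sees finitely many uniform derivatives (`eventually_mem_whitney`). Since
stability is demanded of every representative, a convenient one is available. It returns a point
where the bump function is `1`, so the germ found there is that of the original perturbation. -/

namespace OddLagrangian

set_option linter.unusedSectionVars false
set_option linter.unusedVariables false

/-! ### Families of smooth maps that converge with all derivatives -/

/-- A filter on an index set together with a limit index. -/
structure PointedFilter (J : Type) where
  l : Filter J
  base : J
  le : pure base ≤ l

section Families

variable {J : Type} (D : PointedFilter J) {X Y Z W : Type}
  [NormedAddCommGroup X] [NormedSpace ℝ X] [NormedAddCommGroup Y] [NormedSpace ℝ Y]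
  [NormedAddCommGroup Z] [NormedSpace ℝ Z] [NormedAddCommGroup W] [NormedSpace ℝ W]

/-- The derivatives up to order `k` of the family `f` converge, locally uniformly near `x`, to
those of the limit member of the family. -/
def FamCk : (k : ℕ) → {Y : Type} → [NormedAddCommGroup Y] → [NormedSpace ℝ Y] →
    (J → X → Y) → X → Prop
  | 0, _, _, _, f, x => Tendsto (fun p : J × X => f p.1 p.2) (D.l ×ˢ 𝓝 x) (𝓝 (f D.base x))
  | k + 1, _, _, _, f, x =>
    Tendsto (fun p : J × X => f p.1 p.2) (D.l ×ˢ 𝓝 x) (𝓝 (f D.base x)) ∧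
      FamCk k (fun j => fderiv ℝ (f j)) x

/-- The members of the family `f` are smooth near `x` and converge with all derivatives. -/
structure FamSmooth (f : J → X → Y) (x : X) : Prop where
  smooth : ∀ᶠ p in D.l ×ˢ 𝓝 x, ContDiffAt ℝ ∞ (f p.1) p.2
  ck : ∀ k, FamCk D k f x

variable {D}

theorem FamCk.tendsto : ∀ {k : ℕ} {f : J → X → Y} {x : X}, FamCk D k f x →
    Tendsto (fun p : J × X => f p.1 p.2) (D.l ×ˢ 𝓝 x) (𝓝 (f D.base x))
  | 0, _, _, h => h
  | _ + 1, _, _, h => h.1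

/-- `D.le` says that `D.base` belongs to every set of `D.l`, so whatever holds eventually holds for
the limit member. All facts about the unperturbed object are obtained this way. -/
theorem eventually_base {R : J → X → Prop} {x : X}
    (h : ∀ᶠ p in D.l ×ˢ 𝓝 x, R p.1 p.2) : ∀ᶠ y in 𝓝 x, R D.base y := by
  have h1 : ∀ᶠ p in (pure D.base : Filter J) ×ˢ 𝓝 x, R p.1 p.2 :=
    h.filter_mono (Filter.prod_mono D.le le_rfl)
  rw [Filter.pure_prod] at h1
  exact h1

theorem eventually_eventually_family {R : J → X → Prop} {x : X}
    (h : ∀ᶠ p in D.l ×ˢ 𝓝 x, R p.1 p.2) :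
    ∀ᶠ p in D.l ×ˢ 𝓝 x, ∀ᶠ y in 𝓝 p.2, R p.1 y := by
  obtain ⟨A, hA, B, hB, hAB⟩ := Filter.eventually_prod_iff.1 h
  exact Filter.eventually_prod_iff.2 ⟨A, hA, _, hB.eventually_nhds, fun {a} ha {b} hb =>
    hb.mono fun y hy => hAB ha hy⟩

theorem eventually_of_base {R : X → Prop} {x : X} (h : ∀ᶠ y in 𝓝 x, R y) :
    ∀ᶠ p in D.l ×ˢ 𝓝 x, R p.2 :=
  (Filter.tendsto_snd (f := D.l) (g := 𝓝 x)).eventually h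

theorem FamCk.congr : ∀ {k : ℕ} {Y : Type} [NormedAddCommGroup Y] [NormedSpace ℝ Y]
    {f g : J → X → Y} {x : X}, FamCk D k f x →
    (∀ᶠ p in D.l ×ˢ 𝓝 x, f p.1 p.2 = g p.1 p.2) → FamCk D k g x
  | 0, Y, _, _, f, g, x, hf, h => by
    have h0 : f D.base x = g D.base x :=
      (eventually_base (R := fun j y => f j y = g j y) h).self_of_nhds
    have := Tendsto.congr' h hf.tendsto
    rwa [h0] at this
  | k + 1, Y, _, _, f, g, x, hf, h => by
    have h0 : f D.base x = g D.base x :=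
      (eventually_base (R := fun j y => f j y = g j y) h).self_of_nhds
    have h1 := Tendsto.congr' h hf.tendsto
    rw [h0] at h1
    exact ⟨h1, hf.2.congr ((eventually_eventually_family (R := fun j y => f j y = g j y) h).mono
      fun p hp => Filter.EventuallyEq.fderiv_eq hp)⟩

theorem FamSmooth.congr {f g : J → X → Y} {x : X} (hf : FamSmooth D f x)
    (h : ∀ᶠ p in D.l ×ˢ 𝓝 x, f p.1 p.2 = g p.1 p.2) : FamSmooth D g x := by
  refine ⟨?_, fun k => (hf.ck k).congr h⟩
  filter_upwards [hf.smooth,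
    eventually_eventually_family (R := fun j y => f j y = g j y) h] with p hp hq
  exact hp.congr_of_eventuallyEq (hq.mono fun y hy => hy.symm)

theorem FamSmooth.tendsto {f : J → X → Y} {x : X} (hf : FamSmooth D f x) :
    Tendsto (fun p : J × X => f p.1 p.2) (D.l ×ˢ 𝓝 x) (𝓝 (f D.base x)) := (hf.ck 0).tendsto

theorem contDiffAt_fderiv {f : X → Y} {x : X} (h : ContDiffAt ℝ ∞ f x) :
    ContDiffAt ℝ ∞ (fderiv ℝ f) x := h.fderiv_right (by norm_cast)

theorem FamSmooth.fderiv {f : J → X → Y} {x : X} (hf : FamSmooth D f x) :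
    FamSmooth D (fun j => fderiv ℝ (f j)) x :=
  ⟨hf.smooth.mono fun _ hp => contDiffAt_fderiv hp, fun k => (hf.ck (k + 1)).2⟩

theorem FamSmooth.of_fderiv {f : J → X → Y} {x : X}
    (hs : ∀ᶠ p in D.l ×ˢ 𝓝 x, ContDiffAt ℝ ∞ (f p.1) p.2)
    (h0 : Tendsto (fun p : J × X => f p.1 p.2) (D.l ×ˢ 𝓝 x) (𝓝 (f D.base x)))
    (h1 : FamSmooth D (fun j => _root_.fderiv ℝ (f j)) x) : FamSmooth D f x := by
  refine ⟨hs, fun k => ?_⟩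
  cases k with
  | zero => exact h0
  | succ k => exact ⟨h0, h1.ck k⟩

theorem FamCk.of_const : ∀ {k : ℕ} {Y : Type} [NormedAddCommGroup Y] [NormedSpace ℝ Y]
    {g : X → Y} {x : X}, (∀ᶠ y in 𝓝 x, ContDiffAt ℝ ∞ g y) → FamCk D k (fun _ => g) x
  | 0, Y, _, _, g, x, h => (h.self_of_nhds.continuousAt.tendsto).comp Filter.tendsto_snd
  | k + 1, Y, _, _, g, x, h => ⟨(h.self_of_nhds.continuousAt.tendsto).comp Filter.tendsto_snd,
      FamCk.of_const (h.mono fun _ hy => contDiffAt_fderiv hy)⟩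

theorem FamSmooth.of_const {g : X → Y} {x : X} (h : ∀ᶠ y in 𝓝 x, ContDiffAt ℝ ∞ g y) :
    FamSmooth D (fun _ => g) x :=
  ⟨eventually_of_base h, fun _ => FamCk.of_const h⟩

theorem FamCk.of_contDiff {k : ℕ} {g : X → Y} {x : X} (h : ContDiff ℝ ∞ g) :
    FamCk D k (fun _ => g) x := FamCk.of_const (Eventually.of_forall fun _ => h.contDiffAt)

theorem FamSmooth.of_contDiff {g : X → Y} {x : X} (h : ContDiff ℝ ∞ g) :
    FamSmooth D (fun _ => g) x := FamSmooth.of_const (Eventually.of_forall fun _ => h.contDiffAt)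

theorem differentiableAt_of_smooth {f : X → Y} {x : X} (h : ContDiffAt ℝ ∞ f x) :
    DifferentiableAt ℝ f x := h.differentiableAt (by norm_num)

theorem FamCk.clm : ∀ {k : ℕ} {Y Z : Type} [NormedAddCommGroup Y] [NormedSpace ℝ Y]
    [NormedAddCommGroup Z] [NormedSpace ℝ Z] (A : Y →L[ℝ] Z) {f : J → X → Y} {x : X},
    (∀ᶠ p in D.l ×ˢ 𝓝 x, ContDiffAt ℝ ∞ (f p.1) p.2) → FamCk D k f x →
    FamCk D k (fun j y => A (f j y)) x
  | 0, Y, Z, _, _, _, _, A, f, x, _, h => (A.continuous.tendsto _).comp h.tendsto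
  | k + 1, Y, Z, _, _, _, _, A, f, x, hs, h => by
    refine ⟨(A.continuous.tendsto _).comp h.tendsto, ?_⟩
    refine (FamCk.clm (ContinuousLinearMap.compL ℝ X Y Z A)
      (hs.mono fun p hp => contDiffAt_fderiv hp) h.2).congr ?_
    filter_upwards [hs] with p hp
    exact ((A.hasFDerivAt.comp p.2 (differentiableAt_of_smooth hp).hasFDerivAt).fderiv).symm

theorem FamCk.prodMk : ∀ {k : ℕ} {Y Z : Type} [NormedAddCommGroup Y] [NormedSpace ℝ Y]
    [NormedAddCommGroup Z] [NormedSpace ℝ Z] {f : J → X → Y} {g : J → X → Z} {x : X},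
    (∀ᶠ p in D.l ×ˢ 𝓝 x, ContDiffAt ℝ ∞ (f p.1) p.2) → FamCk D k f x →
    (∀ᶠ p in D.l ×ˢ 𝓝 x, ContDiffAt ℝ ∞ (g p.1) p.2) → FamCk D k g x →
    FamCk D k (fun j y => (f j y, g j y)) x
  | 0, Y, Z, _, _, _, _, f, g, x, _, hf, _, hg => hf.tendsto.prodMk_nhds hg.tendsto
  | k + 1, Y, Z, _, _, _, _, f, g, x, hfs, hf, hgs, hg => by
    refine ⟨hf.tendsto.prodMk_nhds hg.tendsto, ?_⟩
    have hfs' := hfs.mono fun p hp => contDiffAt_fderiv hp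
    have hgs' := hgs.mono fun p hp => contDiffAt_fderiv hp
    have h1 := FamCk.prodMk hfs' hf.2 hgs' hg.2
    refine (FamCk.clm ((ContinuousLinearMap.compL ℝ X Y (Y × Z)
      (ContinuousLinearMap.inl ℝ Y Z)).comp (ContinuousLinearMap.fst ℝ (X →L[ℝ] Y) (X →L[ℝ] Z)) +
      (ContinuousLinearMap.compL ℝ X Z (Y × Z) (ContinuousLinearMap.inr ℝ Y Z)).comp
      (ContinuousLinearMap.snd ℝ (X →L[ℝ] Y) (X →L[ℝ] Z))) ?_ h1).congr ?_
    · filter_upwards [hfs', hgs'] with p hp hq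
      exact hp.prodMk hq
    · filter_upwards [hfs, hgs] with p hp hq
      rw [(((differentiableAt_of_smooth hp).hasFDerivAt.prodMk
        (differentiableAt_of_smooth hq).hasFDerivAt).fderiv)]
      ext v <;> simp

theorem FamCk.add {k : ℕ} {f g : J → X → Y} {x : X}
    (hfs : ∀ᶠ p in D.l ×ˢ 𝓝 x, ContDiffAt ℝ ∞ (f p.1) p.2) (hf : FamCk D k f x)
    (hgs : ∀ᶠ p in D.l ×ˢ 𝓝 x, ContDiffAt ℝ ∞ (g p.1) p.2) (hg : FamCk D k g x) :
    FamCk D k (fun j y => f j y + g j y) x := by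
  refine FamCk.clm (ContinuousLinearMap.fst ℝ Y Y + ContinuousLinearMap.snd ℝ Y Y) ?_
    (FamCk.prodMk hfs hf hgs hg)
  filter_upwards [hfs, hgs] with p hp hq
  exact hp.prodMk hq

theorem contDiffAt_bilin (B : Y →L[ℝ] Z →L[ℝ] W) {f : X → Y} {g : X → Z} {x : X}
    (hf : ContDiffAt ℝ ∞ f x) (hg : ContDiffAt ℝ ∞ g x) :
    ContDiffAt ℝ ∞ (fun y => B (f y) (g y)) x :=
  ((B.contDiff.contDiffAt).comp x hf).clm_apply hg

theorem FamCk.bilin : ∀ {k : ℕ} {Y Z W : Type} [NormedAddCommGroup Y] [NormedSpace ℝ Y]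
    [NormedAddCommGroup Z] [NormedSpace ℝ Z] [NormedAddCommGroup W] [NormedSpace ℝ W]
    (B : Y →L[ℝ] Z →L[ℝ] W) {f : J → X → Y} {g : J → X → Z} {x : X},
    (∀ᶠ p in D.l ×ˢ 𝓝 x, ContDiffAt ℝ ∞ (f p.1) p.2) → FamCk D k f x →
    (∀ᶠ p in D.l ×ˢ 𝓝 x, ContDiffAt ℝ ∞ (g p.1) p.2) → FamCk D k g x →
    FamCk D k (fun j y => B (f j y) (g j y)) x
  | 0, Y, Z, W, _, _, _, _, _, _, B, f, g, x, _, hf, _, hg =>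
    (B.isBoundedBilinearMap.continuous.tendsto (f D.base x, g D.base x)).comp
      (hf.tendsto.prodMk_nhds hg.tendsto)
  | k + 1, Y, Z, W, _, _, _, _, _, _, B, f, g, x, hfs, hf, hgs, hg => by
    have hfs' := hfs.mono fun p hp => contDiffAt_fderiv hp
    have hgs' := hgs.mono fun p hp => contDiffAt_fderiv hp
    have hfk : FamCk D k f x := by
      exact famCk_of_succ hf
    have hgk : FamCk D k g x := by
      exact famCk_of_succ hg
    refine ⟨(B.isBoundedBilinearMap.continuous.tendsto (f D.base x, g D.base x)).comp
      (hf.tendsto.prodMk_nhds hg.tendsto), ?_⟩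
    refine (FamCk.add ?_ (FamCk.bilin (B.precompR X) hfs hfk hgs' hg.2) ?_
      (FamCk.bilin (B.precompL X) hfs' hf.2 hgs hgk)).congr ?_
    · filter_upwards [hfs, hgs'] with p hp hq
      exact contDiffAt_bilin _ hp hq
    · filter_upwards [hfs', hgs] with p hp hq
      exact contDiffAt_bilin _ hp hq
    · filter_upwards [hfs, hgs] with p hp hq
      exact (B.fderiv_of_bilinear (differentiableAt_of_smooth hp)
        (differentiableAt_of_smooth hq)).symm
where
  famCk_of_succ : ∀ {k : ℕ} {Y : Type} [NormedAddCommGroup Y] [NormedSpace ℝ Y]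
      {f : J → X → Y} {x : X}, FamCk D (k + 1) f x → FamCk D k f x
    | 0, _, _, _, _, _, h => h.1
    | _ + 1, _, _, _, _, _, h => ⟨h.1, famCk_of_succ h.2⟩

theorem contDiffAt_comp_family {f : J → X → Y} {g : J → Y → Z} {x : X}
    (hgs : ∀ᶠ p in D.l ×ˢ 𝓝 (f D.base x), ContDiffAt ℝ ∞ (g p.1) p.2)
    (hf : Tendsto (fun p : J × X => f p.1 p.2) (D.l ×ˢ 𝓝 x) (𝓝 (f D.base x))) :
    ∀ᶠ p in D.l ×ˢ 𝓝 x, ContDiffAt ℝ ∞ (g p.1) (f p.1 p.2) :=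
  (Filter.tendsto_fst.prodMk hf).eventually hgs

/-- Induction by the chain rule. Only the inner family is limited to order `k`; this asymmetry
permits the bootstrap for inverse maps, whose derivative is a smooth expression in the inverse
itself. -/
theorem FamCk.comp : ∀ {k : ℕ} {Y Z : Type} [NormedAddCommGroup Y] [NormedSpace ℝ Y]
    [NormedAddCommGroup Z] [NormedSpace ℝ Z] {f : J → X → Y} {g : J → Y → Z} {x : X},
    FamSmooth D g (f D.base x) →
    (∀ᶠ p in D.l ×ˢ 𝓝 x, ContDiffAt ℝ ∞ (f p.1) p.2) → FamCk D k f x →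
    FamCk D k (fun j y => g j (f j y)) x
  | 0, Y, Z, _, _, _, _, f, g, x, hg, _, hf =>
    hg.tendsto.comp (Filter.tendsto_fst.prodMk hf.tendsto)
  | k + 1, Y, Z, _, _, _, _, f, g, x, hg, hfs, hf => by
    refine ⟨hg.tendsto.comp (Filter.tendsto_fst.prodMk hf.tendsto), ?_⟩
    have hfk : FamCk D k f x := FamCk.bilin.famCk_of_succ hf
    have h1 := FamCk.comp hg.fderiv hfs hfk
    have hgs := contDiffAt_comp_family hg.smooth hf.tendsto
    refine (FamCk.bilin (ContinuousLinearMap.compL ℝ X Y Z) ?_ h1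
      (hfs.mono fun p hp => contDiffAt_fderiv hp) hf.2).congr ?_
    · filter_upwards [hgs, hfs] with p hp hq
      exact (contDiffAt_fderiv hp).comp p.2 hq
    · filter_upwards [hgs, hfs] with p hp hq
      exact (((differentiableAt_of_smooth hp).hasFDerivAt.comp p.2
        (differentiableAt_of_smooth hq).hasFDerivAt).fderiv).symm

theorem FamSmooth.comp {f : J → X → Y} {g : J → Y → Z} {x : X}
    (hg : FamSmooth D g (f D.base x)) (hf : FamSmooth D f x) :
    FamSmooth D (fun j y => g j (f j y)) x := by
  refine ⟨?_, fun k => FamCk.comp hg hf.smooth (hf.ck k)⟩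
  filter_upwards [contDiffAt_comp_family hg.smooth hf.tendsto, hf.smooth] with p hp hq
  exact hp.comp p.2 hq

theorem FamSmooth.comp_fixed {f : J → X → Y} {g : Y → Z} {x : X}
    (hf : FamSmooth D f x) (hg : ∀ᶠ y in 𝓝 (f D.base x), ContDiffAt ℝ ∞ g y) :
    FamSmooth D (fun j y => g (f j y)) x :=
  FamSmooth.comp (g := fun _ => g) (FamSmooth.of_const hg) hf

theorem FamSmooth.clm (A : Y →L[ℝ] Z) {f : J → X → Y} {x : X} (hf : FamSmooth D f x) :
    FamSmooth D (fun j y => A (f j y)) x :=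
  hf.comp_fixed (g := A) (Eventually.of_forall fun _ => A.contDiff.contDiffAt)

theorem FamSmooth.prodMk {f : J → X → Y} {g : J → X → Z} {x : X}
    (hf : FamSmooth D f x) (hg : FamSmooth D g x) :
    FamSmooth D (fun j y => (f j y, g j y)) x :=
  ⟨(hf.smooth.and hg.smooth).mono fun _ h => h.1.prodMk h.2,
    fun k => FamCk.prodMk hf.smooth (hf.ck k) hg.smooth (hg.ck k)⟩

theorem FamSmooth.bilin (B : Y →L[ℝ] Z →L[ℝ] W) {f : J → X → Y} {g : J → X → Z} {x : X}
    (hf : FamSmooth D f x) (hg : FamSmooth D g x) :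
    FamSmooth D (fun j y => B (f j y) (g j y)) x :=
  ⟨(hf.smooth.and hg.smooth).mono fun _ h => contDiffAt_bilin B h.1 h.2,
    fun k => FamCk.bilin B hf.smooth (hf.ck k) hg.smooth (hg.ck k)⟩

theorem FamSmooth.add {f g : J → X → Y} {x : X} (hf : FamSmooth D f x) (hg : FamSmooth D g x) :
    FamSmooth D (fun j y => f j y + g j y) x :=
  (hf.prodMk hg).clm (ContinuousLinearMap.fst ℝ Y Y + ContinuousLinearMap.snd ℝ Y Y)

theorem FamSmooth.sub {f g : J → X → Y} {x : X} (hf : FamSmooth D f x) (hg : FamSmooth D g x) :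
    FamSmooth D (fun j y => f j y - g j y) x :=
  (hf.prodMk hg).clm (ContinuousLinearMap.fst ℝ Y Y - ContinuousLinearMap.snd ℝ Y Y)

theorem FamSmooth.base {f : J → X → Y} {x : X} (hf : FamSmooth D f x) :
    ∀ᶠ y in 𝓝 x, ContDiffAt ℝ ∞ (f D.base) y :=
  eventually_base (R := fun j y => ContDiffAt ℝ ∞ (f j) y) hf.smooth

theorem eventually_forall_of_isCompact {R : J → X → Prop} {K : Set X} (hK : IsCompact K)
    (h : ∀ x ∈ K, ∀ᶠ p in D.l ×ˢ 𝓝 x, R p.1 p.2) : ∀ᶠ j in D.l, ∀ x ∈ K, R j x := by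
  refine hK.induction_on (p := fun s => ∀ᶠ j in D.l, ∀ x ∈ s, R j x) (by simp)
    (fun s t hst ht => ht.mono fun j hj x hx => hj x (hst hx))
    (fun s t hs ht => (hs.and ht).mono fun j hj x hx => hx.elim (hj.1 x) (hj.2 x)) ?_
  intro x hx
  obtain ⟨A, hA, B, hB, hAB⟩ := Filter.eventually_prod_iff.1 (h x hx)
  exact ⟨{y | B y}, mem_nhdsWithin_of_mem_nhds hB, hA.mono fun j hj y hy => hAB hj hy⟩

theorem FamCk.of_iteratedFDeriv : ∀ {k : ℕ} {Y : Type} [NormedAddCommGroup Y] [NormedSpace ℝ Y]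
    {d : J → X → Y} {x : X},
    (∀ i ≤ k, ∀ ε > 0, ∀ᶠ p in D.l ×ˢ 𝓝 x, ‖iteratedFDeriv ℝ i (d p.1) p.2‖ < ε) →
    FamCk D k d x := by
  have key : ∀ {k : ℕ} {Y : Type} [NormedAddCommGroup Y] [NormedSpace ℝ Y]
      {d : J → X → Y} {x : X},
      (∀ i ≤ k, ∀ ε > 0, ∀ᶠ p in D.l ×ˢ 𝓝 x, ‖iteratedFDeriv ℝ i (d p.1) p.2‖ < ε) →
      Tendsto (fun p : J × X => d p.1 p.2) (D.l ×ˢ 𝓝 x) (𝓝 (d D.base x)) := by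
    intro k Y _ _ d x h
    have h0 : ∀ ε > 0, ∀ᶠ p in D.l ×ˢ 𝓝 x, ‖d p.1 p.2‖ < ε := fun ε hε => by
      simpa only [norm_iteratedFDeriv_zero] using h 0 (Nat.zero_le _) ε hε
    -- The limit member obeys the bound for every `ε`, so the family can only converge to zero.
    have h1 : d D.base x = 0 := by
      by_contra hne
      exact lt_irrefl _ (eventually_base (R := fun j y => ‖d j y‖ < ‖d D.base x‖)
        (h0 _ (norm_pos_iff.2 hne))).self_of_nhds
    rw [h1, Metric.tendsto_nhds]
    intro ε hε
    simpa only [dist_zero_right] using h0 ε hε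
  intro k
  induction k with
  | zero => intro Y _ _ d x h; exact key h
  | succ k ih =>
    intro Y _ _ d x h
    refine ⟨key h, ih fun i hi ε hε => ?_⟩
    simpa only [norm_iteratedFDeriv_fderiv] using h (i + 1) (by omega) ε hε

theorem FamCk.norm_iteratedFDeriv_lt : ∀ {k : ℕ} {Y : Type} [NormedAddCommGroup Y]
    [NormedSpace ℝ Y] {d : J → X → Y} {x : X}, d D.base = 0 → FamCk D k d x →
    ∀ i ≤ k, ∀ ε > 0, ∀ᶠ p in D.l ×ˢ 𝓝 x, ‖iteratedFDeriv ℝ i (d p.1) p.2‖ < ε := by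
  intro k
  induction k with
  | zero =>
    intro Y _ _ d x h0 h i hi ε hε
    obtain rfl : i = 0 := by omega
    have h1 := h.tendsto
    rw [h0] at h1
    simpa only [norm_iteratedFDeriv_zero, Pi.zero_apply, dist_zero_right] using
      (Metric.tendsto_nhds.1 h1) ε hε
  | succ k ih =>
    intro Y _ _ d x h0 h i hi ε hε
    cases i with
    | zero =>
      have h1 := h.tendsto
      rw [h0] at h1
      simpa only [norm_iteratedFDeriv_zero, Pi.zero_apply, dist_zero_right] using
        (Metric.tendsto_nhds.1 h1) ε hε
    | succ i =>
      have h1 := ih (d := fun j => fderiv ℝ (d j)) (x := x) (by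
        ext1 y; simp [h0]) h.2 i (by omega) ε hε
      simpa only [norm_iteratedFDeriv_fderiv] using h1

/-! ### The Whitney topology -/

/-- The filter of Whitney neighbourhoods. -/
def whitney (V : Set X) (f : X → Y) : Filter (X → Y) where
  sets := {W | IsWhitneyNhd V f W}
  univ_sets := ⟨0, fun _ => 1, continuousOn_const, fun _ _ => one_pos, fun _ _ _ => mem_univ _⟩
  sets_of_superset := by
    rintro W W' ⟨k, δ, h1, h2, h3⟩ hW
    exact ⟨k, δ, h1, h2, fun g hg hg' => hW (h3 g hg hg')⟩
  inter_sets := by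
    rintro W W' ⟨k, δ, h1, h2, h3⟩ ⟨k', δ', h1', h2', h3'⟩
    refine ⟨max k k', fun x => min (δ x) (δ' x), ContinuousOn.inf h1 h1',
      fun x hx => lt_min (h2 x hx) (h2' x hx), fun g hg hg' => ⟨?_, ?_⟩⟩
    · exact h3 g hg fun x hx i hi =>
        (hg' x hx i (hi.trans (le_max_left _ _))).trans_le (min_le_left _ _)
    · exact h3' g hg fun x hx i hi =>
        (hg' x hx i (hi.trans (le_max_right _ _))).trans_le (min_le_right _ _)

theorem mem_whitney_self {V : Set X} {f : X → Y} (hf : ContDiffOn ℝ ∞ f V) {W : Set (X → Y)}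
    (hW : W ∈ whitney V f) : f ∈ W := by
  obtain ⟨k, δ, h1, h2, h3⟩ := hW
  refine h3 f hf fun x hx i _ => ?_
  have : (fun y => f y - f y) = fun _ => (0 : Y) := by ext; simp
  rw [this]
  have h0 : iteratedFDeriv ℝ i (fun _ : X => (0 : Y)) = 0 := iteratedFDeriv_fun_zero
  rw [h0]
  simpa using h2 x hx

/-- The maps with the property `good`, in the Whitney topology at `f`. -/
def whitneyAt (V : Set X) (f : X → Y) (good : (X → Y) → Prop) (hf : ContDiffOn ℝ ∞ f V)
    (hgood : good f) : PointedFilter {g : X → Y // good g} where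
  l := comap Subtype.val (whitney V f)
  base := ⟨f, hgood⟩
  le := by
    rw [← Filter.map_le_iff_le_comap, Filter.map_pure]
    intro W hW
    exact mem_whitney_self hf hW

theorem exists_whitneyNhd_of_eventually {V : Set X} {f : X → Y} {good : (X → Y) → Prop}
    {hf : ContDiffOn ℝ ∞ f V} {hgood : good f} {R : (X → Y) → Prop}
    (h : ∀ᶠ g in (whitneyAt V f good hf hgood).l, R g.1) :
    ∃ W : Set (X → Y), IsWhitneyNhd V f W ∧ ∀ g ∈ W, good g → R g := by
  obtain ⟨W, hW, hWR⟩ := Filter.mem_comap.1 h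
  exact ⟨W, hW, fun g hg hg' => hWR (show (⟨g, hg'⟩ : {g : X → Y // good g}) ∈ _ from hg)⟩

/-- Constant functions `δ` already force every derivative of `g - f` to be uniformly small on `V`;
adding the fixed map `f` back keeps the convergence. -/
theorem famSmooth_whitneyAt {V : Set X} (hV : IsOpen V) {f : X → Y} {good : (X → Y) → Prop}
    (hf : ContDiffOn ℝ ∞ f V) (hgood : good f) (hsm : ∀ g, good g → ContDiffOn ℝ ∞ g V)
    {x : X} (hx : x ∈ V) : FamSmooth (whitneyAt V f good hf hgood) (fun g => g.1) x := by
  have hat : ∀ g, good g → ∀ y ∈ V, ContDiffAt ℝ ∞ g y := fun g hg y hy =>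
    (hsm g hg).contDiffAt (hV.mem_nhds hy)
  have hfx : ∀ᶠ y in 𝓝 x, ContDiffAt ℝ ∞ f y := by
    filter_upwards [hV.mem_nhds hx] with y hy using hat f hgood y hy
  have hev : ∀ᶠ p in (whitneyAt V f good hf hgood).l ×ˢ 𝓝 x, p.2 ∈ V :=
    eventually_of_base (hV.mem_nhds hx)
  have hd : FamSmooth (whitneyAt V f good hf hgood) (fun g y => g.1 y - f y) x := by
    refine ⟨hev.mono fun p hp => (hat _ p.1.2 _ hp).sub (hat f hgood _ hp), fun k => ?_⟩
    refine FamCk.of_iteratedFDeriv fun i hi ε hε => ?_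
    have hW : {g : X → Y | ∀ x ∈ V, ∀ i ≤ k, ‖iteratedFDeriv ℝ i (fun y => g y - f y) x‖ < ε} ∈
        whitney V f := ⟨k, fun _ => ε, continuousOn_const, fun _ _ => hε, fun g _ hg' => hg'⟩
    have h1 : ∀ᶠ g in (whitneyAt V f good hf hgood).l, ∀ x ∈ V, ∀ i ≤ k,
        ‖iteratedFDeriv ℝ i (fun y => g.1 y - f y) x‖ < ε := Filter.preimage_mem_comap hW
    filter_upwards [hev, Filter.tendsto_fst.eventually h1] with p hp hq
    exact hq _ hp i hi
  refine (hd.add (FamSmooth.of_const hfx)).congr (Eventually.of_forall fun p => ?_)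
  simp

theorem eventually_contDiff_of_compact_support {K : Set X} (hK : IsCompact K)
    {d : J → X → Y} (hd : ∀ x ∈ K, FamSmooth D d x) (h0 : ∀ j, ∀ x ∉ K, d j x = 0) :
    ∀ᶠ j in D.l, ContDiff ℝ ∞ (d j) := by
  have h1 := eventually_forall_of_isCompact (R := fun j x => ContDiffAt ℝ ∞ (d j) x) hK
    fun x hx => (hd x hx).smooth
  filter_upwards [h1] with j hj
  refine contDiff_iff_contDiffAt.2 fun x => ?_
  by_cases hx : x ∈ K
  · exact hj x hx
  · refine (contDiffAt_const (c := (0 : Y))).congr_of_eventuallyEq ?_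
    filter_upwards [hK.isClosed.isOpen_compl.mem_nhds hx] with y hy using h0 j y hy

/-- Off `K` nothing changes, and on the compact set `K` the function `δ` has a positive minimum.
Membership in the Whitney neighbourhood is thus a matter of finitely many derivatives, uniformly on
`K`. -/
theorem eventually_mem_whitney {V K : Set X} (hK : IsCompact K) (hKV : K ⊆ V)
    {f : X → Y} (hf : ContDiffOn ℝ ∞ f V)
    {d : J → X → Y} (hd : ∀ x ∈ K, FamSmooth D d x) (h0 : ∀ j, ∀ x ∉ K, d j x = 0)
    (hb : d D.base = 0) {W : Set (X → Y)} (hW : IsWhitneyNhd V f W) :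
    ∀ᶠ j in D.l, (fun x => f x + d j x) ∈ W := by
  obtain ⟨k, δ, hδ, hpos, hW⟩ := hW
  obtain ⟨ε, hε, hεδ⟩ : ∃ ε > 0, ∀ x ∈ K, ε ≤ δ x := by
    rcases K.eq_empty_or_nonempty with rfl | hne
    · exact ⟨1, one_pos, by simp⟩
    · obtain ⟨x₀, hx₀, hmin⟩ := hK.exists_isMinOn hne (hδ.mono hKV)
      exact ⟨δ x₀, hpos _ (hKV hx₀), fun x hx => hmin hx⟩
  have h2 := eventually_forall_of_isCompact (D := D)
    (R := fun j x => ∀ i ≤ k, ‖iteratedFDeriv ℝ i (d j) x‖ < ε) hK fun x hx => by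
      have := fun i (hi : i ∈ Finset.range (k + 1)) =>
        ((hd x hx).ck k).norm_iteratedFDeriv_lt hb i
          (Nat.lt_succ_iff.1 (Finset.mem_range.1 hi)) ε hε
      filter_upwards [(Filter.eventually_all_finset _).2 this] with p hp i hi
      exact hp i (Finset.mem_range.2 (Nat.lt_succ_iff.2 hi))
  filter_upwards [h2, eventually_contDiff_of_compact_support hK hd h0] with j hj hsm
  refine hW _ (hf.add hsm.contDiffOn) fun x hx i hi => ?_
  have he : (fun y => f y + d j y - f y) = d j := by ext; simp
  rw [he]
  by_cases hxK : x ∈ K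
  · exact (hj x hxK i hi).trans_le (hεδ x hxK)
  · have h3 : d j =ᶠ[𝓝 x] fun _ => 0 := by
      filter_upwards [hK.isClosed.isOpen_compl.mem_nhds hxK] with y hy using h0 j y hy
    have h4 : iteratedFDeriv ℝ i (d j) x = 0 := by
      rw [(h3.iteratedFDeriv ℝ i).eq_of_nhds]
      have h0 : iteratedFDeriv ℝ i (fun _ : X => (0 : Y)) = 0 := iteratedFDeriv_fun_zero
      rw [h0]; rfl
    rw [h4, norm_zero]
    exact hpos x hx

end Families

end OddLagrangian

namespace OddLagrangian

/-! ### Inverse function theorem, uniform over a convergent family -/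

section Inverse

open Metric

variable {J : Type} {D : PointedFilter J} {X Y : Type}
  [NormedAddCommGroup X] [NormedSpace ℝ X] [NormedAddCommGroup Y] [NormedSpace ℝ Y]

/-- `h` is a smooth family of inverses of the members of the family `f`, which maps the ball of
radius `r` about `f D.base x₀` into the ball of radius `ε` about `x₀`. -/
structure IsFamInverse (D : PointedFilter J) (f : J → X → Y) (x₀ : X) (ε r : ℝ) (h : J → Y → X) :
    Prop where
  eps_pos : 0 < ε
  r_pos : 0 < r
  base_mem : ∀ y ∈ ball (f D.base x₀) r, h D.base y ∈ ball x₀ ε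
  famSmooth : ∀ y ∈ ball (f D.base x₀) r, FamSmooth D h y
  smooth : ∀ᶠ j in D.l, ∀ x ∈ ball x₀ ε, ContDiffAt ℝ ∞ (f j) x
  invertible : ∀ᶠ j in D.l, ∀ x ∈ ball x₀ ε, (fderiv ℝ (f j) x).IsInvertible
  left_inv : ∀ᶠ j in D.l, ∀ x ∈ ball x₀ ε, f j x ∈ ball (f D.base x₀) r → h j (f j x) = x
  injOn : ∀ᶠ j in D.l, InjOn (f j) (ball x₀ ε)
  mem : ∀ᶠ j in D.l, ∀ y ∈ ball (f D.base x₀) r, h j y ∈ ball x₀ ε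
  right_inv : ∀ᶠ j in D.l, ∀ y ∈ ball (f D.base x₀) r, f j (h j y) = y
  smooth_inv : ∀ᶠ j in D.l, ∀ y ∈ ball (f D.base x₀) r, ContDiffAt ℝ ∞ (h j) y

/-- All members with derivative close to that of the limit member are approximated on one ball by
the same linear isomorphism `e` with the same constant. Injectivity and the size of the image then
follow with common radii. -/
theorem exists_famInverse [CompleteSpace X] [CompleteSpace Y] {f : J → X → Y} {x₀ : X}
    {O : Set X} (hO : O ∈ 𝓝 x₀) (hf : ∀ x ∈ O, FamSmooth D f x)
    (hinv : (fderiv ℝ (f D.base) x₀).IsInvertible) :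
    ∃ (ε r : ℝ) (h : J → Y → X), ball x₀ ε ⊆ O ∧ IsFamInverse D f x₀ ε r h := by
  classical
  obtain ⟨e, he⟩ := hinv
  set N := ‖(e.symm : Y →L[ℝ] X)‖₊ with hN
  -- The constant has to lie strictly below `N⁻¹`. In the trivial space `N = 0`, no such positive
  -- constant exists and none is needed.
  set c : NNReal := if Subsingleton X then 1 else N⁻¹ / 2 with hc
  have hcN : Subsingleton X ∨ c < N⁻¹ := by
    by_cases hX : Subsingleton X
    · exact Or.inl hX
    · right
      have : Nontrivial X := not_subsingleton_iff_nontrivial.1 hX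
      rw [hc, if_neg hX]
      have hpos : 0 < N := e.nnnorm_symm_pos
      exact NNReal.half_lt_self (inv_ne_zero hpos.ne')
  have hcpos : 0 < c := by
    by_cases hX : Subsingleton X
    · simp [hc, hX]
    · have : Nontrivial X := not_subsingleton_iff_nontrivial.1 hX
      have hpos : 0 < N := e.nnnorm_symm_pos
      rw [hc, if_neg hX]; positivity
  have hx₀ : x₀ ∈ O := mem_of_mem_nhds hO
  -- uniform closeness of the derivatives
  have hder : ∀ᶠ p in D.l ×ˢ 𝓝 x₀, p.2 ∈ O ∧ ContDiffAt ℝ ∞ (f p.1) p.2 ∧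
      ‖fderiv ℝ (f p.1) p.2 - e‖ < c ∧ (fderiv ℝ (f p.1) p.2).IsInvertible := by
    have h1 := (hf x₀ hx₀).fderiv.tendsto
    have h2 := Metric.tendsto_nhds.1 h1 c (by exact_mod_cast hcpos)
    have h3 := h1.eventually (by rw [← he]; exact ContinuousLinearEquiv.nhds e)
    filter_upwards [eventually_of_base hO, (hf x₀ hx₀).smooth, h2, h3] with p h1 h2 h3 h4
    refine ⟨h1, h2, ?_, ?_⟩
    · rw [← he, dist_eq_norm] at h3; exact h3
    · obtain ⟨e', he'⟩ := h4
      exact ⟨e', he'⟩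
  obtain ⟨A, hA, B, hB, hAB⟩ := Filter.eventually_prod_iff.1 hder
  obtain ⟨ε, hε, hεB⟩ := Metric.mem_nhds_iff.1 hB
  have hgood : ∀ j, A j → ∀ x ∈ ball x₀ ε, x ∈ O ∧ ContDiffAt ℝ ∞ (f j) x ∧
      ‖fderiv ℝ (f j) x - e‖ < c ∧ (fderiv ℝ (f j) x).IsInvertible :=
    fun j hj x hx => hAB hj (hεB hx)
  have happ : ∀ j, A j → ApproximatesLinearOn (f j) (e : X →L[ℝ] Y) (ball x₀ ε) c := by
    intro j hj x hx y hy
    refine (convex_ball x₀ ε).norm_image_sub_le_of_norm_hasFDerivWithin_le'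
      (f' := fun z => fderiv ℝ (f j) z) (fun z hz => ?_) (fun z hz => ?_) hy hx
    · exact (differentiableAt_of_smooth (hgood j hj z hz).2.1).hasFDerivAt.hasFDerivWithinAt
    · exact (hgood j hj z hz).2.2.1.le
  have hAbase : A D.base := by
    have := D.le hA
    exact this
  obtain ⟨r, hr, hrA⟩ : ∃ r > 0, ∀ᶠ j in D.l, A j ∧
      ball (f D.base x₀) r ⊆ f j '' ball x₀ ε := by
    by_cases hX : Subsingleton X
    · refine ⟨1, one_pos, hA.mono fun j hj => ⟨hj, fun y _ => ⟨x₀, mem_ball_self hε, ?_⟩⟩⟩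
      have : Subsingleton Y := e.toEquiv.subsingleton_congr.1 hX
      exact Subsingleton.elim _ _
    · have hcN' : (0 : ℝ) < (N : ℝ)⁻¹ - c := by
        have := hcN.resolve_left hX
        rw [sub_pos]; exact_mod_cast this
      -- The image of each member contains a ball of radius `(N⁻¹ - c) (ε / 2)` about its own centre
      -- `f j x₀`. Half of this is given up because the centres move with `j`.
      refine ⟨((N : ℝ)⁻¹ - c) * (ε / 2) / 2, by positivity, ?_⟩
      have h1 : Tendsto (fun j => f j x₀) D.l (𝓝 (f D.base x₀)) :=
        (hf x₀ hx₀).tendsto.comp (tendsto_id.prodMk (tendsto_const_nhds (x := x₀)))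
      filter_upwards [hA, Metric.tendsto_nhds.1 h1 (((N : ℝ)⁻¹ - c) * (ε / 2) / 2)
        (by positivity)] with j hj hj'
      refine ⟨hj, ?_⟩
      have h2 := (happ j hj).closedBall_subset_target hcN isOpen_ball (b := x₀) (ε := ε / 2)
        (by positivity) (closedBall_subset_ball (by linarith))
      refine Subset.trans (fun y hy => ?_) h2
      rw [mem_closedBall]
      rw [mem_ball] at hy
      have := dist_triangle_right y (f j x₀) (f D.base x₀)
      refine this.trans ?_
      have h5 : dist (f j x₀) (f D.base x₀) < ((N : ℝ)⁻¹ - c) * (ε / 2) / 2 := hj'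
      change _ ≤ (((N⁻¹ : NNReal) : ℝ) - c) * (ε / 2)
      rw [NNReal.coe_inv]
      linarith
  have hrbase : ball (f D.base x₀) r ⊆ f D.base '' ball x₀ ε := by
    have := D.le hrA
    exact this.2
  set h : J → Y → X := fun j y => Function.invFunOn (f j) (ball x₀ ε) y with hh
  have hmem : ∀ j, ∀ y ∈ f j '' ball x₀ ε, h j y ∈ ball x₀ ε := fun j y hy =>
    Function.invFunOn_mem hy
  have hright : ∀ j, ∀ y ∈ f j '' ball x₀ ε, f j (h j y) = y := fun j y hy =>
    Function.invFunOn_eq hy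
  have hinj : ∀ j, A j → InjOn (f j) (ball x₀ ε) := fun j hj => (happ j hj).injOn hcN
  have hleft : ∀ j, A j → ∀ x ∈ ball x₀ ε, h j (f j x) = x := fun j hj x hx =>
    hinj j hj (hmem j _ (mem_image_of_mem _ hx)) hx (hright j _ (mem_image_of_mem _ hx))
  have hsm : ∀ j, A j → ∀ y ∈ f j '' ball x₀ ε, ContDiffAt ℝ ∞ (h j) y ∧
      fderiv ℝ (h j) y = (fderiv ℝ (f j) (h j y)).inverse := by
    intro j hj y hy
    set E := (happ j hj).toOpenPartialHomeomorph (f j) (ball x₀ ε) hcN isOpen_ball with hE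
    have hyt : y ∈ E.target := hy
    have heq : ∀ z ∈ E.target, E.symm z = h j z := by
      intro z hz
      have h1 : E.symm z ∈ ball x₀ ε := E.map_target hz
      refine hinj j hj h1 (hmem j z hz) ?_
      rw [hright j z hz]
      exact E.right_inv hz
    have hev : h j =ᶠ[𝓝 y] E.symm := by
      filter_upwards [E.open_target.mem_nhds hyt] with z hz using (heq z hz).symm
    obtain ⟨e', he'⟩ := (hgood j hj _ (hmem j y hy)).2.2.2
    have hsy : E.symm y = h j y := heq y hyt
    have hdiff : HasFDerivAt E (e' : X →L[ℝ] Y) (E.symm y) := by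
      rw [hsy, he']
      exact (differentiableAt_of_smooth (hgood j hj _ (hmem j y hy)).2.1).hasFDerivAt
    constructor
    · refine ContDiffAt.congr_of_eventuallyEq ?_ hev
      refine E.contDiffAt_symm hyt hdiff ?_
      rw [hsy]
      exact (hgood j hj _ (hmem j y hy)).2.1
    · rw [hev.fderiv_eq, ← he', ContinuousLinearMap.inverse_equiv]
      exact (E.hasFDerivAt_symm hyt hdiff).fderiv
  refine ⟨ε, r, h, fun x hx => (hgood _ hAbase x hx).1, ?_⟩
  refine ⟨hε, hr, fun y hy => hmem _ y (hrbase hy), fun y hy => ?_, ?_, ?_, ?_, ?_, ?_, ?_, ?_⟩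
  · have hev : ∀ᶠ p in D.l ×ˢ 𝓝 y, A p.1 ∧ p.2 ∈ ball (f D.base x₀) r ∧
        p.2 ∈ f p.1 '' ball x₀ ε := by
      filter_upwards [Filter.tendsto_fst.eventually hrA,
        eventually_of_base (isOpen_ball.mem_nhds hy)] with p hp hq
      exact ⟨hp.1, hq, hp.2 hq⟩
    have hyb : h D.base y ∈ ball x₀ ε := hmem _ y (hrbase hy)
    have hfh := hf _ (hgood _ hAbase _ hyb).1
    have hs : ∀ᶠ p in D.l ×ˢ 𝓝 y, ContDiffAt ℝ ∞ (h p.1) p.2 :=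
      hev.mono fun p hp => (hsm p.1 hp.1 p.2 hp.2.2).1
    have h0 : Tendsto (fun p : J × Y => h p.1 p.2) (D.l ×ˢ 𝓝 y) (𝓝 (h D.base y)) := by
      by_cases hX : Subsingleton X
      · have : (fun p : J × Y => h p.1 p.2) = fun _ => h D.base y := by
          ext; exact Subsingleton.elim _ _
        rw [this]; exact tendsto_const_nhds
      have h1 : Tendsto (fun p : J × Y => f p.1 (h D.base y)) (D.l ×ˢ 𝓝 y) (𝓝 y) := by
        have := hfh.tendsto.comp ((Filter.tendsto_fst (f := D.l) (g := 𝓝 y)).prodMk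
          (tendsto_const_nhds (x := h D.base y)))
        rwa [hright _ _ (hrbase hy)] at this
      -- The common antilipschitz bound compares `h j y'` with the fixed point `h D.base y` through
      -- their images `y'` and `f j (h D.base y)`, both of which tend to `y`.
      have h2 : Tendsto (fun p : J × Y => ((N⁻¹ - c)⁻¹ : NNReal) * dist p.2 (f p.1 (h D.base y)))
          (D.l ×ˢ 𝓝 y) (𝓝 (((N⁻¹ - c)⁻¹ : NNReal) * dist y y)) :=
        (Filter.tendsto_snd.dist h1).const_mul _
      rw [dist_self, mul_zero] at h2
      refine tendsto_iff_dist_tendsto_zero.2 (squeeze_zero' (Eventually.of_forall fun _ =>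
        dist_nonneg) ?_ h2)
      filter_upwards [hev] with p hp
      have h3 := ((happ p.1 hp.1).antilipschitz hcN).le_mul_dist
        ⟨h p.1 p.2, hmem _ _ hp.2.2⟩ ⟨h D.base y, hyb⟩
      rw [Subtype.dist_eq] at h3
      refine h3.trans (le_of_eq ?_)
      congr 2
      exact hright _ _ hp.2.2
    refine ⟨hs, fun k => ?_⟩
    -- The derivative of `h j` is the inverse of `fderiv (f j)` taken at `h j`, so convergence of
    -- `h` to order `k` gives convergence of its derivative to order `k`.
    induction k with
    | zero => exact h0
    | succ k ih =>
      refine ⟨h0, ?_⟩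
      have h4 := FamCk.comp hfh.fderiv hs ih
      have hinv := (hgood _ hAbase _ hyb).2.2.2
      have hsmi : ∀ᶠ z in 𝓝 (fderiv ℝ (f D.base) (h D.base y)),
          ContDiffAt ℝ ∞ (ContinuousLinearMap.inverse (R := ℝ) (M := X) (M₂ := Y)) z := by
        obtain ⟨e', he'⟩ := hinv
        have := ContinuousLinearEquiv.nhds e'
        rw [he'] at this
        filter_upwards [this] with z hz
        obtain ⟨e'', rfl⟩ := hz
        exact contDiffAt_map_inverse e''
      have hs2 := contDiffAt_comp_family (g := fun j => fderiv ℝ (f j)) hfh.fderiv.smooth h0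
      refine (FamCk.comp (g := fun _ => ContinuousLinearMap.inverse)
        (FamSmooth.of_const hsmi) ?_ h4).congr ?_
      · filter_upwards [hs2, hs] with p hp hq using hp.comp p.2 hq
      · filter_upwards [hev] with p hp using ((hsm p.1 hp.1 p.2 hp.2.2).2).symm
  · exact hrA.mono fun j hj x hx => (hgood j hj.1 x hx).2.1
  · exact hrA.mono fun j hj x hx => (hgood j hj.1 x hx).2.2.2
  · exact hrA.mono fun j hj x hx _ => hleft j hj.1 x hx
  · exact hrA.mono fun j hj => hinj j hj.1
  · exact hrA.mono fun j hj y hy => hmem j y (hj.2 hy)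
  · exact hrA.mono fun j hj y hy => hright j y (hj.2 hy)
  · exact hrA.mono fun j hj y hy => (hsm j hj.1 y (hj.2 hy)).1

end Inverse

end OddLagrangian

namespace OddLagrangian

/-! ### Hadamard's lemma with parameters -/

section Hadamard

open MeasureTheory

variable {X Y R Z : Type} [NormedAddCommGroup X] [NormedSpace ℝ X]
  [NormedAddCommGroup Y] [NormedSpace ℝ Y] [NormedAddCommGroup R] [NormedSpace ℝ R]
  [NormedAddCommGroup Z] [NormedSpace ℝ Z]

/-- The partial derivative in the first variable. -/
noncomputable def fderivFst (f : X × ℝ → Z) (p : X × ℝ) : X →L[ℝ] Z :=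
  (fderiv ℝ f p).comp (ContinuousLinearMap.inl ℝ X ℝ)

theorem contDiffAt_fderivFst {f : X × ℝ → Z} {p : X × ℝ} (h : ContDiffAt ℝ ∞ f p) :
    ContDiffAt ℝ ∞ (fderivFst f) p :=
  (contDiffAt_fderiv h).clm_comp contDiffAt_const

theorem continuousOn_slice {f : X × ℝ → Z} {x : X}
    (h : ∀ t ∈ Icc (0 : ℝ) 1, ContDiffAt ℝ ∞ f (x, t)) :
    ContinuousOn (fun t => f (x, t)) (Icc 0 1) := fun t ht =>
  ((h t ht).continuousAt.comp (f := fun t : ℝ => (x, t)) (by fun_prop)).continuousWithinAt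

theorem hasFDerivAt_integral_unitInterval {O : Set X} (hO : IsOpen O)
    {f : X × ℝ → Z} (hf : ∀ x ∈ O, ∀ t ∈ Icc (0 : ℝ) 1, ContDiffAt ℝ ∞ f (x, t)) {x : X}
    (hx : x ∈ O) : HasFDerivAt (fun x => ∫ t in (0 : ℝ)..1, f (x, t))
      (∫ t in (0 : ℝ)..1, fderivFst f (x, t)) x := by
  have huIcc : uIcc (0 : ℝ) 1 = Icc 0 1 := uIcc_of_le zero_le_one
  have hsub : uIoc (0 : ℝ) 1 ⊆ Icc 0 1 := by rw [uIoc_of_le zero_le_one]; exact Ioc_subset_Icc_self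
  have hcD := continuousOn_slice fun t ht => contDiffAt_fderivFst (hf x hx t ht)
  obtain ⟨C, hC⟩ := isCompact_Icc.exists_bound_of_continuousOn hcD
  have hb : ∀ᶠ y in 𝓝 x, ∀ t ∈ Icc (0 : ℝ) 1, ‖fderivFst f (y, t)‖ < C + 1 := by
    refine isCompact_Icc.eventually_forall_of_forall_eventually fun t ht => ?_
    have := (contDiffAt_fderivFst (hf x hx t ht)).continuousAt.norm
    exact this.eventually_lt continuousAt_const ((hC t ht).trans_lt (lt_add_one C))
  refine intervalIntegral.hasFDerivAt_integral_of_dominated_of_fderiv_le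
    (F' := fun x t => fderivFst f (x, t)) (bound := fun _ => C + 1)
    (s := {y | y ∈ O ∧ ∀ t ∈ Icc (0 : ℝ) 1, ‖fderivFst f (y, t)‖ < C + 1}) ?_ ?_ ?_ ?_ ?_ ?_ ?_
  · filter_upwards [hO.mem_nhds hx, hb] with y h1 h2 using ⟨h1, h2⟩
  · filter_upwards [hO.mem_nhds hx] with y hy
    exact ((continuousOn_slice (hf y hy)).mono hsub).aestronglyMeasurable measurableSet_uIoc
  · refine ContinuousOn.intervalIntegrable ?_
    rw [huIcc]
    exact continuousOn_slice (hf x hx)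
  · exact (hcD.mono hsub).aestronglyMeasurable measurableSet_uIoc
  · exact Eventually.of_forall fun t ht y hy => (hy.2 t (hsub ht)).le
  · exact intervalIntegrable_const
  · refine Eventually.of_forall fun t ht y hy => ?_
    have h1 := (differentiableAt_of_smooth (hf y hy.1 t (hsub ht))).hasFDerivAt
    exact h1.comp y (hasFDerivAt_prodMk_left y t)

theorem contDiffOn_integral_unitInterval {O : Set X} (hO : IsOpen O) :
    ∀ (n : ℕ) {Z : Type} [NormedAddCommGroup Z] [NormedSpace ℝ Z]
    {f : X × ℝ → Z}, (∀ x ∈ O, ∀ t ∈ Icc (0 : ℝ) 1, ContDiffAt ℝ ∞ f (x, t)) →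
    ContDiffOn ℝ n (fun x => ∫ t in (0 : ℝ)..1, f (x, t)) O
  | 0, Z, _, _, f, hf => by
    have : ContinuousOn (fun x => ∫ t in (0 : ℝ)..1, f (x, t)) O := fun x hx =>
      (hasFDerivAt_integral_unitInterval hO hf hx).continuousAt.continuousWithinAt
    simpa using this
  | n + 1, Z, _, _, f, hf => by
    push_cast
    rw [contDiffOn_succ_iff_fderiv_of_isOpen hO]
    refine ⟨fun x hx => (hasFDerivAt_integral_unitInterval hO hf hx).differentiableAt
      |>.differentiableWithinAt, by simp, ?_⟩
    refine (contDiffOn_integral_unitInterval hO n (f := fderivFst f) fun x hx t ht =>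
      contDiffAt_fderivFst (hf x hx t ht)).congr fun x hx => ?_
    exact (hasFDerivAt_integral_unitInterval hO hf hx).fderiv

/-- Since `F` vanishes at `r = 0`, the fundamental theorem of calculus along `t ↦ (y, t r)` gives `F
(y, r) = (∫₀¹ ∂F/∂r (y, t r) dt) r`. Smoothness of the coefficient is differentiation under the
integral. -/
theorem exists_hadamard [CompleteSpace Z] {F : Y × R → Z} {y₀ : Y}
    (hF : ∀ᶠ p in 𝓝 (y₀, (0 : R)), ContDiffAt ℝ ∞ F p) (h0 : ∀ᶠ y in 𝓝 y₀, F (y, 0) = 0) :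
    ∃ g : Y × R → (R →L[ℝ] Z), (∀ᶠ p in 𝓝 (y₀, (0 : R)), ContDiffAt ℝ ∞ g p) ∧
      (∀ᶠ p in 𝓝 (y₀, (0 : R)), F p = g p p.2) ∧
      ∀ y, g (y, 0) = (fderiv ℝ F (y, 0)).comp (ContinuousLinearMap.inr ℝ Y R) := by
  obtain ⟨ε, hε, hball⟩ := Metric.mem_nhds_iff.1 hF
  set O := Metric.ball (y₀, (0 : R)) ε with hO
  have hscale : ∀ p ∈ O, ∀ t ∈ Icc (0 : ℝ) 1, (p.1, t • p.2) ∈ O := by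
    intro p hp t ht
    rw [hO, Metric.mem_ball, Prod.dist_eq, max_lt_iff] at hp ⊢
    refine ⟨hp.1, ?_⟩
    simp only [dist_zero_right, norm_smul, Real.norm_eq_abs, abs_of_nonneg ht.1] at hp ⊢
    exact (mul_le_of_le_one_left (norm_nonneg _) ht.2).trans_lt hp.2
  have hmul : ∀ p : (Y × R) × ℝ, ContDiffAt ℝ ∞ (fun p : (Y × R) × ℝ => (p.1.1, p.2 • p.1.2)) p :=
    fun p => (contDiff_fst.fst.prodMk (contDiff_snd.smul contDiff_fst.snd)).contDiffAt
  set G : (Y × R) × ℝ → (R →L[ℝ] Z) := fun p =>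
    (fderiv ℝ F (p.1.1, p.2 • p.1.2)).comp (ContinuousLinearMap.inr ℝ Y R) with hG
  have hGs : ∀ p ∈ O, ∀ t ∈ Icc (0 : ℝ) 1, ContDiffAt ℝ ∞ G (p, t) := fun p hp t ht =>
    ((contDiffAt_fderiv (hball (hscale p hp t ht))).comp (p, t) (hmul (p, t))).clm_comp
      contDiffAt_const
  have hOmem : O ∈ 𝓝 (y₀, (0 : R)) := Metric.ball_mem_nhds _ hε
  refine ⟨fun p => ∫ t in (0 : ℝ)..1, G (p, t), ?_, ?_, ?_⟩
  · have : ContDiffOn ℝ ∞ (fun p => ∫ t in (0 : ℝ)..1, G (p, t)) O :=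
      contDiffOn_infty.2 fun n => contDiffOn_integral_unitInterval Metric.isOpen_ball n hGs
    filter_upwards [hOmem] with p hp using this.contDiffAt (Metric.isOpen_ball.mem_nhds hp)
  · have h0' : ∀ᶠ p in 𝓝 (y₀, (0 : R)), F (p.1, 0) = 0 :=
      (continuous_fst.tendsto (y₀, (0 : R))).eventually h0
    filter_upwards [hOmem, h0'] with p hp hp0
    have hint : IntervalIntegrable (fun t => G (p, t)) volume 0 1 := by
      refine ContinuousOn.intervalIntegrable ?_
      rw [uIcc_of_le zero_le_one]
      exact continuousOn_slice (hGs p hp)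
    rw [ContinuousLinearMap.intervalIntegral_apply hint]
    have h1 : ∀ t ∈ uIcc (0 : ℝ) 1,
        HasDerivAt (fun t => F (p.1, t • p.2)) (G (p, t) p.2) t := by
      intro t ht
      rw [uIcc_of_le zero_le_one] at ht
      have h2 := (differentiableAt_of_smooth (hball (hscale p hp t ht))).hasFDerivAt
      have h3 : HasDerivAt (fun t : ℝ => (p.1, t • p.2)) ((0 : Y), p.2) t := by
        have := (hasDerivAt_const t p.1).prodMk ((hasDerivAt_id t).smul_const p.2)
        simpa using this
      exact h2.comp_hasDerivAt t h3
    have hint2 : IntervalIntegrable (fun t => G (p, t) p.2) volume 0 1 := by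
      refine ContinuousOn.intervalIntegrable ?_
      rw [uIcc_of_le zero_le_one]
      exact (continuousOn_slice (hGs p hp)).clm_apply continuousOn_const
    rw [intervalIntegral.integral_eq_sub_of_hasDerivAt h1 hint2]
    simp [hp0]
  · intro y
    simp [hG]

/-- A function that vanishes to second order on `{r = 0}` is a quadratic form in `r` with smooth
coefficients. -/
theorem exists_hadamard_two [CompleteSpace Z] {F : Y × R → Z} {y₀ : Y}
    (hF : ∀ᶠ p in 𝓝 (y₀, (0 : R)), ContDiffAt ℝ ∞ F p) (h0 : ∀ᶠ y in 𝓝 y₀, F (y, 0) = 0)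
    (h1 : ∀ᶠ y in 𝓝 y₀, (fderiv ℝ F (y, 0)).comp (ContinuousLinearMap.inr ℝ Y R) = 0) :
    ∃ B : Y × R → (R →L[ℝ] R →L[ℝ] Z), (∀ᶠ p in 𝓝 (y₀, (0 : R)), ContDiffAt ℝ ∞ B p) ∧
      ∀ᶠ p in 𝓝 (y₀, (0 : R)), F p = B p p.2 p.2 := by
  obtain ⟨g, hg, hFg, hg0⟩ := exists_hadamard hF h0
  obtain ⟨B, hB, hgB, -⟩ := exists_hadamard hg (h1.mono fun y hy => (hg0 y).trans hy)
  refine ⟨B, hB, ?_⟩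
  filter_upwards [hFg, hgB] with p hp hq
  rw [hp, hq]

end Hadamard

end OddLagrangian

namespace OddLagrangian

/-! ### Germs of diffeomorphisms -/

theorem eq_zero_of_eq_neg {X : Type} [AddCommGroup X] [Module ℝ X] {x : X} (h : x = -x) :
    x = 0 := by
  have h2 : (2 : ℝ) • x = 0 := by rw [two_smul]; nth_rewrite 2 [h]; exact add_neg_cancel x
  exact (smul_eq_zero.1 h2).resolve_left two_ne_zero

section Charts

variable {X Y Z : Type} [NormedAddCommGroup X] [NormedSpace ℝ X]
  [NormedAddCommGroup Y] [NormedSpace ℝ Y] [NormedAddCommGroup Z] [NormedSpace ℝ Z]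

theorem isInvertible_of_injective [FiniteDimensional ℝ X] [FiniteDimensional ℝ Y]
    (h : Module.finrank ℝ X = Module.finrank ℝ Y) {A : X →L[ℝ] Y} (hA : ∀ x, A x = 0 → x = 0) :
    A.IsInvertible := by
  have hinj : Function.Injective (A : X →ₗ[ℝ] Y) := by
    rw [injective_iff_map_eq_zero]; exact hA
  exact ⟨(LinearMap.linearEquivOfInjective (A : X →ₗ[ℝ] Y) hinj h).toContinuousLinearEquiv, by
    ext x; simp⟩

theorem IsInvertible.eq_zero {A : X →L[ℝ] Y} (hA : A.IsInvertible) {x : X} (hx : A x = 0) :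
    x = 0 := by
  obtain ⟨e, rfl⟩ := hA
  simpa using hx

theorem IsInvertible.eventually [CompleteSpace X] {A : X →L[ℝ] Y} (hA : A.IsInvertible) :
    ∀ᶠ B in 𝓝 A, B.IsInvertible := by
  obtain ⟨e, rfl⟩ := hA
  filter_upwards [ContinuousLinearEquiv.nhds e] with B hB
  obtain ⟨e', rfl⟩ := hB
  exact ⟨e', rfl⟩

theorem exists_chart [CompleteSpace X] {f : X → Y} {x₀ : X} {N : Set X} (hN : N ∈ 𝓝 x₀)
    (hf : ∀ᶠ x in 𝓝 x₀, ContDiffAt ℝ ∞ f x) (hinv : (fderiv ℝ f x₀).IsInvertible) :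
    ∃ e : OpenPartialHomeomorph X Y, x₀ ∈ e.source ∧ e.source ⊆ N ∧ (∀ x, e x = f x) ∧
      (∀ x ∈ e.source, ContDiffAt ℝ ∞ f x) ∧ (∀ y ∈ e.target, ContDiffAt ℝ ∞ e.symm y) ∧
      ∀ x ∈ e.source, (fderiv ℝ f x).IsInvertible := by
  obtain ⟨e', he'⟩ := id hinv
  have hf0 := hf.self_of_nhds
  have hd : HasFDerivAt f (e' : X →L[ℝ] Y) x₀ := by
    rw [he']; exact (differentiableAt_of_smooth hf0).hasFDerivAt
  set e₀ := hf0.toOpenPartialHomeomorph f hd (by norm_num) with he₀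
  have hev : ∀ᶠ x in 𝓝 x₀, x ∈ N ∧ ContDiffAt ℝ ∞ f x ∧ (fderiv ℝ f x).IsInvertible := by
    have h3 := (contDiffAt_fderiv hf0).continuousAt.eventually (IsInvertible.eventually hinv)
    filter_upwards [hN, hf, h3] with x h1 h2 h3 using ⟨h1, h2, h3⟩
  obtain ⟨O, hO, hOo, hxO⟩ := eventually_nhds_iff.1 hev
  have hsrc : (e₀.restrOpen O hOo).source = e₀.source ∩ O := e₀.restrOpen_source O hOo
  refine ⟨e₀.restrOpen O hOo, ?_, ?_, fun x => rfl, ?_, ?_, ?_⟩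
  · rw [hsrc]
    exact ⟨hf0.mem_toOpenPartialHomeomorph_source hd (by norm_num), hxO⟩
  · rw [hsrc]; exact fun x hx => (hO x hx.2).1
  · rw [hsrc]; exact fun x hx => (hO x hx.2).2.1
  · intro y hy
    have h1 := (e₀.restrOpen O hOo).map_target hy
    rw [hsrc] at h1
    obtain ⟨-, h2, e'', h3⟩ := hO _ h1.2
    refine (e₀.restrOpen O hOo).contDiffAt_symm hy (f₀' := e'') ?_ h2
    rw [h3]
    exact (differentiableAt_of_smooth h2).hasFDerivAt
  · rw [hsrc]; exact fun x hx => (hO x hx.2).2.2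

theorem isDiffeoGerm_iff [CompleteSpace X] {Φ : X → X} {x y : X} : IsDiffeoGerm Φ x y ↔
    Φ x = y ∧ (∀ᶠ q in 𝓝 x, ContDiffAt ℝ ∞ Φ q) ∧ (fderiv ℝ Φ x).IsInvertible := by
  constructor
  · rintro ⟨e, hx, hy, hs, hs', hΦ⟩
    have hev : ∀ᶠ q in 𝓝 x, ContDiffAt ℝ ∞ e q := by
      filter_upwards [e.open_source.mem_nhds hx] with q hq
      exact hs.contDiffAt (e.open_source.mem_nhds hq)
    refine ⟨hΦ.eq_of_nhds.trans hy, ?_, ?_⟩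
    · filter_upwards [hev, hΦ.eventuallyEq_nhds] with q hq hq' using hq.congr_of_eventuallyEq hq'
    · rw [hΦ.fderiv_eq]
      have hxt : e x ∈ e.target := e.map_source hx
      have h1 := (differentiableAt_of_smooth hev.self_of_nhds).hasFDerivAt
      have h2 := (differentiableAt_of_smooth
        (hs'.contDiffAt (e.open_target.mem_nhds hxt))).hasFDerivAt
      have h3 : HasFDerivAt e (fderiv ℝ e x) (e.symm (e x)) := by rwa [e.left_inv hx]
      have h4 : (fderiv ℝ e.symm (e x)).comp (fderiv ℝ e x) = ContinuousLinearMap.id ℝ X := by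
        refine ((h2.comp x h1).congr_of_eventuallyEq ?_).unique (hasFDerivAt_id x)
        filter_upwards [e.open_source.mem_nhds hx] with q hq using (e.left_inv hq).symm
      have h5 : (fderiv ℝ e x).comp (fderiv ℝ e.symm (e x)) = ContinuousLinearMap.id ℝ X := by
        refine ((h3.comp (e x) h2).congr_of_eventuallyEq ?_).unique (hasFDerivAt_id _)
        filter_upwards [e.open_target.mem_nhds hxt] with q hq using (e.right_inv hq).symm
      exact ⟨ContinuousLinearEquiv.equivOfInverse _ (fderiv ℝ e.symm (e x))
        (fun v => DFunLike.congr_fun h4 v) (fun v => DFunLike.congr_fun h5 v), rfl⟩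
  · rintro ⟨rfl, hs, hinv⟩
    obtain ⟨e, hx, -, he, h1, h2, -⟩ := exists_chart univ_mem hs hinv
    have hfe : ⇑e = Φ := funext he
    refine ⟨e, hx, he x, ?_, fun y hy => (h2 y hy).contDiffWithinAt, ?_⟩
    · rw [hfe]; exact fun q hq => (h1 q hq).contDiffWithinAt
    · rw [hfe]

theorem IsDiffeoGerm.congr [CompleteSpace X] {Φ Ψ : X → X} {x y : X} (h : IsDiffeoGerm Φ x y)
    (hΨ : Φ =ᶠ[𝓝 x] Ψ) : IsDiffeoGerm Ψ x y := by
  obtain ⟨e, h1, h2, h3, h4, h5⟩ := h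
  exact ⟨e, h1, h2, h3, h4, hΨ.symm.trans h5⟩

theorem IsDiffeoGerm.tendsto [CompleteSpace X] {Φ : X → X} {x y : X} (h : IsDiffeoGerm Φ x y) :
    Tendsto Φ (𝓝 x) (𝓝 y) := by
  obtain ⟨h1, h2, -⟩ := isDiffeoGerm_iff.1 h
  have := h2.self_of_nhds.continuousAt.tendsto
  rwa [h1] at this

theorem IsDiffeoGerm.comp [CompleteSpace X] {Φ Ψ : X → X} {x y z : X} (hΨ : IsDiffeoGerm Ψ y z)
    (hΦ : IsDiffeoGerm Φ x y) : IsDiffeoGerm (fun q => Ψ (Φ q)) x z := by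
  have ht := hΦ.tendsto
  obtain ⟨h1, h2, h3⟩ := isDiffeoGerm_iff.1 hΦ
  obtain ⟨g1, g2, g3⟩ := isDiffeoGerm_iff.1 hΨ
  refine isDiffeoGerm_iff.2 ⟨by rw [h1, g1], ?_, ?_⟩
  · filter_upwards [h2, ht.eventually g2] with q hq hq' using hq'.comp q hq
  · have h4 := (differentiableAt_of_smooth h2.self_of_nhds).hasFDerivAt
    have h5 : HasFDerivAt Ψ (fderiv ℝ Ψ y) (Φ x) := by
      rw [h1]; exact (differentiableAt_of_smooth g2.self_of_nhds).hasFDerivAt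
    have h6 : fderiv ℝ (fun q => Ψ (Φ q)) x = (fderiv ℝ Ψ y).comp (fderiv ℝ Φ x) :=
      (h5.comp x h4).fderiv
    rw [h6]
    exact g3.comp h3

/-- The inverse of a diffeomorphism germ. -/
theorem IsDiffeoGerm.exists_inverse [CompleteSpace X] {Φ : X → X} {x y : X}
    (h : IsDiffeoGerm Φ x y) : ∃ Ψ : X → X, IsDiffeoGerm Ψ y x ∧ (∀ᶠ q in 𝓝 x, Ψ (Φ q) = q) ∧
      ∀ᶠ q in 𝓝 y, Φ (Ψ q) = q := by
  obtain ⟨e, hx, hy, hs, hs', hΦ⟩ := h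
  have hyt : y ∈ e.target := hy ▸ e.map_source hx
  have hyx : e.symm y = x := by rw [← hy, e.left_inv hx]
  refine ⟨e.symm, ⟨e.symm, hyt, hyx, hs', hs, EventuallyEq.rfl⟩, ?_, ?_⟩
  · filter_upwards [hΦ, e.open_source.mem_nhds hx] with q hq hq'
    rw [hq, e.left_inv hq']
  · have h1 : Tendsto e.symm (𝓝 y) (𝓝 x) := by
      have := (e.continuousAt_symm hyt).tendsto
      rwa [hyx] at this
    filter_upwards [h1.eventually hΦ, e.open_target.mem_nhds hyt] with q hq hq'
    rw [hq, e.right_inv hq']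

end Charts

/-! ### Fibred odd equivalence of function germs -/

section Rodd

variable {n m : ℕ}

/-- The involution `(β, l) ↦ (-β, l)`. -/
def flip {E X : Type} [Neg E] (x : E × X) : E × X := (-x.1, x.2)

theorem tendsto_flip {E X : Type} [NormedAddCommGroup E] [TopologicalSpace X] (l : X) :
    Tendsto (flip : E × X → E × X) (𝓝 (0, l)) (𝓝 (0, l)) := by
  have h : Continuous (flip : E × X → E × X) := by unfold flip; fun_prop
  have := h.tendsto (0, l)
  simpa [flip] using this

/-- The data of a fibred odd diffeomorphism germ, with the Jacobian condition on the blocks. -/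
structure IsFibredOddGerm (Φ : Euc n × Euc m → Euc n) (Λ : Euc m → Euc m) (l₀ l₁ : Euc m) :
    Prop where
  smooth : ∀ᶠ x in 𝓝 ((0 : Euc n), l₀), ContDiffAt ℝ ∞ Φ x
  base_smooth : ∀ᶠ l in 𝓝 l₀, ContDiffAt ℝ ∞ Λ l
  base_eq : Λ l₀ = l₁
  odd : ∀ᶠ x in 𝓝 ((0 : Euc n), l₀), Φ (-x.1, x.2) = -Φ x
  inj : ∀ b, fderiv ℝ Φ (0, l₀) (b, 0) = 0 → b = 0
  base_inj : ∀ v, fderiv ℝ Λ l₀ v = 0 → v = 0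

theorem hasFDerivAt_fibred {Φ : Euc n × Euc m → Euc n} {Λ : Euc m → Euc m}
    {x : Euc n × Euc m} (h : ContDiffAt ℝ ∞ Φ x) (h' : ContDiffAt ℝ ∞ Λ x.2) :
    HasFDerivAt (fun x : Euc n × Euc m => (Φ x, Λ x.2))
      ((fderiv ℝ Φ x).prod ((fderiv ℝ Λ x.2).comp (ContinuousLinearMap.snd ℝ (Euc n) (Euc m)))) x :=
  (differentiableAt_of_smooth h).hasFDerivAt.prodMk
    ((differentiableAt_of_smooth h').hasFDerivAt.comp x hasFDerivAt_snd)

/-- The derivative is block triangular, hence invertible exactly when both diagonal blocks are; the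
derivative of `Φ` in `l` plays no part. That the centre goes to `β = 0` is forced by oddness. -/
theorem isFibredOddGerm_iff {Φ : Euc n × Euc m → Euc n} {Λ : Euc m → Euc m} {l₀ l₁ : Euc m} :
    IsFibredOddGerm Φ Λ l₀ l₁ ↔
      IsDiffeoGerm (fun x : Euc n × Euc m => (Φ x, Λ x.2)) (0, l₀) (0, l₁) ∧
      ∀ᶠ x in 𝓝 ((0, l₀) : Euc n × Euc m), Φ (-x.1, x.2) = -Φ x := by
  constructor
  · intro h
    refine ⟨isDiffeoGerm_iff.2 ⟨?_, ?_, ?_⟩, h.odd⟩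
    · have h0 := h.odd.self_of_nhds
      simp only [neg_zero] at h0
      rw [h.base_eq, eq_zero_of_eq_neg h0]
    · filter_upwards [h.smooth, (continuous_snd.tendsto ((0 : Euc n), l₀)).eventually
        h.base_smooth] with x hx hx'
      exact hx.prodMk (hx'.comp x contDiffAt_snd)
    · rw [(hasFDerivAt_fibred h.smooth.self_of_nhds h.base_smooth.self_of_nhds).fderiv]
      refine isInvertible_of_injective rfl fun x hx => ?_
      obtain ⟨b, v⟩ := x
      simp only [ContinuousLinearMap.prod_apply, ContinuousLinearMap.comp_apply,
        ContinuousLinearMap.coe_snd', Prod.mk_eq_zero] at hx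
      obtain rfl := h.base_inj v hx.2
      rw [h.inj b hx.1, Prod.mk_eq_zero]
      exact ⟨rfl, rfl⟩
  · rintro ⟨h, hodd⟩
    obtain ⟨h1, h2, h3⟩ := isDiffeoGerm_iff.1 h
    have hs : ∀ᶠ x in 𝓝 ((0 : Euc n), l₀), ContDiffAt ℝ ∞ Φ x := h2.mono fun x hx => hx.fst
    have hbs : ∀ᶠ l in 𝓝 l₀, ContDiffAt ℝ ∞ Λ l := by
      have hc : Tendsto (fun l : Euc m => ((0 : Euc n), l)) (𝓝 l₀) (𝓝 (0, l₀)) :=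
        (Continuous.prodMk_right (0 : Euc n)).tendsto l₀
      filter_upwards [hc.eventually h2] with l hl
      exact hl.snd.comp (f := fun l : Euc m => ((0 : Euc n), l)) l
        (contDiffAt_const.prodMk contDiffAt_id)
    rw [(hasFDerivAt_fibred hs.self_of_nhds hbs.self_of_nhds).fderiv] at h3
    refine ⟨hs, hbs, (Prod.mk.inj h1).2, hodd, fun b hb => ?_, ?_⟩
    · have : ((b, 0) : Euc n × Euc m) = 0 := IsInvertible.eq_zero h3 (by simp [hb])
      exact (Prod.mk_eq_zero.1 this).1
    · have hsurj : Function.Surjective (fderiv ℝ Λ l₀ : Euc m →ₗ[ℝ] Euc m) := by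
        intro w
        obtain ⟨e, he⟩ := h3
        have h4 := congrArg (fun A => A (e.symm (0, w))) he
        simp only [ContinuousLinearEquiv.coe_coe, ContinuousLinearEquiv.apply_symm_apply] at h4
        exact ⟨(e.symm (0, w)).2, (Prod.ext_iff.1 h4).2.symm⟩
      have hinj := LinearMap.injective_iff_surjective.2 hsurj
      exact (injective_iff_map_eq_zero _).1 hinj

theorem roddEquiv_iff {F : Euc n × Euc m → ℝ} {l₀ : Euc m} {G : Euc n × Euc m → ℝ}
    {l₁ : Euc m} : RoddEquiv F l₀ G l₁ ↔ ∃ Φ Λ, IsFibredOddGerm Φ Λ l₀ l₁ ∧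
      ∀ᶠ x in 𝓝 ((0, l₀) : Euc n × Euc m), F x = G (Φ x, Λ x.2) := by
  simp only [RoddEquiv, isFibredOddGerm_iff, and_assoc]

theorem RoddEquiv.congr_left {F F' G : Euc n × Euc m → ℝ} {l₀ l₁ : Euc m}
    (h : RoddEquiv F l₀ G l₁) (hF : F =ᶠ[𝓝 (0, l₀)] F') : RoddEquiv F' l₀ G l₁ := by
  obtain ⟨Φ, Λ, h1, h2, h3⟩ := h
  exact ⟨Φ, Λ, h1, h2, by filter_upwards [h3, hF] with x hx hx' using hx' ▸ hx⟩

theorem RoddEquiv.trans {F G H : Euc n × Euc m → ℝ} {l₀ l₁ l₂ : Euc m}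
    (h : RoddEquiv F l₀ G l₁) (h' : RoddEquiv G l₁ H l₂) : RoddEquiv F l₀ H l₂ := by
  obtain ⟨Φ, Λ, h1, h2, h3⟩ := h
  obtain ⟨Φ', Λ', h1', h2', h3'⟩ := h'
  refine ⟨fun x => Φ' (Φ x, Λ x.2), fun l => Λ' (Λ l), h1'.comp h1, ?_, ?_⟩
  · filter_upwards [h2, h1.tendsto.eventually h2'] with x hx hx'
    simp only [hx, hx']
  · filter_upwards [h3, h1.tendsto.eventually h3'] with x hx hx'
    rw [hx, hx']

/-- The inverse germ is again fibred because the base map has a local inverse of its own, and again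
odd because the inverse of a map that commutes with `flip` commutes with `flip`. -/
theorem RoddEquiv.symm {F G : Euc n × Euc m → ℝ} {l₀ l₁ : Euc m}
    (h : RoddEquiv F l₀ G l₁) : RoddEquiv G l₁ F l₀ := by
  obtain ⟨Φ, Λ, h1, h2, h3⟩ := h
  have hfib := isFibredOddGerm_iff.2 ⟨h1, h2⟩
  obtain ⟨Ψ, hΨ, hl, hr⟩ := h1.exists_inverse
  have hΛ : IsDiffeoGerm Λ l₀ l₁ := isDiffeoGerm_iff.2 ⟨hfib.base_eq, hfib.base_smooth,
    isInvertible_of_injective rfl hfib.base_inj⟩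
  obtain ⟨Λ', hΛ', hll, -⟩ := hΛ.exists_inverse
  have hΨ2 : ∀ᶠ y in 𝓝 ((0 : Euc n), l₁), (Ψ y).2 = Λ' y.2 := by
    have ht : Tendsto (fun y => (Ψ y).2) (𝓝 ((0 : Euc n), l₁)) (𝓝 l₀) :=
      (continuous_snd.tendsto _).comp hΨ.tendsto
    filter_upwards [hr, ht.eventually hll] with y hy hy'
    rw [← hy', ← congrArg Prod.snd hy]
  refine ⟨fun y => (Ψ y).1, Λ', hΨ.congr ?_, ?_, ?_⟩
  · filter_upwards [hΨ2] with y hy using Prod.ext rfl hy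
  · filter_upwards [hr, hΨ.tendsto.eventually h2, hΨ2, (tendsto_flip l₁).eventually hΨ2,
      ((tendsto_flip l₀).comp hΨ.tendsto).eventually hl] with y hy hodd hy2 hfy2 hl'
    have h5 : Ψ (flip y) = flip (Ψ y) := by
      change _ = (flip ∘ Ψ) y
      rw [← hl']
      simp only [Function.comp_apply, flip, hodd]
      have h6 := Prod.ext_iff.1 hy
      simp only at h6
      rw [h6.1, h6.2]
    have := congrArg Prod.fst h5
    simpa [flip] using this
  · filter_upwards [hr, hΨ.tendsto.eventually h3, hΨ2] with y hy hy' hy2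
    rw [← hy2, hy', hy]

end Rodd

end OddLagrangian

namespace OddLagrangian

/-! ### Normal forms -/

section NormalForm

variable {n m : ℕ} {Q : Type} [NormedAddCommGroup Q] [NormedSpace ℝ Q]

/-- The identification of `ℝⁿ` with its dual by the inner product. -/
noncomputable def rho (n : ℕ) : Euc n ≃L[ℝ] StrongDual ℝ (Euc n) :=
  LinearEquiv.toContinuousLinearEquiv
    { toFun := fun x => InnerProductSpace.toDual ℝ (Euc n) x
      map_add' := fun x y => map_add _ x y
      map_smul' := fun c x => by simp
      invFun := fun a => (InnerProductSpace.toDual ℝ (Euc n)).symm a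
      left_inv := fun x => by simp
      right_inv := fun a => by simp }

theorem rho_comm (a b : Euc n) : rho n a b = rho n b a := by
  change inner ℝ a b = inner ℝ b a
  exact real_inner_comm _ _

/-- The linear map `(y, a) ↦ (κ, l)` with
`κ v = ⟪y.1, (T v).1⟫ + a (0, (T v).2)`, `T l = (-a (·, 0), y.2)`. -/
noncomputable def lagLin (T : Euc m ≃L[ℝ] Euc n × Q) :
    (Euc n × Q) × StrongDual ℝ (Euc n × Q) →L[ℝ] Cot m :=
  (((ContinuousLinearMap.compL ℝ (Euc m) (Euc n × Q) ℝ).flip (T : Euc m →L[ℝ] Euc n × Q)).comp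
    ((((ContinuousLinearMap.compL ℝ (Euc n × Q) (Euc n) ℝ).flip
        (ContinuousLinearMap.fst ℝ (Euc n) Q)).comp
      ((rho n : Euc n →L[ℝ] StrongDual ℝ (Euc n)).comp
        ((ContinuousLinearMap.fst ℝ (Euc n) Q).comp
          (ContinuousLinearMap.fst ℝ (Euc n × Q) (StrongDual ℝ (Euc n × Q)))))) +
     ((ContinuousLinearMap.compL ℝ (Euc n × Q) (Euc n × Q) ℝ).flip
        ((ContinuousLinearMap.inr ℝ (Euc n) Q).comp (ContinuousLinearMap.snd ℝ (Euc n) Q))).comp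
      (ContinuousLinearMap.snd ℝ (Euc n × Q) (StrongDual ℝ (Euc n × Q))))).prod
  ((T.symm : Euc n × Q →L[ℝ] Euc m).comp
    ((-(((rho n).symm : StrongDual ℝ (Euc n) →L[ℝ] Euc n).comp
      (((ContinuousLinearMap.compL ℝ (Euc n) (Euc n × Q) ℝ).flip
        (ContinuousLinearMap.inl ℝ (Euc n) Q)).comp
      (ContinuousLinearMap.snd ℝ (Euc n × Q) (StrongDual ℝ (Euc n × Q)))))).prod
      ((ContinuousLinearMap.snd ℝ (Euc n) Q).comp
          (ContinuousLinearMap.fst ℝ (Euc n × Q) (StrongDual ℝ (Euc n × Q))))))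

/-- The Lagrangian submanifold with generating function `S`. -/
noncomputable def lagParam (T : Euc m ≃L[ℝ] Euc n × Q) (S : Euc n × Q → ℝ) (y : Euc n × Q) :
    Cot m := lagLin T (y, fderiv ℝ S y)

/-- The generating family that belongs to the generating function `S`. -/
noncomputable def normalFamily (T : Euc m ≃L[ℝ] Euc n × Q) (S : Euc n × Q → ℝ)
    (x : Euc n × Euc m) : ℝ := rho n (T x.2).1 x.1 + S (x.1, (T x.2).2)

/-- The linear coordinates on `T*ℝᵐ` in which the submanifolds `lagParam T S` are graphs. -/
noncomputable def lin (T : Euc m ≃L[ℝ] Euc n × Q) : Cot m →L[ℝ] Euc n × Q :=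
  ((((rho n).symm : StrongDual ℝ (Euc n) →L[ℝ] Euc n).comp
    ((ContinuousLinearMap.compL ℝ (Euc n) (Euc m) ℝ).flip
      ((T.symm : Euc n × Q →L[ℝ] Euc m).comp (ContinuousLinearMap.inl ℝ (Euc n) Q)))).comp
    (ContinuousLinearMap.fst ℝ (StrongDual ℝ (Euc m)) (Euc m))).prod
  (((ContinuousLinearMap.snd ℝ (Euc n) Q).comp (T : Euc m →L[ℝ] Euc n × Q)).comp
    (ContinuousLinearMap.snd ℝ (StrongDual ℝ (Euc m)) (Euc m)))

variable (T : Euc m ≃L[ℝ] Euc n × Q)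

theorem lagParam_fst_apply (S : Euc n × Q → ℝ) (y : Euc n × Q) (v : Euc m) :
    (lagParam T S y).1 v = rho n y.1 (T v).1 + fderiv ℝ S y (0, (T v).2) := rfl

theorem lagParam_snd (S : Euc n × Q → ℝ) (y : Euc n × Q) :
    (lagParam T S y).2 = T.symm (-(rho n).symm ((fderiv ℝ S y).comp
      (ContinuousLinearMap.inl ℝ (Euc n) Q)), y.2) := rfl

theorem lin_fst (q : Cot m) : (lin T q).1 = (rho n).symm (q.1.comp
    ((T.symm : Euc n × Q →L[ℝ] Euc m).comp (ContinuousLinearMap.inl ℝ (Euc n) Q))) := rfl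

theorem lin_snd (q : Cot m) : (lin T q).2 = (T q.2).2 := rfl

theorem rho_lin_fst (q : Cot m) (a : Euc n) : rho n (lin T q).1 a = q.1 (T.symm (a, 0)) := by
  rw [lin_fst, ContinuousLinearEquiv.apply_symm_apply]; rfl

-- `lagParam T S` is a section of `lin T` whatever `S` is; injectivity, immersivity and the
-- embedding property all come from here.
@[simp]
theorem lin_lagParam (S : Euc n × Q → ℝ) (y : Euc n × Q) : lin T (lagParam T S y) = y := by
  refine Prod.ext ?_ ?_
  · refine (rho n).injective ?_
    ext a
    rw [rho_lin_fst, lagParam_fst_apply]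
    simp only [ContinuousLinearEquiv.apply_symm_apply]
    have : ((0 : Euc n), (0 : Q)) = 0 := rfl
    rw [this, map_zero, add_zero]
  · rw [lin_snd, lagParam_snd]
    simp

theorem symm_split (T : Euc m ≃L[ℝ] Euc n × Q) (v : Euc m) :
    v = T.symm ((T v).1, 0) + T.symm (0, (T v).2) := by
  rw [← map_add]
  simp

theorem cot_ext_of_lin {q : Cot m} {S : Euc n × Q → ℝ} {y : Euc n × Q} (hl : lin T q = y)
    (h1 : ∀ z, fderiv ℝ S y (0, z) = q.1 (T.symm (0, z)))
    (h2 : ∀ b, fderiv ℝ S y (b, 0) = -rho n (T q.2).1 b) : lagParam T S y = q := by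
  refine Prod.ext ?_ ?_
  · ext v
    rw [lagParam_fst_apply, h1, ← hl, rho_lin_fst, ← map_add, ← symm_split]
  · rw [lagParam_snd, ContinuousLinearEquiv.symm_apply_eq]
    refine Prod.ext ?_ ?_
    · simp only
      have : (fderiv ℝ S y).comp (ContinuousLinearMap.inl ℝ (Euc n) Q) = -rho n (T q.2).1 := by
        ext b
        simpa using h2 b
      rw [this, map_neg, neg_neg, ContinuousLinearEquiv.symm_apply_apply]
    · rw [← hl]; rfl

theorem contDiffAt_lagParam {S : Euc n × Q → ℝ} {y : Euc n × Q} (h : ContDiffAt ℝ ∞ S y) :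
    ContDiffAt ℝ ∞ (lagParam T S) y :=
  (lagLin T).contDiff.contDiffAt.comp y (contDiffAt_id.prodMk (contDiffAt_fderiv h))

/-- The germ of `L` at `p` is given by the generating function `S`. -/
def Repr (S : Euc n × Q → ℝ) (L : Set (Cot m)) (p : Cot m) : Prop :=
  ∀ᶠ q in 𝓝 p, q ∈ L ↔ lagParam T S (lin T q) = q

/-- `genMap` as a linear function of the point and the derivative. -/
noncomputable def genLin (n m : ℕ) :
    StrongDual ℝ (Euc n × Euc m) × (Euc n × Euc m) →L[ℝ] Cot m :=
  (((ContinuousLinearMap.compL ℝ (Euc m) (Euc n × Euc m) ℝ).flip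
    (ContinuousLinearMap.inr ℝ (Euc n) (Euc m))).comp
    (ContinuousLinearMap.fst ℝ (StrongDual ℝ (Euc n × Euc m)) (Euc n × Euc m))).prod
  ((ContinuousLinearMap.snd ℝ (Euc n) (Euc m)).comp
    (ContinuousLinearMap.snd ℝ (StrongDual ℝ (Euc n × Euc m)) (Euc n × Euc m)))

/-- Restriction of a covector to the variables of the family. -/
noncomputable def fibreRestrict (n m : ℕ) :
    StrongDual ℝ (Euc n × Euc m) →L[ℝ] StrongDual ℝ (Euc n) :=
  (ContinuousLinearMap.compL ℝ (Euc n) (Euc n × Euc m) ℝ).flip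
    (ContinuousLinearMap.inl ℝ (Euc n) (Euc m))

/-- The derivative in the variables of the family, as a vector. -/
noncomputable def fibreGrad (G : Euc n × Euc m → ℝ) (x : Euc n × Euc m) : Euc n :=
  (rho n).symm (fibreDeriv G x)

theorem fibreGrad_eq_zero {G : Euc n × Euc m → ℝ} {x : Euc n × Euc m} :
    fibreGrad G x = 0 ↔ fibreDeriv G x = 0 := by
  rw [fibreGrad, map_eq_zero_iff _ (rho n).symm.injective]

/-- `legMap` as a linear function of the point and the derivative. -/
noncomputable def legLin : StrongDual ℝ (Euc n × Euc m) × (Euc n × Euc m) →L[ℝ]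
    (Euc n × Q) × Euc n :=
  ((lin T).comp (genLin n m)).prod
    (((rho n).symm : StrongDual ℝ (Euc n) →L[ℝ] Euc n).comp ((fibreRestrict n m).comp
      (ContinuousLinearMap.fst ℝ (StrongDual ℝ (Euc n × Euc m)) (Euc n × Euc m))))

/-- The map whose inverse is used for the Legendre transform of a family. -/
noncomputable def legMap (G : Euc n × Euc m → ℝ) (x : Euc n × Euc m) :
    (Euc n × Q) × Euc n := legLin T (fderiv ℝ G x, x)

theorem legMap_fst (G : Euc n × Euc m → ℝ) (x : Euc n × Euc m) :
    (legMap T G x).1 = lin T (genMap G x) := rfl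

theorem legMap_snd (G : Euc n × Euc m → ℝ) (x : Euc n × Euc m) :
    (legMap T G x).2 = fibreGrad G x := rfl

theorem legMap_fst_snd (G : Euc n × Euc m → ℝ) (x : Euc n × Euc m) :
    (legMap T G x).1.2 = (T x.2).2 := rfl

theorem contDiffAt_legMap {G : Euc n × Euc m → ℝ} {x : Euc n × Euc m} (h : ContDiffAt ℝ ∞ G x) :
    ContDiffAt ℝ ∞ (legMap T G) x :=
  (legLin T).contDiff.contDiffAt.comp x ((contDiffAt_fderiv h).prodMk contDiffAt_id)

theorem fderiv_split (G : Euc n × Euc m → ℝ) (x v : Euc n × Euc m) :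
    fderiv ℝ G x v = fibreDeriv G x v.1 + (genMap G x).1 v.2 := by
  have : v = (v.1, 0) + (0, v.2) := by simp
  conv_lhs => rw [this, map_add]
  rfl

/-- The Legendre transform of a family generates the same Lagrangian submanifold. -/
theorem lagParam_legendre {G : Euc n × Euc m → ℝ} {h : Euc n × Q → Euc n × Euc m}
    {S : Euc n × Q → ℝ} {y : Euc n × Q} (hh : DifferentiableAt ℝ h y)
    (hG : DifferentiableAt ℝ G (h y)) (hM : ∀ᶠ z in 𝓝 y, legMap T G (h z) = (z, 0))
    (hS : ∀ᶠ z in 𝓝 y, S z = G (h z) - rho n (T (h z).2).1 z.1) :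
    lagParam T S y = genMap G (h y) := by
  have hMy := hM.self_of_nhds
  have hl : lin T (genMap G (h y)) = y := by rw [← legMap_fst, hMy]
  have hc : fibreDeriv G (h y) = 0 := by rw [← fibreGrad_eq_zero, ← legMap_snd T, hMy]
  set h' := fderiv ℝ h y with hh'
  have hd := hh.hasFDerivAt
  have hT : HasFDerivAt (fun z => T (h z).2) ((T : Euc m →L[ℝ] Euc n × Q).comp
      ((ContinuousLinearMap.snd ℝ (Euc n) (Euc m)).comp h')) y :=
    T.hasFDerivAt.comp y (hasFDerivAt_snd.comp y hd)
  have hT2 : ∀ w, (T (h' w).2).2 = w.2 := by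
    intro w
    have h1 : HasFDerivAt (fun z => (T (h z).2).2) _ y := hasFDerivAt_snd.comp y hT
    have h2 : HasFDerivAt (fun z : Euc n × Q => (T (h z).2).2)
        (ContinuousLinearMap.snd ℝ (Euc n) Q) y := by
      refine (hasFDerivAt_snd (𝕜 := ℝ) (p := y)).congr_of_eventuallyEq ?_
      filter_upwards [hM] with z hz
      have := congrArg (fun a => a.1.2) hz
      simpa [legMap_fst_snd] using this
    exact DFunLike.congr_fun (h1.unique h2) w
  have hSd : ∀ w, fderiv ℝ S y w = (genMap G (h y)).1 (T.symm (0, w.2)) -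
      rho n (T (h y).2).1 w.1 := by
    intro w
    have h1 : HasFDerivAt (fun z => (rho n) (T (h z).2).1) _ y :=
      (rho n).hasFDerivAt.comp y (hasFDerivAt_fst.comp y hT)
    have h2 := (hG.hasFDerivAt.comp y hd).sub (h1.clm_apply (hasFDerivAt_fst (𝕜 := ℝ) (p := y)))
    have h3 := h2.congr_of_eventuallyEq (f₁ := S) hS
    rw [h3.fderiv]
    -- Splitting the velocity of the parameter along `T`, the first block contributes exactly the
    -- term that the derivative of the subtracted product cancels. Together with the vanishing fibre
    -- derivative this is the usual cancellation in a Legendre transform.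
    have h4 : (genMap G (h y)).1 (h' w).2 = rho n y.1 (T (h' w).2).1 +
        (genMap G (h y)).1 (T.symm (0, w.2)) := by
      conv_lhs => rw [symm_split T (h' w).2, map_add, ← rho_lin_fst, hl, hT2]
    have h5 : fderiv ℝ G (h y) (h' w) = (genMap G (h y)).1 (h' w).2 := by
      rw [fderiv_split, hc]; simp
    simp only [_root_.sub_apply, ContinuousLinearMap.comp_apply,
      _root_.add_apply, ContinuousLinearMap.flip_apply,
      ContinuousLinearEquiv.coe_coe, ContinuousLinearMap.coe_fst', ContinuousLinearMap.coe_snd']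
    rw [h5, h4, rho_comm y.1]
    ring
  refine cot_ext_of_lin T hl (fun z => ?_) fun b => ?_
  · rw [hSd]; simp
  · rw [hSd]
    have : T.symm ((0 : Euc n), (0 : Q)) = 0 := map_zero T.symm
    simp only [this, map_zero, zero_sub]
    rfl

theorem hasFDerivAt_normalFamily {S : Euc n × Q → ℝ} {x : Euc n × Euc m}
    (hS : DifferentiableAt ℝ S (x.1, (T x.2).2)) (v : Euc n × Euc m) :
    DifferentiableAt ℝ (normalFamily T S) x ∧ fderiv ℝ (normalFamily T S) x v =
      rho n (T x.2).1 v.1 + rho n (T v.2).1 x.1 +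
        fderiv ℝ S (x.1, (T x.2).2) (v.1, (T v.2).2) := by
  have hT : HasFDerivAt (fun z : Euc n × Euc m => T z.2) ((T : Euc m →L[ℝ] Euc n × Q).comp
      (ContinuousLinearMap.snd ℝ (Euc n) (Euc m))) x := T.hasFDerivAt.comp x hasFDerivAt_snd
  have h1 : HasFDerivAt (fun z : Euc n × Euc m => rho n (T z.2).1) _ x :=
    (rho n).hasFDerivAt.comp x (hasFDerivAt_fst.comp x hT)
  have h2 : HasFDerivAt (fun z : Euc n × Euc m => (z.1, (T z.2).2)) _ x :=
    (hasFDerivAt_fst (𝕜 := ℝ) (p := x)).prodMk (hasFDerivAt_snd.comp x hT)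
  have h3 : HasFDerivAt (normalFamily T S) _ x :=
    (h1.clm_apply (hasFDerivAt_fst (𝕜 := ℝ) (p := x))).add
    ((hS.hasFDerivAt).comp x h2)
  refine ⟨h3.differentiableAt, ?_⟩
  rw [h3.fderiv]
  simp

theorem fibreDeriv_normalFamily {S : Euc n × Q → ℝ} {x : Euc n × Euc m}
    (hS : DifferentiableAt ℝ S (x.1, (T x.2).2)) :
    fibreDeriv (normalFamily T S) x = rho n (T x.2).1 +
      (fderiv ℝ S (x.1, (T x.2).2)).comp (ContinuousLinearMap.inl ℝ (Euc n) Q) := by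
  ext b
  change fderiv ℝ (normalFamily T S) x (b, 0) = _
  rw [(hasFDerivAt_normalFamily T hS _).2]
  simp

theorem genMap_normalFamily_fst {S : Euc n × Q → ℝ} {x : Euc n × Euc m}
    (hS : DifferentiableAt ℝ S (x.1, (T x.2).2)) :
    (genMap (normalFamily T S) x).1 = (lagParam T S (x.1, (T x.2).2)).1 := by
  ext v
  rw [lagParam_fst_apply]
  change fderiv ℝ (normalFamily T S) x (0, v) = _
  rw [(hasFDerivAt_normalFamily T hS _).2]
  simp only [map_zero, zero_add]
  rw [rho_comm]

theorem mem_critSet_normalFamily {S : Euc n × Q → ℝ} {x : Euc n × Euc m}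
    (hS : DifferentiableAt ℝ S (x.1, (T x.2).2)) :
    x ∈ critSet (normalFamily T S) ↔ (lagParam T S (x.1, (T x.2).2)).2 = x.2 := by
  change fibreDeriv (normalFamily T S) x = 0 ↔ _
  rw [fibreDeriv_normalFamily T hS, lagParam_snd, ContinuousLinearEquiv.symm_apply_eq,
    Prod.ext_iff, ← (rho n).injective.eq_iff]
  simp only [map_neg, ContinuousLinearEquiv.apply_symm_apply, and_true]
  rw [add_comm, add_eq_zero_iff_neg_eq]

theorem contDiffAt_normalFamily {S : Euc n × Q → ℝ} {x : Euc n × Euc m}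
    (hS : ContDiffAt ℝ ∞ S (x.1, (T x.2).2)) : ContDiffAt ℝ ∞ (normalFamily T S) x := by
  have hT : ContDiff ℝ ∞ (fun z : Euc n × Euc m => T z.2) := T.contDiff.comp contDiff_snd
  refine ContDiffAt.add ?_ ?_
  · exact (((rho n).contDiff.comp (contDiff_fst.comp hT)).clm_apply contDiff_fst).contDiffAt
  · exact hS.comp x (contDiff_fst.prodMk (contDiff_snd.comp hT)).contDiffAt

theorem fderiv_legMap {G : Euc n × Euc m → ℝ} {x : Euc n × Euc m} (h : ContDiffAt ℝ ∞ G x)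
    (v : Euc n × Euc m) :
    fderiv ℝ (legMap T G) x v = legLin T (fderiv ℝ (fderiv ℝ G) x v, v) := by
  have h1 : HasFDerivAt (legMap T G) _ x := (legLin T).hasFDerivAt.comp x
    ((differentiableAt_of_smooth (contDiffAt_fderiv h)).hasFDerivAt.prodMk (hasFDerivAt_id x))
  rw [h1.fderiv]; rfl

theorem fderiv_fibreDeriv {G : Euc n × Euc m → ℝ} {x : Euc n × Euc m} (h : ContDiffAt ℝ ∞ G x)
    (v : Euc n × Euc m) :
    fderiv ℝ (fibreDeriv G) x v = fibreRestrict n m (fderiv ℝ (fderiv ℝ G) x v) := by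
  have h1 : HasFDerivAt (fibreDeriv G) _ x := (fibreRestrict n m).hasFDerivAt.comp x
    (differentiableAt_of_smooth (contDiffAt_fderiv h)).hasFDerivAt
  rw [h1.fderiv]; rfl

/-! ### Consequences of oddness -/

/-- The involution `flip` as a linear equivalence. -/
def flipL (E X : Type) [NormedAddCommGroup E] [NormedSpace ℝ E] [NormedAddCommGroup X]
    [NormedSpace ℝ X] : (E × X) ≃L[ℝ] (E × X) :=
  (ContinuousLinearEquiv.neg ℝ).prodCongr (ContinuousLinearEquiv.refl ℝ X)

@[simp]
theorem flip_flip {E X : Type} [AddGroup E] (x : E × X) : flip (flip x) = x := by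
  simp [flip]

section

variable {E X Z : Type} [NormedAddCommGroup E] [NormedSpace ℝ E] [NormedAddCommGroup X]
  [NormedSpace ℝ X] [NormedAddCommGroup Z] [NormedSpace ℝ Z]

theorem fderiv_flip (f : E × X → Z) (x v : E × X) :
    fderiv ℝ (fun y => f (flip y)) x v = fderiv ℝ f (flip x) (flip v) := by
  have := (flipL E X).comp_right_fderiv (f := f) (x := x)
  have h2 := DFunLike.congr_fun this v
  exact h2

theorem fderiv_odd {f : E × X → Z} {x : E × X} (h : ∀ᶠ y in 𝓝 x, f (flip y) = -f y)
    (v : E × X) : fderiv ℝ f (flip x) v = -fderiv ℝ f x (flip v) := by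
  have h1 := fderiv_flip f x (flip v)
  rw [flip_flip] at h1
  rw [← h1, Filter.EventuallyEq.fderiv_eq h]
  have : fderiv ℝ (fun y => -f y) x = -fderiv ℝ f x := fderiv_fun_neg
  rw [this]; rfl

theorem fderiv_even {f : E × X → Z} {x : E × X} (h : ∀ᶠ y in 𝓝 x, f (flip y) = f y)
    (v : E × X) : fderiv ℝ f (flip x) v = fderiv ℝ f x (flip v) := by
  have h1 := fderiv_flip f x (flip v)
  rw [flip_flip] at h1
  rw [← h1, Filter.EventuallyEq.fderiv_eq h]

end

theorem fibreDeriv_flip {G : Euc n × Euc m → ℝ} {x : Euc n × Euc m}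
    (h : ∀ᶠ y in 𝓝 x, G (flip y) = -G y) : fibreDeriv G (flip x) = fibreDeriv G x := by
  ext b
  change fderiv ℝ G (flip x) (b, 0) = fderiv ℝ G x (b, 0)
  rw [fderiv_odd h, ← map_neg]
  simp [flip]

theorem genMap_flip {G : Euc n × Euc m → ℝ} {x : Euc n × Euc m}
    (h : ∀ᶠ y in 𝓝 x, G (flip y) = -G y) : genMap G (flip x) = zeta (genMap G x) := by
  refine Prod.ext ?_ rfl
  ext v
  change fderiv ℝ G (flip x) (0, v) = -fderiv ℝ G x (0, v)
  rw [fderiv_odd h]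
  simp [flip]

theorem lin_zeta (q : Cot m) : lin T (zeta q) = flip (lin T q) := by
  refine Prod.ext ?_ rfl
  refine (rho n).injective ?_
  ext a
  rw [rho_lin_fst]
  change _ = rho n (-(lin T q).1) a
  rw [map_neg, _root_.neg_apply, rho_lin_fst]
  rfl

theorem legMap_flip {G : Euc n × Euc m → ℝ} {x : Euc n × Euc m}
    (h : ∀ᶠ y in 𝓝 x, G (flip y) = -G y) :
    legMap T G (flip x) = (flip (legMap T G x).1, (legMap T G x).2) := by
  refine Prod.ext ?_ ?_
  · rw [legMap_fst, genMap_flip h, lin_zeta]; rfl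
  · rw [legMap_snd, fibreGrad, fibreDeriv_flip h]; rfl

theorem lagParam_flip {S : Euc n × Q → ℝ} {y : Euc n × Q}
    (h : ∀ᶠ z in 𝓝 y, S (flip z) = -S z) : lagParam T S (flip y) = zeta (lagParam T S y) := by
  refine cot_ext_of_lin T (by rw [lin_zeta, lin_lagParam]) (fun z => ?_) fun b => ?_
  · rw [fderiv_odd h]
    change -fderiv ℝ S y (-0, z) = -(lagParam T S y).1 _
    rw [lagParam_fst_apply]
    simp
  · rw [fderiv_odd h]
    change -fderiv ℝ S y (-b, 0) = -rho n (T (lagParam T S y).2).1 b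
    rw [lagParam_snd, ContinuousLinearEquiv.apply_symm_apply, map_neg,
      ContinuousLinearEquiv.apply_symm_apply, ← map_neg]
    simp

theorem genMap_zero {G : Euc n × Euc m → ℝ} {l : Euc m}
    (h : ∀ᶠ y in 𝓝 ((0 : Euc n), l), G (flip y) = -G y) : genMap G (0, l) = (0, l) := by
  have h1 := genMap_flip h
  have h2 : flip ((0 : Euc n), l) = (0, l) := by simp [flip]
  rw [h2] at h1
  exact Prod.ext (eq_zero_of_eq_neg (congrArg Prod.fst h1)) rfl

theorem lin_zero (l : Euc m) : lin T (0, l) = (0, (T l).2) := by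
  refine Prod.ext ?_ rfl
  rw [lin_fst]; simp

theorem legMap_zero {G : Euc n × Euc m → ℝ} {l : Euc m}
    (h : ∀ᶠ y in 𝓝 ((0 : Euc n), l), G (flip y) = -G y) (hc : (0, l) ∈ critSet G) :
    legMap T G (0, l) = ((0, (T l).2), 0) := by
  refine Prod.ext ?_ (fibreGrad_eq_zero.2 hc)
  rw [legMap_fst, genMap_zero h, lin_zero]

/-- The fibre derivative of an odd function is even in `β`. This vanishing of the fibre Hessian
keeps the number `n` of variables rigid: there are no quadratic directions to split off. -/
theorem fderiv_fibreDeriv_zero {G : Euc n × Euc m → ℝ} {l : Euc m}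
    (h : ∀ᶠ y in 𝓝 ((0 : Euc n), l), G (flip y) = -G y) (b : Euc n) :
    fderiv ℝ (fibreDeriv G) (0, l) (b, 0) = 0 := by
  have h2 : flip ((0 : Euc n), l) = (0, l) := by simp [flip]
  have h1 := fderiv_even (f := fibreDeriv G) (x := (0, l))
    (h.eventually_nhds.mono fun y hy => fibreDeriv_flip hy) (b, 0)
  rw [h2] at h1
  refine eq_zero_of_eq_neg (h1.trans ?_)
  rw [← map_neg]
  simp [flip]

end NormalForm

end OddLagrangian

namespace OddLagrangian

set_option maxSynthPendingDepth 3

/-! ### Absorbing a quadratic form in the fibre gradient by an odd change of variables -/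

section Perturbation

variable {E X : Type} [NormedAddCommGroup E] [NormedSpace ℝ E] [NormedAddCommGroup X]
  [NormedSpace ℝ X]

/-- The pull-back of a bilinear form `β` by the linear map of the form `A`. -/
noncomputable def pullForm (R : E ≃L[ℝ] (E →L[ℝ] ℝ)) (β A : E →L[ℝ] E →L[ℝ] ℝ) :
    E →L[ℝ] E →L[ℝ] ℝ :=
  ((ContinuousLinearMap.compL ℝ E E ℝ).flip ((R.symm : (E →L[ℝ] ℝ) →L[ℝ] E).comp A)).comp
    (β.comp ((R.symm : (E →L[ℝ] ℝ) →L[ℝ] E).comp A))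

variable (R : E ≃L[ℝ] (E →L[ℝ] ℝ))

theorem pullForm_apply (β A : E →L[ℝ] E →L[ℝ] ℝ) (r r' : E) :
    pullForm R β A r r' = β (R.symm (A r)) (R.symm (A r')) := rfl

theorem pullForm_smul (β A : E →L[ℝ] E →L[ℝ] ℝ) (t : ℝ) :
    pullForm R β (t • A) = (t * t) • pullForm R β A := by
  ext r r'
  rw [pullForm_apply]
  simp only [_root_.smul_apply, map_smul, smul_eq_mul, pullForm_apply]
  ring

theorem contDiffAt_pullForm {Y : Type} [NormedAddCommGroup Y] [NormedSpace ℝ Y]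
    {β A : Y → (E →L[ℝ] E →L[ℝ] ℝ)} {x : Y}
    (hβ : ContDiffAt ℝ ∞ β x) (hA : ContDiffAt ℝ ∞ A x) :
    ContDiffAt ℝ ∞ (fun x => pullForm R (β x) (A x)) x := by
  have h1 : ContDiffAt ℝ ∞ (fun x => (R.symm : (E →L[ℝ] ℝ) →L[ℝ] E).comp (A x)) x :=
    contDiffAt_const.clm_comp hA
  exact (((ContinuousLinearMap.compL ℝ E E ℝ).flip.contDiff.contDiffAt).comp
    x h1).clm_comp (hβ.clm_comp h1)

/-- The partial derivative in the first factor. -/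
noncomputable def partialFst (G : E × X → ℝ) (x : E × X) : E →L[ℝ] ℝ :=
  (fderiv ℝ G x).comp (ContinuousLinearMap.inl ℝ E X)

theorem contDiffAt_partialFst {G : E × X → ℝ} {x : E × X}
    (h : ContDiffAt ℝ ∞ G x) : ContDiffAt ℝ ∞ (partialFst G) x :=
  (contDiffAt_fderiv h).clm_comp contDiffAt_const

theorem partialFst_flip {G : E × X → ℝ} {x : E × X}
    (h : ∀ᶠ y in 𝓝 x, G (flip y) = -G y) : partialFst G (flip x) = partialFst G x := by
  ext b
  change fderiv ℝ G (flip x) (b, 0) = fderiv ℝ G x (b, 0)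
  rw [fderiv_odd h, ← map_neg]
  simp [flip]

/-- The quadratic remainder of an odd function, as an odd family of bilinear forms. -/
theorem exists_odd_remainder {G : E × X → ℝ} {l : X}
    (hG : ∀ᶠ x in 𝓝 ((0 : E), l), ContDiffAt ℝ ∞ G x)
    (hodd : ∀ᶠ x in 𝓝 ((0 : E), l), G (flip x) = -G x) :
    ∃ B : (E × X) × E → (E →L[ℝ] E →L[ℝ] ℝ),
      (∀ᶠ p in 𝓝 (((0 : E), l), (0 : E)), ContDiffAt ℝ ∞ B p) ∧
      (∀ p, B (flip p.1, -p.2) = -B p) ∧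
      ∀ᶠ p in 𝓝 (((0 : E), l), (0 : E)),
        G (p.1.1 + p.2, p.1.2) = G p.1 + partialFst G p.1 p.2 + B p p.2 p.2 := by
  set f : (E × X) × E → ℝ := fun p =>
    G (p.1.1 + p.2, p.1.2) - G p.1 - partialFst G p.1 p.2 with hf
  set τ : (E × X) × E → E × X := fun p => (p.1.1 + p.2, p.1.2) with hτ
  have hτs : ContDiff ℝ ∞ τ := (contDiff_fst.fst.add contDiff_snd).prodMk contDiff_fst.snd
  have hτ0 : τ (((0 : E), l), (0 : E)) = (0, l) := by simp [hτ]
  have hτt : Tendsto τ (𝓝 (((0 : E), l), (0 : E))) (𝓝 (0, l)) := by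
    have := hτs.continuous.tendsto (((0 : E), l), (0 : E))
    rwa [hτ0] at this
  have hfst : Tendsto (Prod.fst : (E × X) × E → _)
      (𝓝 (((0 : E), l), (0 : E))) (𝓝 (0, l)) := continuous_fst.tendsto _
  have hfs : ∀ᶠ p in 𝓝 (((0 : E), l), (0 : E)), ContDiffAt ℝ ∞ f p := by
    filter_upwards [hτt.eventually hG, hfst.eventually hG] with p h1 h2
    exact ((h1.comp p hτs.contDiffAt).sub (h2.comp p contDiffAt_fst)).sub
      (((contDiffAt_partialFst h2).comp p contDiffAt_fst).clm_apply contDiffAt_snd)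
  have hf0 : ∀ᶠ x in 𝓝 ((0 : E), l), f (x, 0) = 0 := Eventually.of_forall fun x => by
    simp [hf]
  have hf1 : ∀ᶠ x in 𝓝 ((0 : E), l),
      (fderiv ℝ f (x, 0)).comp (ContinuousLinearMap.inr ℝ (E × X) E) = 0 := by
    filter_upwards [hG] with x hx
    have hfx : DifferentiableAt ℝ f (x, 0) := by
      have h1 : ContDiffAt ℝ ∞ G (τ (x, 0)) := by simpa [hτ] using hx
      exact differentiableAt_of_smooth (((h1.comp (x, 0) hτs.contDiffAt).sub
        (ContDiffAt.comp (x, (0 : E)) hx contDiffAt_fst)).sub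
        ((ContDiffAt.comp (x, (0 : E)) (contDiffAt_partialFst hx)
          contDiffAt_fst).clm_apply contDiffAt_snd))
    have hslice : HasFDerivAt (fun v : E => f (x, v))
        ((fderiv ℝ f (x, 0)).comp (ContinuousLinearMap.inr ℝ (E × X) E)) 0 :=
      hfx.hasFDerivAt.comp (0 : E) (hasFDerivAt_prodMk_right x (0 : E))
    have h2 : HasFDerivAt (fun v : E => (x.1 + v, x.2))
        (ContinuousLinearMap.inl ℝ E X) 0 :=
      ((hasFDerivAt_id (0 : E)).const_add x.1).prodMk (hasFDerivAt_const x.2 0)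
    have h3 : HasFDerivAt G (fderiv ℝ G x) (x.1 + 0, x.2) := by
      simpa using (differentiableAt_of_smooth hx).hasFDerivAt
    have h4 : HasFDerivAt (fun v : E => f (x, v)) _ 0 :=
      ((h3.comp (0 : E) h2).sub_const (G x)).sub (partialFst G x).hasFDerivAt
    rw [hslice.unique h4]
    exact sub_self _
  obtain ⟨B₀, hB₀, hfB⟩ := exists_hadamard_two hfs hf0 hf1
  -- The bilinear form from Hadamard's lemma need not be odd. Its antisymmetrisation under `ν` still
  -- represents the remainder, because the remainder itself changes sign under `ν`.
  set ν : (E × X) × E → (E × X) × E := fun p => (flip p.1, -p.2) with hν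
  have hνs : ContDiff ℝ ∞ ν :=
    ((flipL E X).contDiff.comp contDiff_fst).prodMk contDiff_snd.neg
  have hνt : Tendsto ν (𝓝 (((0 : E), l), (0 : E))) (𝓝 (((0 : E), l), (0 : E))) := by
    have := hνs.continuous.tendsto (((0 : E), l), (0 : E))
    simpa [hν, flip] using this
  refine ⟨fun p => (1 / 2 : ℝ) • (B₀ p - B₀ (ν p)), ?_, fun p => ?_, ?_⟩
  · filter_upwards [hB₀, hνt.eventually hB₀] with p h1 h2
    exact (h1.sub (h2.comp p hνs.contDiffAt)).const_smul (1 / 2 : ℝ)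
  · simp only [hν, flip_flip, neg_neg]
    module
  · filter_upwards [hfB, hνt.eventually hfB, hfst.eventually hodd,
      hτt.eventually hodd, hfst.eventually hodd.eventually_nhds] with p h1 h2 h3 h4 h5
    have h6 : f (ν p) = -f p := by
      have e1 : (-p.1.1 + -p.2, p.1.2) = flip (τ p) := by simp [hτ, flip, add_comm]
      have e2 : partialFst G (flip p.1) = partialFst G p.1 := partialFst_flip h5
      simp only [hf, hν]
      rw [h3, e2, map_neg]
      change G (-p.1.1 + -p.2, p.1.2) - _ - _ = _
      rw [e1, h4]
      simp only [hτ]; ring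
    have h7 : G (p.1.1 + p.2, p.1.2) - G p.1 - partialFst G p.1 p.2 = B₀ p p.2 p.2 := h1
    have h8 : B₀ (ν p) p.2 p.2 = - B₀ p p.2 p.2 := by
      rw [← h1, ← h6, h2]; simp [hν]
    have h9 : ((1 / 2 : ℝ) • (B₀ p - B₀ (ν p))) p.2 p.2 = B₀ p p.2 p.2 := by
      simp only [_root_.smul_apply, _root_.sub_apply, h8, smul_eq_mul]; ring
    rw [h9, ← h7]; ring

theorem hasDerivAt_line {A : Type} [NormedAddCommGroup A] [NormedSpace ℝ A] (x : X) (H : A) :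
    HasDerivAt (fun t : ℝ => (x, t • H)) ((0 : X), H) 0 := by
  have := (hasDerivAt_const (0 : ℝ) x).prodMk ((hasDerivAt_id (0 : ℝ)).smul_const H)
  simpa using this

variable {R} in
/-- An odd function can be changed by an odd quadratic form in its fibre derivative by an odd
fibred change of the variables. -/
theorem exists_odd_change [FiniteDimensional ℝ E] [FiniteDimensional ℝ X]
    (hR : ∀ a b, R a b = R b a) {G : E × X → ℝ} {l : X}
    (hG : ∀ᶠ x in 𝓝 ((0 : E), l), ContDiffAt ℝ ∞ G x)
    (hodd : ∀ᶠ x in 𝓝 ((0 : E), l), G (flip x) = -G x) (hc : partialFst G (0, l) = 0)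
    {q : E × X → (E →L[ℝ] E →L[ℝ] ℝ)} (hq : ∀ᶠ x in 𝓝 ((0 : E), l), ContDiffAt ℝ ∞ q x)
    (hqodd : ∀ x, q (flip x) = -q x) :
    ∃ Φ : E × X → E, (∀ᶠ x in 𝓝 ((0 : E), l), ContDiffAt ℝ ∞ Φ x) ∧
      (∀ᶠ x in 𝓝 ((0 : E), l), Φ (-x.1, x.2) = -Φ x) ∧ (∀ b, fderiv ℝ Φ (0, l) (b, 0) = b) ∧
      ∀ᶠ x in 𝓝 ((0 : E), l), G (Φ x, x.2) =
        G x - q x (R.symm (partialFst G x)) (R.symm (partialFst G x)) := by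
  set grad : E × X → E := fun x => R.symm (partialFst G x) with hgrad
  have hgs : ∀ᶠ x in 𝓝 ((0 : E), l), ContDiffAt ℝ ∞ grad x := by
    filter_upwards [hG] with x hx
    exact R.symm.contDiff.contDiffAt.comp x (contDiffAt_partialFst hx)
  obtain ⟨B, hB, hBodd, hGB⟩ := exists_odd_remainder hG hodd
  set x₁ : E × X := (0, l) with hx₁
  have hfx₁ : flip x₁ = x₁ := by simp [hx₁, flip]
  have hr0 : grad x₁ = 0 := by simp only [hgrad]; rw [hc, map_zero]
  have hq0 : q x₁ = 0 := by
    have := hqodd x₁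
    rw [hfx₁] at this
    exact eq_zero_of_eq_neg this
  -- the shift and the equation for it
  set v : (E × X) × (E →L[ℝ] E →L[ℝ] ℝ) → E := fun p => R.symm (p.2 (grad p.1))
    with hv
  have hv0 : v (x₁, 0) = 0 := by simp [hv]
  have hfst : Tendsto (Prod.fst : (E × X) × (E →L[ℝ] E →L[ℝ] ℝ) → _) (𝓝 (x₁, 0)) (𝓝 x₁) :=
    continuous_fst.tendsto _
  have hvs : ∀ᶠ p in 𝓝 (x₁, (0 : E →L[ℝ] E →L[ℝ] ℝ)), ContDiffAt ℝ ∞ v p := by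
    filter_upwards [hfst.eventually hgs] with p hp
    exact R.symm.contDiff.contDiffAt.comp p (contDiffAt_snd.clm_apply
      (hp.comp p contDiffAt_fst))
  have hxv : Tendsto (fun p : (E × X) × (E →L[ℝ] E →L[ℝ] ℝ) => (p.1, v p)) (𝓝 (x₁, 0))
      (𝓝 (x₁, 0)) := by
    have h1 := hfst.prodMk_nhds hvs.self_of_nhds.continuousAt.tendsto
    rwa [hv0] at h1
  -- Ansatz: shift `β` by `v = R⁻¹ (A grad)` with an unknown bilinear form `A`. The linear term of
  -- the expansion of `G` becomes `A (grad, grad)` by symmetry of `R`, and the remainder becomes the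
  -- pulled-back form applied to `(grad, grad)`. So it suffices to solve `Z (x, A) = 0`, an identity
  -- of bilinear forms, for `A`.
  set Z : (E × X) × (E →L[ℝ] E →L[ℝ] ℝ) → (E →L[ℝ] E →L[ℝ] ℝ) := fun p =>
    p.2 + pullForm R (B (p.1, v p)) p.2 + q p.1 with hZ
  have hZs : ∀ᶠ p in 𝓝 (x₁, (0 : E →L[ℝ] E →L[ℝ] ℝ)), ContDiffAt ℝ ∞ Z p := by
    filter_upwards [hvs, hxv.eventually hB, hfst.eventually hq] with p h1 h2 h3
    refine (contDiffAt_snd.add (contDiffAt_pullForm R ?_ contDiffAt_snd)).add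
      (h3.comp p contDiffAt_fst)
    exact h2.comp p (contDiffAt_fst.prodMk h1)
  set Θ : (E × X) × (E →L[ℝ] E →L[ℝ] ℝ) → (E × X) × (E →L[ℝ] E →L[ℝ] ℝ) := fun p => (p.1, Z p)
    with hΘ
  have hΘs : ∀ᶠ p in 𝓝 (x₁, (0 : E →L[ℝ] E →L[ℝ] ℝ)), ContDiffAt ℝ ∞ Θ p :=
    hZs.mono fun p hp => contDiffAt_fst.prodMk hp
  have hZ0 : ∀ A, Z (x₁, A) = A + pullForm R (B (x₁, 0)) A := by
    intro A
    have : v (x₁, A) = 0 := by simp only [hv, hr0, map_zero]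
    simp only [hZ, hq0, add_zero, this]
  have hΘ0 : Θ (x₁, 0) = (x₁, 0) := by
    have h2 : pullForm R (B (x₁, 0)) (0 : E →L[ℝ] E →L[ℝ] ℝ) = 0 := by
      have := pullForm_smul R (B (x₁, 0)) (0 : E →L[ℝ] E →L[ℝ] ℝ) 0
      simpa using this
    simp only [hΘ, hZ0, h2, add_zero]
  -- At `x₁` the gradient vanishes, so the shift does not depend on `A` there and `Z` is `A` plus a
  -- term quadratic in `A`. Its derivative in `A` at `0` is the identity.
  have hΘinv : (fderiv ℝ Θ (x₁, 0)).IsInvertible := by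
    refine isInvertible_of_injective rfl fun p hp => ?_
    obtain ⟨w, H⟩ := p
    have hdΘ : HasFDerivAt Θ ((ContinuousLinearMap.fst ℝ _ _).prod (fderiv ℝ Z (x₁, 0))) (x₁, 0) :=
      hasFDerivAt_fst.prodMk (differentiableAt_of_smooth hZs.self_of_nhds).hasFDerivAt
    rw [hdΘ.fderiv] at hp
    simp only [ContinuousLinearMap.prod_apply, ContinuousLinearMap.coe_fst',
      Prod.mk_eq_zero] at hp
    obtain ⟨rfl, hp⟩ := hp
    have h1 : HasDerivAt (fun t : ℝ => Z (x₁, t • H)) (fderiv ℝ Z (x₁, 0) (0, H)) 0 := by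
      have h2 : HasFDerivAt Z (fderiv ℝ Z (x₁, 0)) (x₁, (0 : ℝ) • H) := by
        rw [zero_smul]
        exact (differentiableAt_of_smooth hZs.self_of_nhds).hasFDerivAt
      exact h2.comp_hasDerivAt (0 : ℝ) (hasDerivAt_line x₁ H)
    have h3 : HasDerivAt (fun t : ℝ => Z (x₁, t • H)) H 0 := by
      simp only [hZ0, pullForm_smul]
      have h4 := ((hasDerivAt_id (0 : ℝ)).smul_const H).add
        (((hasDerivAt_id (0 : ℝ)).mul (hasDerivAt_id (0 : ℝ))).smul_const
          (pullForm R (B (x₁, 0)) H))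
      exact h4.congr_deriv (by simp)
    rw [h1.unique h3] at hp
    rw [hp]; rfl
  obtain ⟨e, hes, -, heΘ, -, hesm, -⟩ := exists_chart univ_mem hΘs hΘinv
  have het : (x₁, (0 : E →L[ℝ] E →L[ℝ] ℝ)) ∈ e.target := by
    have := e.map_source hes
    rwa [heΘ, hΘ0] at this
  have hex : e.symm (x₁, 0) = (x₁, 0) := by
    have := e.left_inv hes
    rwa [heΘ, hΘ0] at this
  set A : E × X → (E →L[ℝ] E →L[ℝ] ℝ) := fun x => (e.symm (x, 0)).2 with hA
  have hA0 : A x₁ = 0 := by simp only [hA, hex]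
  have hin : Continuous fun x : E × X => (x, (0 : E →L[ℝ] E →L[ℝ] ℝ)) := by fun_prop
  have hint : ∀ᶠ x in 𝓝 x₁, (x, (0 : E →L[ℝ] E →L[ℝ] ℝ)) ∈ e.target :=
    hin.continuousAt.eventually (e.open_target.mem_nhds het)
  have hAs : ∀ᶠ x in 𝓝 x₁, ContDiffAt ℝ ∞ A x := by
    filter_upwards [hint] with x hx
    exact ((hesm _ hx).comp x (contDiffAt_id.prodMk contDiffAt_const)).snd
  have hAe : ∀ᶠ x in 𝓝 x₁, e.symm (x, 0) = (x, A x) ∧ Z (x, A x) = 0 := by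
    filter_upwards [hint] with x hx
    have h1 := e.right_inv hx
    rw [heΘ] at h1
    have h2 : e.symm (x, 0) = (x, A x) := Prod.ext (show (Θ (e.symm (x, 0))).1 = x from congrArg Prod.fst h1) rfl
    rw [h2] at h1
    exact ⟨h2, congrArg Prod.snd h1⟩
  have hAt : Tendsto (fun x => (x, A x)) (𝓝 x₁) (𝓝 (x₁, 0)) := by
    have := tendsto_id.prodMk_nhds hAs.self_of_nhds.continuousAt.tendsto
    rwa [hA0] at this
  have hflip : Tendsto (flip : E × X → _) (𝓝 x₁) (𝓝 x₁) := tendsto_flip l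
  -- The equation is equivariant: `Z` changes sign when `x` is flipped and `A` is negated.
  -- Uniqueness of the solution in the chart makes `A` odd.
  have hAodd : ∀ᶠ x in 𝓝 x₁, A (flip x) = -A x := by
    have ht : Tendsto (fun x => (flip x, -A x)) (𝓝 x₁) (𝓝 (x₁, 0)) := by
      have := hflip.prodMk_nhds hAs.self_of_nhds.continuousAt.tendsto.neg
      rwa [hA0, neg_zero] at this
    filter_upwards [hAe, ht.eventually (e.open_source.mem_nhds hes),
      hodd.eventually_nhds] with x hx hsrc hxo
    have hr : grad (flip x) = grad x := by
      simp only [hgrad]; rw [partialFst_flip hxo]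
    have hvv : v (flip x, -A x) = -v (x, A x) := by
      simp only [hv, hr, _root_.neg_apply, map_neg]
    have hpf : ∀ β A : E →L[ℝ] E →L[ℝ] ℝ, pullForm R (-β) (-A) = -pullForm R β A := by
      intro β A
      ext r r'
      simp only [pullForm_apply, _root_.neg_apply, map_neg]
      simp
    have hZn : Z (flip x, -A x) = -Z (x, A x) := by
      simp only [hZ]
      rw [hvv, hqodd]
      have := hBodd (x, v (x, A x))
      simp only at this
      rw [this, hpf]
      abel
    have h1 := e.left_inv hsrc
    rw [heΘ] at h1
    simp only [hΘ, hZn, hx.2, neg_zero] at h1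
    exact congrArg Prod.snd h1
  have hvAs : ∀ᶠ x in 𝓝 x₁, ContDiffAt ℝ ∞ (fun x => v (x, A x)) x := by
    filter_upwards [hAt.eventually hvs, hAs] with x h1 h2
    exact ContDiffAt.comp (g := v) (f := fun x => (x, A x)) x h1 (contDiffAt_id.prodMk h2)
  -- Both `A` and the gradient vanish at `x₁`, so the shift vanishes to first order and the new
  -- variable has derivative `b` in direction `(b, 0)`.
  have hvA0 : HasFDerivAt (fun x => v (x, A x)) (0 : E × X →L[ℝ] E) x₁ := by
    have h1 := (differentiableAt_of_smooth hAs.self_of_nhds).hasFDerivAt.clm_apply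
      (differentiableAt_of_smooth hgs.self_of_nhds).hasFDerivAt
    have h2 := R.symm.hasFDerivAt.comp x₁ h1
    refine h2.congr_fderiv ?_
    refine ContinuousLinearMap.ext fun w => ?_
    simp [hr0, hA0]
  refine ⟨fun x => x.1 + v (x, A x), ?_, ?_, ?_, ?_⟩
  · exact hvAs.mono fun x hx => contDiffAt_fst.add hx
  · filter_upwards [hAodd, hodd.eventually_nhds] with x hx hxo
    have hr : grad (flip x) = grad x := by
      simp only [hgrad]; rw [partialFst_flip hxo]
    change -x.1 + v (flip x, A (flip x)) = _
    simp only [hv, hr, hx, _root_.neg_apply, map_neg]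
    abel
  · intro b
    have h1 : HasFDerivAt (fun x : E × X => x.1 + v (x, A x)) _ x₁ :=
      hasFDerivAt_fst.add hvA0
    rw [h1.fderiv]
    simp
  · have ht : Tendsto (fun x => (x, v (x, A x))) (𝓝 x₁) (𝓝 (x₁, 0)) := hxv.comp hAt
    filter_upwards [ht.eventually hGB, hAe] with x hx hx'
    have h1 := congrArg (fun C : E →L[ℝ] E →L[ℝ] ℝ => C (grad x) (grad x)) hx'.2
    simp only [hZ, _root_.add_apply, pullForm_apply, _root_.zero_apply] at h1
    have h2 : partialFst G x (v (x, A x)) = A x (grad x) (grad x) := by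
      have h3 : partialFst G x = R (grad x) := by simp [hgrad]
      simp only [hv]
      rw [h3, hR, ContinuousLinearEquiv.apply_symm_apply]
    rw [hx, h2]
    simp only [hv] at h1 ⊢
    linarith

end Perturbation

end OddLagrangian

namespace OddLagrangian

set_option maxSynthPendingDepth 3

/-! ### Reduction of odd families to normal form -/

section Legendre

variable {n m : ℕ} {Q : Type} [NormedAddCommGroup Q] [NormedSpace ℝ Q]

/-- The germ of `G` at `(0, l)` generates the germ of `L` at `(0, l)`. -/
def Generates (G : Euc n × Euc m → ℝ) (l : Euc m) (L : Set (Cot m)) : Prop :=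
  ∃ O₀ ∈ 𝓝 ((0, l) : Euc n × Euc m), ∀ O ∈ 𝓝 ((0, l) : Euc n × Euc m), O ⊆ O₀ →
      genMap G '' (critSet G ∩ O) =ᶠ[𝓝 ((0, l) : Cot m)] L

theorem Generates.unique {G : Euc n × Euc m → ℝ} {l : Euc m} {L L' : Set (Cot m)}
    (h : Generates G l L) (h' : Generates G l L') : L =ᶠ[𝓝 ((0, l) : Cot m)] L' := by
  obtain ⟨O, hO, h⟩ := h
  obtain ⟨O', hO', h'⟩ := h'
  exact (h _ (inter_mem hO hO') inter_subset_left).symm.trans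
    (h' _ (inter_mem hO hO') inter_subset_right)

theorem Generates.congr {G : Euc n × Euc m → ℝ} {l : Euc m} {L L' : Set (Cot m)}
    (h : Generates G l L) (hL : L =ᶠ[𝓝 ((0, l) : Cot m)] L') : Generates G l L' := by
  obtain ⟨O, hO, h⟩ := h
  exact ⟨O, hO, fun O' h1 h2 => (h O' h1 h2).trans hL⟩

/-- The germ of `G` at `(0, l)` is smooth and odd with `(0, l)` critical. -/
structure IsOddGerm (G : Euc n × Euc m → ℝ) (l : Euc m) : Prop where
  smooth : ∀ᶠ x in 𝓝 ((0 : Euc n), l), ContDiffAt ℝ ∞ G x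
  odd : ∀ᶠ x in 𝓝 ((0 : Euc n), l), G (flip x) = -G x
  crit : (0, l) ∈ critSet G

variable (T : Euc m ≃L[ℝ] Euc n × Q)

/-- `h` parametrizes the critical set of the germ of the odd family `G` at `(0, l)`, and `S` is
the Legendre transform of `G`. -/
structure IsLegendre (G : Euc n × Euc m → ℝ) (l : Euc m) (h : Euc n × Q → Euc n × Euc m)
    (S : Euc n × Q → ℝ) : Prop extends IsOddGerm G l where
  inv : (fderiv ℝ (legMap T G) (0, l)).IsInvertible
  cont : ContinuousAt h (0, (T l).2)
  base : h (0, (T l).2) = (0, l)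
  leg : ∀ᶠ y in 𝓝 ((0 : Euc n), (T l).2), legMap T G (h y) = (y, 0)
  val : ∀ᶠ y in 𝓝 ((0 : Euc n), (T l).2), S y = G (h y) - rho n (T (h y).2).1 y.1

variable {T} {G : Euc n × Euc m → ℝ} {l : Euc m} {h : Euc n × Q → Euc n × Euc m}
  {S : Euc n × Q → ℝ}

theorem exists_legChart (hG : IsOddGerm G l) (hinv : (fderiv ℝ (legMap T G) (0, l)).IsInvertible) :
    ∃ e : OpenPartialHomeomorph (Euc n × Euc m) ((Euc n × Q) × Euc n), (0, l) ∈ e.source ∧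
      (∀ x, e x = legMap T G x) ∧ (∀ x ∈ e.source, ContDiffAt ℝ ∞ G x) ∧
      (∀ y ∈ e.target, ContDiffAt ℝ ∞ e.symm y) ∧ (((0 : Euc n), (T l).2), (0 : Euc n)) ∈ e.target ∧
      e.symm ((0, (T l).2), 0) = (0, l) := by
  obtain ⟨e, h1, h2, h3, -, h5, -⟩ := exists_chart hG.smooth
    (hG.smooth.mono fun x hx => contDiffAt_legMap T hx) hinv
  have h6 : e (0, l) = ((0, (T l).2), 0) := by rw [h3, legMap_zero T hG.odd hG.crit]
  refine ⟨e, h1, h3, fun x hx => h2 hx, h5, ?_, ?_⟩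
  · rw [← h6]; exact e.map_source h1
  · rw [← h6]; exact e.left_inv h1

theorem tendsto_inl_zero {Y R : Type} [TopologicalSpace Y] [TopologicalSpace R] [Zero R] (y : Y) :
    Tendsto (fun z : Y => (z, (0 : R))) (𝓝 y) (𝓝 (y, 0)) :=
  (Continuous.prodMk_left (0 : R)).tendsto y

theorem exists_isLegendre (hG : IsOddGerm G l)
    (hinv : (fderiv ℝ (legMap T G) (0, l)).IsInvertible) : ∃ h S, IsLegendre T G l h S := by
  obtain ⟨e, he, heG, -, hes, het, hsymm⟩ := exists_legChart hG hinv
  refine ⟨fun y => e.symm (y, 0), fun y => G (e.symm (y, 0)) -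
    rho n (T (e.symm (y, 0)).2).1 y.1, hG, hinv, ?_, hsymm, ?_, Eventually.of_forall fun _ => rfl⟩
  · exact ContinuousAt.comp (f := fun y : Euc n × Q => (y, (0 : Euc n))) (g := e.symm)
      (hes _ het).continuousAt (Continuous.prodMk_left (0 : Euc n)).continuousAt
  · filter_upwards [(tendsto_inl_zero _).eventually (e.open_target.mem_nhds het)] with y hy
    rw [← heG, e.right_inv hy]

namespace IsLegendre

variable (H : IsLegendre T G l h S)

include H

theorem tendsto : Tendsto h (𝓝 (0, (T l).2)) (𝓝 (0, l)) := by
  have := H.cont.tendsto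
  rwa [H.base] at this

theorem smooth_inv : ∀ᶠ y in 𝓝 ((0 : Euc n), (T l).2), ContDiffAt ℝ ∞ h y := by
  obtain ⟨e, he, heG, -, hes, het, hsymm⟩ := exists_legChart H.toIsOddGerm H.inv
  have h1 : ∀ᶠ y in 𝓝 ((0 : Euc n), (T l).2), h y = e.symm (y, 0) := by
    filter_upwards [H.leg, H.tendsto.eventually (e.open_source.mem_nhds he)] with y hy hy'
    rw [← hy, ← heG, e.left_inv hy']
  filter_upwards [h1.eventually_nhds,
    (tendsto_inl_zero _).eventually (e.open_target.mem_nhds het)] with y hy hy'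
  refine ContDiffAt.congr_of_eventuallyEq ?_ hy
  exact (hes _ hy').comp y (contDiffAt_id.prodMk contDiffAt_const)

/-- The Legendre map intertwines the involutions, so both sides are preimages of one point under an
injective chart. -/
theorem flip_inv : ∀ᶠ y in 𝓝 ((0 : Euc n), (T l).2), h (flip y) = flip (h y) := by
  obtain ⟨e, he, heG, -, -, -, -⟩ := exists_legChart H.toIsOddGerm H.inv
  have hs := e.open_source.mem_nhds he
  filter_upwards [H.leg, (tendsto_flip _).eventually H.leg,
    ((H.tendsto).comp (tendsto_flip _)).eventually hs,
    ((tendsto_flip _).comp H.tendsto).eventually hs,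
    H.tendsto.eventually H.odd.eventually_nhds] with y h1 h2 h3 h4 h5
  refine e.injOn h3 h4 ?_
  simp only [Function.comp_apply]
  rw [heG, heG, h2, legMap_flip T h5, h1]

theorem smooth_val : ∀ᶠ y in 𝓝 ((0 : Euc n), (T l).2), ContDiffAt ℝ ∞ S y := by
  filter_upwards [H.val.eventually_nhds, H.smooth_inv, H.tendsto.eventually H.smooth]
    with y h1 h2 h3
  refine ContDiffAt.congr_of_eventuallyEq ?_ h1
  refine (h3.comp y h2).sub (ContDiffAt.clm_apply ?_ contDiffAt_fst)
  exact (rho n).contDiff.contDiffAt.comp y (T.contDiff.contDiffAt.comp y h2.snd).fst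

theorem odd_val : ∀ᶠ y in 𝓝 ((0 : Euc n), (T l).2), S (flip y) = -S y := by
  filter_upwards [H.val, (tendsto_flip _).eventually H.val, H.flip_inv,
    H.tendsto.eventually H.odd] with y h1 h2 h3 h4
  rw [h1, h2, h3, h4]
  simp only [flip, map_neg]
  ring

theorem lagParam_val : ∀ᶠ y in 𝓝 ((0 : Euc n), (T l).2), lagParam T S y = genMap G (h y) := by
  filter_upwards [H.smooth_inv, H.tendsto.eventually H.smooth, H.leg.eventually_nhds,
    H.val.eventually_nhds] with y h1 h2 h3 h4
  exact lagParam_legendre T (differentiableAt_of_smooth h1) (differentiableAt_of_smooth h2) h3 h4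

theorem lagParam_base : lagParam T S (0, (T l).2) = (0, l) := by
  rw [H.lagParam_val.self_of_nhds, H.base, genMap_zero H.odd]

/-- On a small neighbourhood the Legendre map is injective, so a critical point `x` is recovered as
`h` of the coordinates of its image. By continuity of `h` the same germ arises from every smaller
neighbourhood. -/
theorem generates : Generates G l {q | lagParam T S (lin T q) = q} := by
  obtain ⟨e, he, heG, -, -, -, -⟩ := exists_legChart H.toIsOddGerm H.inv
  have hs := e.open_source.mem_nhds he
  have hM : Tendsto (fun x => lin T (genMap G x)) (𝓝 ((0 : Euc n), l))
      (𝓝 ((0 : Euc n), (T l).2)) := by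
    have h1 := (contDiffAt_legMap T H.smooth.self_of_nhds).continuousAt.tendsto.fst_nhds
    rw [legMap_zero T H.odd H.crit] at h1
    exact h1
  have hlin : Tendsto (lin T) (𝓝 ((0, l) : Cot m)) (𝓝 ((0 : Euc n), (T l).2)) := by
    have := (lin T).continuous.tendsto ((0, l) : Cot m)
    rwa [lin_zero] at this
  refine ⟨_, inter_mem hs (inter_mem (hM.eventually H.lagParam_val)
    (inter_mem (hM.eventually H.leg)
      (hM.eventually (H.tendsto.eventually hs)))), fun O hO hO₀ => ?_⟩
  have hhO := H.tendsto.eventually hO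
  filter_upwards [hlin.eventually H.lagParam_val, hlin.eventually hhO,
    hlin.eventually H.leg] with q hq hqO hql
  refine propext ⟨?_, fun hfix => ⟨h (lin T q), ⟨?_, hqO⟩, ?_⟩⟩
  · rintro ⟨x, ⟨hxc, hxO⟩, rfl⟩
    obtain ⟨g1, g2, g3, g4⟩ := hO₀ hxO
    have g3' : legMap T G (h (lin T (genMap G x))) = (lin T (genMap G x), 0) := g3
    have g2' : lagParam T S (lin T (genMap G x)) = genMap G (h (lin T (genMap G x))) := g2
    have hx : h (lin T (genMap G x)) = x := by
      refine e.injOn g4 g1 ?_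
      rw [heG, heG, g3']
      exact Prod.ext rfl (fibreGrad_eq_zero.2 hxc).symm
    change lagParam T S (lin T (genMap G x)) = _
    rw [g2', hx]
  · exact fibreGrad_eq_zero.1 (congrArg Prod.snd hql)
  · rw [← hq]; exact hfix

theorem repr {L : Set (Cot m)} (hL : Generates G l L) : Repr T S L (0, l) := by
  filter_upwards [hL.unique H.generates] with q hq
  exact iff_of_eq hq

/-- An odd family with nondegenerate Legendre transform is equivalent to its normal form. -/
theorem roddEquiv : RoddEquiv G l (normalFamily T S) l := by
  obtain ⟨e, he, heG, hes, hesm, het, hsymm⟩ := exists_legChart H.toIsOddGerm H.inv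
  set N := normalFamily T S with hN
  -- The momenta `Φ₀` dual to the first block serve as new fibre variables. In them the normal form
  -- agrees with `G` to first order along the critical set, and the difference `D` is to be absorbed
  -- afterwards.
  set Φ₀ : Euc n × Euc m → Euc n := fun x => (legMap T G x).1.1 with hΦ₀
  have hΦs : ∀ᶠ x in 𝓝 ((0 : Euc n), l), ContDiffAt ℝ ∞ Φ₀ x :=
    H.smooth.mono fun x hx => (contDiffAt_legMap T hx).fst.fst
  have hΦodd : ∀ᶠ x in 𝓝 ((0 : Euc n), l), Φ₀ (flip x) = -Φ₀ x := by
    filter_upwards [H.odd.eventually_nhds] with x hx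
    simp only [hΦ₀]
    rw [legMap_flip T hx]; rfl
  have hM0 := legMap_zero T H.odd H.crit
  have hM : Tendsto (legMap T G) (𝓝 (0, l)) (𝓝 (((0 : Euc n), (T l).2), 0)) := by
    have := (contDiffAt_legMap T H.smooth.self_of_nhds).continuousAt.tendsto
    rwa [hM0] at this
  have hM1 : Tendsto (fun x => (legMap T G x).1) (𝓝 (0, l)) (𝓝 ((0 : Euc n), (T l).2)) :=
    hM.fst_nhds
  have hNs : ∀ᶠ x in 𝓝 ((0 : Euc n), l), ContDiffAt ℝ ∞ N (Φ₀ x, x.2) := by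
    filter_upwards [hM1.eventually H.smooth_val] with x hx
    exact contDiffAt_normalFamily T (x := (Φ₀ x, x.2)) hx
  set D : Euc n × Euc m → ℝ := fun x => G x - N (Φ₀ x, x.2) with hD
  have hDs : ∀ᶠ x in 𝓝 ((0 : Euc n), l), ContDiffAt ℝ ∞ D x := by
    filter_upwards [H.smooth, hNs, hΦs] with x h1 h2 h3
    exact h1.sub (ContDiffAt.comp (f := fun x => (Φ₀ x, x.2)) x h2 (h3.prodMk contDiffAt_snd))
  have hDodd : ∀ᶠ x in 𝓝 ((0 : Euc n), l), D (flip x) = -D x := by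
    filter_upwards [H.odd, hΦodd, hM1.eventually H.odd_val] with x h1 h2 h3
    simp only [hD, h1, h2, hN, normalFamily]
    have h3' : S (-Φ₀ x, (T x.2).2) = -S (Φ₀ x, (T x.2).2) := h3
    change -G x - (rho n (T x.2).1 (-Φ₀ x) + S (-Φ₀ x, (T x.2).2)) = _
    rw [h3', map_neg]; ring
  have hDh : ∀ᶠ y in 𝓝 ((0 : Euc n), (T l).2), D (h y) = 0 := by
    filter_upwards [H.leg, H.val] with y h1 h2
    have h3 : Φ₀ (h y) = y.1 := by simp only [hΦ₀, h1]
    have h4 : (T (h y).2).2 = y.2 := by rw [← legMap_fst_snd T G, h1]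
    simp only [hD, hN, normalFamily, h3, h4, h2]
    ring
  -- Both fibre derivatives vanish, so the derivative of `Φ₀` does not enter; the base derivatives
  -- agree because `S` and `G` generate the same Lagrangian submanifold.
  have hdDh : ∀ᶠ y in 𝓝 ((0 : Euc n), (T l).2), fderiv ℝ D (h y) = 0 := by
    filter_upwards [H.leg, H.lagParam_val, H.tendsto.eventually H.smooth,
      H.tendsto.eventually hΦs, H.smooth_val] with y h1 h2 h3 h4 h5
    have h6 : Φ₀ (h y) = y.1 := by simp only [hΦ₀, h1]
    have h7 : (T (h y).2).2 = y.2 := by rw [← legMap_fst_snd T G, h1]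
    have h8 : DifferentiableAt ℝ S (Φ₀ (h y), (T (h y).2).2) := by
      rw [h6, h7]; exact differentiableAt_of_smooth h5
    have hcG : fibreDeriv G (h y) = 0 := fibreGrad_eq_zero.1 (congrArg Prod.snd h1)
    have hcN : fibreDeriv N (Φ₀ (h y), (h y).2) = 0 := by
      refine (mem_critSet_normalFamily T (x := (Φ₀ (h y), (h y).2)) h8).2 ?_
      simp only [h6, h7]
      rw [h2]; rfl
    have hgN : (genMap N (Φ₀ (h y), (h y).2)).1 = (genMap G (h y)).1 := by
      rw [genMap_normalFamily_fst T (x := (Φ₀ (h y), (h y).2)) h8]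
      simp only [h6, h7]
      rw [h2]
    have hNd := (hasFDerivAt_normalFamily T (x := (Φ₀ (h y), (h y).2)) h8 0).1
    have hd1 : HasFDerivAt (fun x : Euc n × Euc m => (Φ₀ x, x.2)) _ (h y) :=
      (differentiableAt_of_smooth h4).hasFDerivAt.prodMk hasFDerivAt_snd
    have hd : HasFDerivAt D _ (h y) := (differentiableAt_of_smooth h3).hasFDerivAt.sub
      (HasFDerivAt.comp (g := N) (f := fun x => (Φ₀ x, x.2)) (h y) hNd.hasFDerivAt hd1)
    rw [hd.fderiv]
    refine ContinuousLinearMap.ext fun v => ?_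
    change fderiv ℝ G (h y) v - fderiv ℝ N (Φ₀ (h y), (h y).2) (fderiv ℝ Φ₀ (h y) v, v.2) = 0
    rw [fderiv_split, fderiv_split, hcG, hcN, hgN]
    simp
  -- the difference is a quadratic form in the fibre derivative
  have hhe : ∀ᶠ y in 𝓝 ((0 : Euc n), (T l).2), e.symm (y, 0) = h y := by
    filter_upwards [H.leg, H.tendsto.eventually (e.open_source.mem_nhds he)] with y hy hy'
    rw [← hy, ← heG, e.left_inv hy']
  have hsymt : Tendsto e.symm (𝓝 (((0 : Euc n), (T l).2), (0 : Euc n))) (𝓝 (0, l)) := by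
    have := (hesm _ het).continuousAt.tendsto
    rwa [hsymm] at this
  have hFs : ∀ᶠ p in 𝓝 (((0 : Euc n), (T l).2), (0 : Euc n)),
      ContDiffAt ℝ ∞ (fun p => D (e.symm p)) p := by
    filter_upwards [hsymt.eventually hDs, e.open_target.mem_nhds het] with p h1 h2
    exact h1.comp p (hesm p h2)
  obtain ⟨B, hB, hFB⟩ := exists_hadamard_two hFs
    (by filter_upwards [hDh, hhe] with y h1 h2; rw [h2, h1])
    (by
      filter_upwards [hdDh, hhe, (tendsto_inl_zero _).eventually (hsymt.eventually hDs),
        (tendsto_inl_zero _).eventually (e.open_target.mem_nhds het)] with y h1 h2 h3 h4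
      have h5 := (differentiableAt_of_smooth h3).hasFDerivAt.comp (y, (0 : Euc n))
        (differentiableAt_of_smooth (hesm _ h4)).hasFDerivAt
      have h6 := h5.fderiv
      rw [h2, h1, ContinuousLinearMap.zero_comp] at h6
      change (fderiv ℝ (D ∘ e.symm) _).comp _ = 0
      rw [h6, ContinuousLinearMap.zero_comp])
  have hDB : ∀ᶠ x in 𝓝 ((0 : Euc n), l), D x = B (legMap T G x) (fibreGrad G x)
      (fibreGrad G x) := by
    filter_upwards [hM.eventually hFB, e.open_source.mem_nhds he] with x h1 h2
    rw [← heG, e.left_inv h2, heG] at h1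
    exact h1
  -- `D` is odd and the fibre gradient is even, so antisymmetrising the coefficients under `flip`
  -- does not change the value of the quadratic form.
  set q : Euc n × Euc m → (Euc n →L[ℝ] Euc n →L[ℝ] ℝ) := fun x =>
    (1 / 2 : ℝ) • (B (legMap T G x) - B (legMap T G (flip x))) with hq
  have hqs : ∀ᶠ x in 𝓝 ((0 : Euc n), l), ContDiffAt ℝ ∞ q x := by
    have h0 : ∀ᶠ x in 𝓝 ((0 : Euc n), l), ContDiffAt ℝ ∞ (fun x => B (legMap T G x)) x := by
      filter_upwards [hM.eventually hB, H.smooth] with x h1 h2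
      exact h1.comp x (contDiffAt_legMap T h2)
    filter_upwards [h0, (tendsto_flip l).eventually h0] with x h1 h2
    have h3 : ContDiffAt ℝ ∞ (fun x => B (legMap T G (flip x))) x :=
      ContDiffAt.comp (g := fun x => B (legMap T G x)) (f := flip) x h2
        (flipL (Euc n) (Euc m)).contDiff.contDiffAt
    exact (h1.sub h3).const_smul (1 / 2 : ℝ)
  obtain ⟨Φ, hΦ1, hΦ2, hΦ3, hΦ4⟩ := exists_odd_change (R := rho n) rho_comm H.smooth H.odd
    (show partialFst G (0, l) = 0 from H.crit) hqs
    (fun x => by simp only [hq, flip_flip]; module)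
  have hGN : ∀ᶠ x in 𝓝 ((0 : Euc n), l), G (Φ x, x.2) = N (Φ₀ x, x.2) := by
    filter_upwards [hΦ4, hDB, (tendsto_flip l).eventually hDB, hDodd,
      H.odd.eventually_nhds] with x h1 h2 h3 h4 h5
    have h6 : fibreGrad G (flip x) = fibreGrad G x := by
      rw [fibreGrad, fibreDeriv_flip h5]; rfl
    have h7 : q x (fibreGrad G x) (fibreGrad G x) = D x := by
      rw [h4, h6] at h3
      simp only [hq, _root_.smul_apply, _root_.sub_apply, ← h2, ← h3, smul_eq_mul]
      ring
    have h8 : G (Φ x, x.2) = G x - q x (fibreGrad G x) (fibreGrad G x) := h1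
    rw [h8, h7]
    simp only [hD]; ring
  have hid : ∀ᶠ l' in 𝓝 l, ContDiffAt ℝ ∞ (fun l : Euc m => l) l' :=
    Eventually.of_forall fun _ => contDiffAt_id
  have hidinj : ∀ v, fderiv ℝ (fun l : Euc m => l) l v = 0 → v = 0 := by
    intro v hv
    rwa [show fderiv ℝ (fun l : Euc m => l) l = ContinuousLinearMap.id ℝ _ from fderiv_id] at hv
  have hE1 : RoddEquiv (fun x => G (Φ x, x.2)) l G l :=
    roddEquiv_iff.2 ⟨Φ, fun l => l, ⟨hΦ1, hid, rfl, hΦ2, fun b hb => by rwa [hΦ3] at hb, hidinj⟩,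
      Eventually.of_forall fun _ => rfl⟩
  have hE2 : RoddEquiv (fun x => G (Φ x, x.2)) l N l := by
    refine roddEquiv_iff.2 ⟨Φ₀, fun l => l, ⟨hΦs, hid, rfl, hΦodd, fun b hb => ?_, hidinj⟩, hGN⟩
    have hsm := H.smooth.self_of_nhds
    -- In direction `(b, 0)` the other components of the Legendre map have zero derivative: the
    -- second block does not involve `β`, and the fibre Hessian vanishes by oddness. Invertibility
    -- of the whole derivative thus makes the fibre block of `Φ₀` injective.
    have h1 : fderiv ℝ (legMap T G) (0, l) (b, 0) = 0 := by
      have hd := (differentiableAt_of_smooth (contDiffAt_legMap T hsm)).hasFDerivAt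
      have e1 : fderiv ℝ Φ₀ (0, l) (b, 0) = (fderiv ℝ (legMap T G) (0, l) (b, 0)).1.1 := by
        have : HasFDerivAt Φ₀ _ (0, l) := hd.fst.fst
        rw [this.fderiv]; rfl
      refine Prod.ext (Prod.ext ?_ ?_) ?_
      · rw [← e1, hb]; rfl
      · rw [fderiv_legMap T hsm]
        change (T (0 : Euc m)).2 = 0
        simp
      · rw [fderiv_legMap T hsm]
        change (rho n).symm (fibreRestrict n m (fderiv ℝ (fderiv ℝ G) (0, l) (b, 0))) = 0
        rw [← fderiv_fibreDeriv hsm, fderiv_fibreDeriv_zero H.odd, map_zero]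
    exact (Prod.mk_eq_zero.1 (IsInvertible.eq_zero H.inv h1)).1
  exact hE1.symm.trans hE2

end IsLegendre

end Legendre

end OddLagrangian

namespace OddLagrangian

set_option maxSynthPendingDepth 3

/-! ### Nondegeneracy of the Legendre transform -/

section Adapted

variable {n m : ℕ} {Q : Type} [NormedAddCommGroup Q] [NormedSpace ℝ Q]
  {T : Euc m ≃L[ℝ] Euc n × Q} {G : Euc n × Euc m → ℝ} {l : Euc m}

theorem hessian_symm {X : Type} [NormedAddCommGroup X] [NormedSpace ℝ X] {f : X → ℝ} {x : X}
    (h : ContDiffAt ℝ ∞ f x) (v w : X) :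
    fderiv ℝ (fderiv ℝ f) x v w = fderiv ℝ (fderiv ℝ f) x w v :=
  (h.isSymmSndFDerivAt
    (by simpa using (show ((2 : ℕ∞) : WithTop ℕ∞) ≤ ∞ from WithTop.coe_le_coe.2 le_top))).eq v w

/-- The base derivative of `G` is odd in `β`, hence vanishes along `β = 0`, and so does its
derivative along the parameters. -/
theorem hessian_base_zero (hG : IsOddGerm G l) (v w : Euc m) :
    fderiv ℝ (fderiv ℝ G) (0, l) (0, v) (0, w) = 0 := by
  have hfl : flip ((0 : Euc n), l) = (0, l) := by simp [flip]
  have h1 : ∀ᶠ x in 𝓝 ((0 : Euc n), l), fderiv ℝ G (flip x) (0, w) = -fderiv ℝ G x (0, w) := by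
    filter_upwards [hG.odd.eventually_nhds] with x hx
    rw [fderiv_odd hx]
    simp [flip]
  have h2 : HasFDerivAt (fun x => fderiv ℝ G x (0, w)) _ (0, l) :=
    (differentiableAt_of_smooth (contDiffAt_fderiv hG.smooth.self_of_nhds)).hasFDerivAt.clm_apply
      (hasFDerivAt_const (0, w) (0, l))
  have h3 := fderiv_odd (f := fun x => fderiv ℝ G x ((0 : Euc n), w)) h1 (0, v)
  rw [hfl, h2.fderiv] at h3
  refine eq_zero_of_eq_neg ?_
  simpa [flip] using h3

/-- Since the base-base block of the Hessian vanishes, a kernel vector `(b, v)` has `b = 0` as soon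
as the mixed block pairs `b` nondegenerately with the first block of `T`. Then `v` lies in the first
block and is killed by the same pairing read from the other side. -/
theorem legMap_isInvertible [FiniteDimensional ℝ Q] (hG : IsOddGerm G l)
    (h : ∀ b, (∀ a, fderiv ℝ (fderiv ℝ G) (0, l) (b, 0) (0, T.symm (a, 0)) = 0) → b = 0) :
    (fderiv ℝ (legMap T G) (0, l)).IsInvertible := by
  have hsm := hG.smooth.self_of_nhds
  set A := fderiv ℝ (fderiv ℝ G) (0, l) with hA
  have hfin : Module.finrank ℝ (Euc n × Euc m) = Module.finrank ℝ ((Euc n × Q) × Euc n) := by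
    rw [Module.finrank_prod, Module.finrank_prod (M := Euc n × Q), T.toLinearEquiv.finrank_eq,
      add_comm]
  refine isInvertible_of_injective hfin fun x hx => ?_
  obtain ⟨b, v⟩ := x
  rw [fderiv_legMap T hsm] at hx
  have h1 : (T v).2 = 0 := congrArg (fun z => z.1.2) hx
  have h2 : ∀ b', A (b, v) (b', 0) = 0 := by
    have : (rho n).symm (fibreRestrict n m (A (b, v))) = 0 := congrArg (fun z => z.2) hx
    rw [map_eq_zero_iff _ (rho n).symm.injective] at this
    exact fun b' => DFunLike.congr_fun this b'
  have h3 : ∀ a, A (b, v) (0, T.symm (a, 0)) = 0 := by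
    intro a
    have : (lin T (genLin n m (A (b, v), (b, v)))).1 = 0 := congrArg (fun z => z.1.1) hx
    have h4 := rho_lin_fst T (genLin n m (A (b, v), (b, v))) a
    rw [this, map_zero] at h4
    exact h4.symm
  have hsplit : ∀ z, A (b, v) z = A (b, 0) z + A (0, v) z := by
    intro z
    rw [← _root_.add_apply, ← map_add]
    simp
  have hb : b = 0 := h b fun a => by
    rw [← h3 a, hsplit, hessian_base_zero hG, add_zero]
  subst hb
  -- the pairing is nondegenerate on the other side by dimension
  set P : Euc n →L[ℝ] Euc n := ((rho n).symm : StrongDual ℝ (Euc n) →L[ℝ] Euc n).comp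
    (((ContinuousLinearMap.compL ℝ (Euc n) (Euc n × Euc m) ℝ).flip
      ((ContinuousLinearMap.inr ℝ (Euc n) (Euc m)).comp
        ((T.symm : Euc n × Q →L[ℝ] Euc m).comp (ContinuousLinearMap.inl ℝ (Euc n) Q)))).comp
      (A.comp (ContinuousLinearMap.inl ℝ (Euc n) (Euc m)))) with hP
  have hPa : ∀ b a, rho n (P b) a = A (b, 0) (0, T.symm (a, 0)) := by
    intro b a
    change rho n ((rho n).symm _) a = _
    rw [ContinuousLinearEquiv.apply_symm_apply]
    rfl
  have hPinj : Function.Injective (P : Euc n →ₗ[ℝ] Euc n) := by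
    rw [injective_iff_map_eq_zero]
    intro b hb
    refine h b fun a => ?_
    rw [← hPa, show P b = 0 from hb, map_zero]
    rfl
  obtain ⟨b', hb'⟩ := LinearMap.injective_iff_surjective.1 hPinj (T v).1
  have hv : v = T.symm ((T v).1, 0) := by
    rw [ContinuousLinearEquiv.eq_symm_apply, ← h1]
  have h5 : rho n (T v).1 (T v).1 = 0 := by
    nth_rewrite 1 [← hb']
    change rho n (P b') (T v).1 = 0
    rw [hPa, ← hv, hessian_symm hsm]
    exact h2 b'
  have h6 : (T v).1 = 0 := inner_self_eq_zero (𝕜 := ℝ).1 h5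
  rw [hv, h6]
  have : ((0 : Euc n), (0 : Q)) = 0 := rfl
  rw [this, map_zero]
  rfl

/-- Coordinates of the base that are adapted to a regular odd family. -/
theorem exists_adapted (hG : IsOddGerm G l)
    (hreg : Function.Surjective (fderiv ℝ (fibreDeriv G) (0, l))) :
    ∃ (k : ℕ) (T : Euc m ≃L[ℝ] Euc n × Euc k), (fderiv ℝ (legMap T G) (0, l)).IsInvertible := by
  have hsm := hG.smooth.self_of_nhds
  -- The fibre Hessian vanishes, so the surjectivity comes entirely from the parameters and `C` is
  -- onto. With `C` as first block of `T` and its kernel as second block, the mixed Hessian pairs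
  -- `b` with `T.symm (b, 0)` to `⟪b, b⟫`.
  set C : Euc m →L[ℝ] Euc n := ((rho n).symm : StrongDual ℝ (Euc n) →L[ℝ] Euc n).comp
    ((fderiv ℝ (fibreDeriv G) (0, l)).comp (ContinuousLinearMap.inr ℝ (Euc n) (Euc m))) with hC
  have hCs : Function.Surjective C := by
    intro a
    obtain ⟨⟨b, v⟩, hx⟩ := hreg (rho n a)
    refine ⟨v, ?_⟩
    have h1 : fderiv ℝ (fibreDeriv G) (0, l) (b, v) = fderiv ℝ (fibreDeriv G) (0, l) (0, v) := by
      have : (b, v) = (b, (0 : Euc m)) + (0, v) := by simp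
      rw [this, map_add, fderiv_fibreDeriv_zero hG.odd, zero_add]
    change (rho n).symm (fderiv ℝ (fibreDeriv G) (0, l) (0, v)) = a
    rw [← h1, hx, ContinuousLinearEquiv.symm_apply_apply]
  obtain ⟨s, hs⟩ := (C : Euc m →ₗ[ℝ] Euc n).exists_rightInverse_of_surjective
    (LinearMap.range_eq_top.2 hCs)
  have hri : Function.RightInverse (LinearMap.toContinuousLinearMap s) C := fun a =>
    LinearMap.congr_fun hs a
  set T₀ := ContinuousLinearEquiv.equivOfRightInverse C (LinearMap.toContinuousLinearMap s) hri
  have hfin : Module.finrank ℝ C.ker = Module.finrank ℝ (Euc (Module.finrank ℝ C.ker)) := by simp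
  set T := T₀.trans ((ContinuousLinearEquiv.refl ℝ (Euc n)).prodCongr
    (ContinuousLinearEquiv.ofFinrankEq hfin)) with hT
  refine ⟨_, T, legMap_isInvertible hG fun b hb => ?_⟩
  have hT1 : ∀ v, (T v).1 = C v := fun v => rfl
  have h1 := hb b
  rw [hessian_symm hsm] at h1
  have h2 : fderiv ℝ (fderiv ℝ G) (0, l) (0, T.symm (b, 0)) (b, 0) = rho n (C (T.symm (b, 0))) b := by
    change _ = rho n ((rho n).symm (fderiv ℝ (fibreDeriv G) (0, l) (0, T.symm (b, 0)))) b
    rw [ContinuousLinearEquiv.apply_symm_apply, fderiv_fibreDeriv hsm]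
    rfl
  rw [h2, ← hT1, ContinuousLinearEquiv.apply_symm_apply] at h1
  exact inner_self_eq_zero (𝕜 := ℝ).1 h1

end Adapted

/-! ### Odd generating functions -/

section GenFun

variable {n m : ℕ} {Q : Type} [NormedAddCommGroup Q] [NormedSpace ℝ Q]

/-- `S` is a smooth odd function germ at `(0, (T l).2)` whose Lagrangian germ passes through
`(0, l)`. -/
structure IsOddGenFun (T : Euc m ≃L[ℝ] Euc n × Q) (S : Euc n × Q → ℝ) (l : Euc m) : Prop where
  smooth : ∀ᶠ y in 𝓝 ((0 : Euc n), (T l).2), ContDiffAt ℝ ∞ S y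
  odd : ∀ᶠ y in 𝓝 ((0 : Euc n), (T l).2), S (flip y) = -S y
  base : lagParam T S (0, (T l).2) = (0, l)

variable {T : Euc m ≃L[ℝ] Euc n × Q} {S S' : Euc n × Q → ℝ} {l : Euc m}

theorem IsLegendre.isOddGenFun {G : Euc n × Euc m → ℝ} {h : Euc n × Q → Euc n × Euc m}
    (H : IsLegendre T G l h S) : IsOddGenFun T S l := ⟨H.smooth_val, H.odd_val, H.lagParam_base⟩

theorem IsOddGenFun.congr (H : IsOddGenFun T S l) (h : S =ᶠ[𝓝 (0, (T l).2)] S') :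
    IsOddGenFun T S' l := by
  refine ⟨?_, ?_, ?_⟩
  · filter_upwards [H.smooth, h.eventuallyEq_nhds] with y h1 h2
      using h1.congr_of_eventuallyEq h2.symm
  · filter_upwards [H.odd, h, (tendsto_flip _).eventually h] with y h1 h2 h3
    rw [← h3, ← h2, h1]
  · rw [lagParam, ← h.fderiv_eq]; exact H.base

theorem fderiv_eq_of_lagParam_eq {y : Euc n × Q} (h : lagParam T S y = lagParam T S' y) :
    fderiv ℝ S y = fderiv ℝ S' y := by
  refine ContinuousLinearMap.ext fun v => ?_
  have hv : v = (v.1, 0) + (0, v.2) := by simp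
  rw [hv, map_add, map_add]
  congr 1
  · have h1 := congrArg (fun q => -rho n (T q.2).1 v.1) h
    simp only [lagParam_snd, ContinuousLinearEquiv.apply_symm_apply, map_neg, _root_.neg_apply,
      neg_neg] at h1
    exact h1
  · have h1 := congrArg (fun q => q.1 (T.symm (0, v.2))) h
    simp only [lagParam_fst_apply, ContinuousLinearEquiv.apply_symm_apply] at h1
    exact add_left_cancel h1

theorem eventuallyEq_of_fderiv_eq {X : Type} [NormedAddCommGroup X] [NormedSpace ℝ X]
    {f g : X → ℝ} {x : X} (hf : ∀ᶠ y in 𝓝 x, DifferentiableAt ℝ f y)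
    (hg : ∀ᶠ y in 𝓝 x, DifferentiableAt ℝ g y) (h : ∀ᶠ y in 𝓝 x, fderiv ℝ f y = fderiv ℝ g y)
    (hx : f x = g x) : f =ᶠ[𝓝 x] g := by
  obtain ⟨ε, hε, hb⟩ := Metric.eventually_nhds_iff_ball.1 (hf.and (hg.and h))
  filter_upwards [Metric.ball_mem_nhds x hε] with y hy
  have h1 := Metric.isOpen_ball.is_const_of_fderiv_eq_zero (𝕜 := ℝ) (f := fun y => f y - g y)
    (convex_ball x ε).isPreconnected
    (fun z hz => ((hb z hz).1.sub (hb z hz).2.1).differentiableWithinAt)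
    (fun z hz => by
      have : fderiv ℝ (fun y => f y - g y) z = fderiv ℝ f z - fderiv ℝ g z :=
        fderiv_sub (hb z hz).1 (hb z hz).2.1
      rw [this, (hb z hz).2.2, sub_self]; rfl) hy (Metric.mem_ball_self hε)
  simp only [hx, sub_self] at h1
  exact sub_eq_zero.1 h1

theorem IsOddGenFun.value (H : IsOddGenFun T S l) : S (0, (T l).2) = 0 := by
  have := H.odd.self_of_nhds
  have hfl : flip ((0 : Euc n), (T l).2) = (0, (T l).2) := by simp [flip]
  rw [hfl] at this
  exact eq_zero_of_eq_neg this

theorem IsOddGenFun.tendsto (H : IsOddGenFun T S l) :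
    Tendsto (lagParam T S) (𝓝 (0, (T l).2)) (𝓝 (0, l)) := by
  have := (contDiffAt_lagParam T H.smooth.self_of_nhds).continuousAt.tendsto
  rwa [H.base] at this

/-- In the coordinates `lin T` the Lagrangian germ is a graph and determines the derivative of its
generating function; the constant of integration is fixed because odd functions vanish at the
centre. -/
theorem IsOddGenFun.unique {L : Set (Cot m)} (H : IsOddGenFun T S l) (H' : IsOddGenFun T S' l)
    (h : Repr T S L (0, l)) (h' : Repr T S' L (0, l)) : S =ᶠ[𝓝 (0, (T l).2)] S' := by
  refine eventuallyEq_of_fderiv_eq (H.smooth.mono fun y hy => differentiableAt_of_smooth hy)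
    (H'.smooth.mono fun y hy => differentiableAt_of_smooth hy) ?_ (by rw [H.value, H'.value])
  filter_upwards [H.tendsto.eventually h, H.tendsto.eventually h'] with y h1 h2
  rw [lin_lagParam] at h1 h2
  exact (fderiv_eq_of_lagParam_eq (h2.1 (h1.2 rfl))).symm

theorem tendsto_normalCoord (l : Euc m) : Tendsto (fun x : Euc n × Euc m => (x.1, (T x.2).2))
    (𝓝 (0, l)) (𝓝 (0, (T l).2)) := by
  have h : Continuous fun x : Euc n × Euc m => (x.1, (T x.2).2) := by fun_prop
  exact h.tendsto (0, l)

theorem normalFamily_congr (h : S =ᶠ[𝓝 (0, (T l).2)] S') :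
    normalFamily T S =ᶠ[𝓝 (0, l)] normalFamily T S' := by
  filter_upwards [(tendsto_normalCoord l).eventually h] with x hx
  simp only [normalFamily, hx]

theorem IsOddGenFun.isOddGerm (H : IsOddGenFun T S l) : IsOddGerm (normalFamily T S) l := by
  refine ⟨?_, ?_, ?_⟩
  · filter_upwards [(tendsto_normalCoord l).eventually H.smooth] with x hx
    exact contDiffAt_normalFamily T hx
  · filter_upwards [(tendsto_normalCoord l).eventually H.odd] with x hx
    change rho n (T x.2).1 (-x.1) + S (-x.1, (T x.2).2) = _
    rw [show S (-x.1, (T x.2).2) = -S (x.1, (T x.2).2) from hx, map_neg, normalFamily]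
    ring
  · refine (mem_critSet_normalFamily T (x := ((0 : Euc n), l))
      (differentiableAt_of_smooth H.smooth.self_of_nhds)).2 ?_
    rw [H.base]

theorem legMap_normalFamily {x : Euc n × Euc m} (hS : DifferentiableAt ℝ S (x.1, (T x.2).2)) :
    legMap T (normalFamily T S) x = ((x.1, (T x.2).2),
      (T x.2).1 - (T (lagParam T S (x.1, (T x.2).2)).2).1) := by
  refine Prod.ext (Prod.ext ?_ rfl) ?_
  · rw [legMap_fst, lin_fst, genMap_normalFamily_fst T hS, ← lin_fst, lin_lagParam]
  · rw [legMap_snd, fibreGrad, fibreDeriv_normalFamily T hS, map_add,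
      ContinuousLinearEquiv.symm_apply_apply, lagParam_snd]
    simp

/-- A generating function is the Legendre transform of its own normal form: the Legendre map of a
normal form only shears the first block by the base point of `lagParam`, and its mixed Hessian is
the standard inner product. In particular every odd generating function is realised by an odd
family. -/
theorem IsOddGenFun.isLegendre [FiniteDimensional ℝ Q] (H : IsOddGenFun T S l) :
    IsLegendre T (normalFamily T S) l (fun y => (y.1, (lagParam T S y).2)) S := by
  have hT2 : ∀ y, (T (lagParam T S y).2).2 = y.2 := fun y => by rw [lagParam_snd]; simp
  refine ⟨H.isOddGerm, legMap_isInvertible H.isOddGerm fun b hb => ?_, ?_, ?_, ?_, ?_⟩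
  · have hev : ∀ a, (fun x => fderiv ℝ (normalFamily T S) x (0, T.symm (a, 0))) =ᶠ[𝓝 (0, l)]
        fun x : Euc n × Euc m => rho n a x.1 := by
      intro a
      filter_upwards [(tendsto_normalCoord l).eventually H.smooth] with x hx
      rw [(hasFDerivAt_normalFamily T (differentiableAt_of_smooth hx) _).2]
      simp only [ContinuousLinearEquiv.apply_symm_apply, map_zero, zero_add]
      rw [show ((0 : Euc n), (0 : Q)) = 0 from rfl, map_zero, add_zero]
    have h1 := hb b
    have h2 : HasFDerivAt (fun x => fderiv ℝ (normalFamily T S) x (0, T.symm (b, 0))) _ (0, l) :=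
      (differentiableAt_of_smooth (contDiffAt_fderiv
        H.isOddGerm.smooth.self_of_nhds)).hasFDerivAt.clm_apply (hasFDerivAt_const _ _)
    have h3 : HasFDerivAt (fun x : Euc n × Euc m => rho n b x.1) _ (0, l) :=
      (rho n b).hasFDerivAt.comp (0, l) hasFDerivAt_fst
    have h4 := DFunLike.congr_fun (h2.unique (h3.congr_of_eventuallyEq (hev b))) (b, 0)
    simp only [ContinuousLinearMap.comp_zero, zero_add, ContinuousLinearMap.flip_apply,
      ContinuousLinearMap.comp_apply, ContinuousLinearMap.coe_fst'] at h4
    rw [h1] at h4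
    exact inner_self_eq_zero (𝕜 := ℝ).1 h4.symm
  · exact continuousAt_fst.prodMk
      (contDiffAt_lagParam T H.smooth.self_of_nhds).snd.continuousAt
  · simp only [H.base]
  · filter_upwards [H.smooth] with y hy
    rw [legMap_normalFamily (x := (y.1, (lagParam T S y).2))]
    · simp only [hT2, sub_self]
    · simp only [hT2]; exact differentiableAt_of_smooth hy
  · refine Eventually.of_forall fun y => ?_
    simp only [normalFamily, hT2]
    ring

end GenFun

end OddLagrangian

namespace OddLagrangian

set_option maxSynthPendingDepth 3
set_option linter.unusedSectionVars false

/-! ### Fibred equivalences of families and of Lagrangian submanifolds -/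

section Transport

variable {n m : ℕ} {F G : Euc n × Euc m → ℝ} {Φ : Euc n × Euc m → Euc n} {Λ : Euc m → Euc m}
  {l₀ l₁ : Euc m} {Θ : Cot m → Cot m}

namespace IsFibredOddGerm

variable (H : IsFibredOddGerm Φ Λ l₀ l₁)

include H

theorem eventually_base_invertible : ∀ᶠ l in 𝓝 l₀, (fderiv ℝ Λ l).IsInvertible :=
  (contDiffAt_fderiv H.base_smooth.self_of_nhds).continuousAt.eventually
    (IsInvertible.eventually (isInvertible_of_injective rfl H.base_inj))

theorem eventually_fibre_invertible : ∀ᶠ x in 𝓝 ((0 : Euc n), l₀),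
    ((fderiv ℝ Φ x).comp (ContinuousLinearMap.inl ℝ (Euc n) (Euc m))).IsInvertible := by
  have h1 : ContinuousAt (fun x => (fderiv ℝ Φ x).comp (ContinuousLinearMap.inl ℝ (Euc n) (Euc m)))
      (0, l₀) := ((contDiffAt_fderiv H.smooth.self_of_nhds).clm_comp
        contDiffAt_const).continuousAt
  exact h1.eventually (IsInvertible.eventually (isInvertible_of_injective rfl H.inj))

theorem map_zero : Φ (0, l₀) = 0 := by
  have h0 := H.odd.self_of_nhds
  simp only [neg_zero] at h0
  exact eq_zero_of_eq_neg h0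

theorem tendsto : Tendsto (fun x : Euc n × Euc m => (Φ x, Λ x.2)) (𝓝 (0, l₀)) (𝓝 (0, l₁)) :=
  (isFibredOddGerm_iff.1 H).1.tendsto

theorem exists_leftInverse : ∃ Λ' : Euc m → Euc m, Tendsto Λ' (𝓝 l₁) (𝓝 l₀) ∧
    (∀ᶠ l in 𝓝 l₀, Λ' (Λ l) = l) ∧ ∀ᶠ l in 𝓝 l₁, Λ (Λ' l) = l := by
  have hΛ : IsDiffeoGerm Λ l₀ l₁ := isDiffeoGerm_iff.2 ⟨H.base_eq, H.base_smooth,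
    isInvertible_of_injective rfl H.base_inj⟩
  obtain ⟨Λ', hΛ', hll, hr⟩ := hΛ.exists_inverse
  exact ⟨Λ', hΛ'.tendsto, hll, hr⟩

theorem eventually_germ : ∀ᶠ l in 𝓝 l₀, IsFibredOddGerm Φ Λ l (Λ l) := by
  have hc : Tendsto (fun l : Euc m => ((0 : Euc n), l)) (𝓝 l₀) (𝓝 (0, l₀)) :=
    (Continuous.prodMk_right (0 : Euc n)).tendsto l₀
  filter_upwards [hc.eventually H.smooth.eventually_nhds, H.base_smooth.eventually_nhds,
    hc.eventually H.odd.eventually_nhds, hc.eventually H.eventually_fibre_invertible,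
    H.eventually_base_invertible] with l h1 h2 h3 h4 h5
  exact ⟨h1, h2, rfl, h3, fun b hb => IsInvertible.eq_zero h4 hb,
    fun v hv => IsInvertible.eq_zero h5 hv⟩

end IsFibredOddGerm

theorem fderiv_comp_fibred {x : Euc n × Euc m} (hG : DifferentiableAt ℝ G (Φ x, Λ x.2))
    (hΦ : ContDiffAt ℝ ∞ Φ x) (hΛ : ContDiffAt ℝ ∞ Λ x.2)
    (hF : ∀ᶠ y in 𝓝 x, F y = G (Φ y, Λ y.2)) (v : Euc n × Euc m) :
    fderiv ℝ F x v = fibreDeriv G (Φ x, Λ x.2) (fderiv ℝ Φ x v) +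
      (genMap G (Φ x, Λ x.2)).1 (fderiv ℝ Λ x.2 v.2) := by
  have h1 := HasFDerivAt.comp (g := G) (f := fun x : Euc n × Euc m => (Φ x, Λ x.2)) x
    hG.hasFDerivAt (hasFDerivAt_fibred hΦ hΛ)
  rw [(h1.congr_of_eventuallyEq hF).fderiv]
  exact fderiv_split G _ _

theorem IsOddGerm.comp (hG : IsOddGerm G l₁) (H : IsFibredOddGerm Φ Λ l₀ l₁)
    (hF : ∀ᶠ x in 𝓝 ((0 : Euc n), l₀), F x = G (Φ x, Λ x.2)) : IsOddGerm F l₀ := by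
  have hs2 : Tendsto (Prod.snd : Euc n × Euc m → Euc m) (𝓝 (0, l₀)) (𝓝 l₀) :=
    continuous_snd.tendsto _
  refine ⟨?_, ?_, ?_⟩
  · filter_upwards [H.tendsto.eventually hG.smooth, hF.eventually_nhds, H.smooth,
      hs2.eventually H.base_smooth] with x h1 h2 h3 h4
    refine ContDiffAt.congr_of_eventuallyEq ?_ h2
    exact ContDiffAt.comp (g := G) (f := fun x : Euc n × Euc m => (Φ x, Λ x.2)) x h1
      (h3.prodMk (h4.comp x contDiffAt_snd))
  · filter_upwards [hF, (tendsto_flip l₀).eventually hF, H.odd,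
      H.tendsto.eventually hG.odd] with x h1 h2 h3 h4
    rw [h2, h1, ← h4]
    change G (Φ (-x.1, x.2), Λ x.2) = _
    rw [h3]; rfl
  · change fibreDeriv F _ = 0
    ext b
    change fderiv ℝ F (0, l₀) (b, 0) = 0
    have hx : (Φ (0, l₀), Λ l₀) = (0, l₁) := by rw [H.map_zero, H.base_eq]
    rw [fderiv_comp_fibred (by rw [hx]; exact differentiableAt_of_smooth hG.smooth.self_of_nhds)
      H.smooth.self_of_nhds H.base_smooth.self_of_nhds hF]
    simp only [hx]
    rw [show fibreDeriv G (0, l₁) = 0 from hG.crit]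
    simp

/-- `Θ` is the lift of `Λ` to the cotangent bundles near the point `(0, l₀)`. -/
def IsCotLift (Θ : Cot m → Cot m) (Λ : Euc m → Euc m) (l₀ : Euc m) : Prop :=
  ∀ᶠ q in 𝓝 ((0, l₀) : Cot m), (Θ q).2 = Λ q.2 ∧ (Θ q).1.comp (fderiv ℝ Λ q.2) = q.1

/-- Chain rule. The fibre block of the change of variables is invertible, so critical points
correspond; at a critical point the contribution of `Φ` drops out and the base derivatives are
related by `dΛ` alone, which is the relation defining the cotangent lift. -/
theorem Generates.transport {L : Set (Cot m)} (hL : Generates G l₁ L)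
    (hG : ∀ᶠ x in 𝓝 ((0 : Euc n), l₁), ContDiffAt ℝ ∞ G x) (H : IsFibredOddGerm Φ Λ l₀ l₁)
    (hF : ∀ᶠ x in 𝓝 ((0 : Euc n), l₀), F x = G (Φ x, Λ x.2)) (hΘ : IsCotLift Θ Λ l₀)
    (ht : Tendsto Θ (𝓝 (0, l₀)) (𝓝 (0, l₁))) : Generates F l₀ {q | Θ q ∈ L} := by
  obtain ⟨O₁, hO₁, hL⟩ := hL
  obtain ⟨e, he, he1, hes, hes', heq⟩ := (isFibredOddGerm_iff.1 H).1
  obtain ⟨Λ', hΛ', hΛl, -⟩ := H.exists_leftInverse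
  have hs2 : Tendsto (Prod.snd : Euc n × Euc m → Euc m) (𝓝 (0, l₀)) (𝓝 l₀) :=
    continuous_snd.tendsto _
  have hq2 : Tendsto (Prod.snd : Cot m → Euc m) (𝓝 (0, l₀)) (𝓝 l₀) := continuous_snd.tendsto _
  -- facts that hold near the base point
  have hd : ∀ᶠ x in 𝓝 ((0 : Euc n), l₀), ∀ v, fderiv ℝ F x v =
      fibreDeriv G (Φ x, Λ x.2) (fderiv ℝ Φ x v) +
      (genMap G (Φ x, Λ x.2)).1 (fderiv ℝ Λ x.2 v.2) := by
    filter_upwards [H.tendsto.eventually hG, hF.eventually_nhds, H.smooth,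
      hs2.eventually H.base_smooth] with x h1 h2 h3 h4
    exact fderiv_comp_fibred (differentiableAt_of_smooth h1) h3 h4 h2
  have hcrit : ∀ᶠ x in 𝓝 ((0 : Euc n), l₀), (x ∈ critSet F ↔ (Φ x, Λ x.2) ∈ critSet G) := by
    filter_upwards [hd, H.eventually_fibre_invertible] with x h1 h2
    have h3 : ∀ b, fibreDeriv F x b = fibreDeriv G (Φ x, Λ x.2) (fderiv ℝ Φ x (b, 0)) := by
      intro b
      have := h1 (b, 0)
      simp only [_root_.map_zero, add_zero] at this
      exact this
    constructor
    · intro hx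
      obtain ⟨A, hA⟩ := h2
      change fibreDeriv G _ = 0
      ext b
      have h4 : fderiv ℝ Φ x (A.symm b, 0) = b := by
        have := DFunLike.congr_fun hA (A.symm b)
        simp only [ContinuousLinearEquiv.coe_coe, ContinuousLinearEquiv.apply_symm_apply] at this
        exact this.symm
      rw [← h4, ← h3, show fibreDeriv F x = 0 from hx]; rfl
    · intro hx
      change fibreDeriv F x = 0
      ext b
      rw [h3, show fibreDeriv G _ = 0 from hx]; rfl
  have hgen : ∀ᶠ x in 𝓝 ((0 : Euc n), l₀), x ∈ critSet F →
      (genMap F x).1 = (genMap G (Φ x, Λ x.2)).1.comp (fderiv ℝ Λ x.2) := by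
    filter_upwards [hd, hcrit] with x h1 h2 hx
    ext w
    change fderiv ℝ F x (0, w) = _
    rw [h1, show fibreDeriv G _ = 0 from h2.1 hx]
    simp
  refine ⟨_, inter_mem (e.open_source.mem_nhds he) (inter_mem (H.tendsto hO₁)
    (inter_mem heq (inter_mem hcrit (inter_mem hgen (inter_mem
      (hs2.eventually hΛl) (hs2.eventually H.eventually_base_invertible)))))),
    fun O hO hOO => ?_⟩
  have het : (0, l₁) ∈ e.target := he1 ▸ e.map_source he
  have hsym : Tendsto e.symm (𝓝 (0, l₁)) (𝓝 (0, l₀)) := by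
    have := (e.continuousAt_symm het).tendsto
    rwa [← he1, e.left_inv he, he1] at this
  have hO' : e.target ∩ e.symm ⁻¹' O ∈ 𝓝 ((0 : Euc n), l₁) :=
    inter_mem (e.open_target.mem_nhds het) (hsym hO)
  have hsub : e.target ∩ e.symm ⁻¹' O ⊆ O₁ := by
    rintro y ⟨hy, hyO⟩
    obtain ⟨g1, g2, g3, -⟩ := hOO hyO
    have g2' : (Φ (e.symm y), Λ (e.symm y).2) ∈ O₁ := g2
    have g3' : (Φ (e.symm y), Λ (e.symm y).2) = e (e.symm y) := g3
    rwa [g3', e.right_inv hy] at g2'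
  have hL' := hL _ hO' hsub
  filter_upwards [hΘ, ht.eventually hL', hq2.eventually hΛl,
    hq2.eventually H.eventually_base_invertible] with q hq hqL hql hqinv
  have hqL' : Θ q ∈ genMap G '' (critSet G ∩ (e.target ∩ e.symm ⁻¹' O)) ↔ Θ q ∈ L :=
    iff_of_eq hqL
  refine propext (Iff.trans ?_ hqL')
  have hsurj : ∀ w, ∃ v, fderiv ℝ Λ q.2 v = w := by
    obtain ⟨A, hA⟩ := hqinv
    intro w
    refine ⟨A.symm w, ?_⟩
    have := DFunLike.congr_fun hA (A.symm w)
    simp only [ContinuousLinearEquiv.coe_coe, ContinuousLinearEquiv.apply_symm_apply] at this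
    exact this.symm
  constructor
  · rintro ⟨x, ⟨hxc, hxO⟩, rfl⟩
    obtain ⟨g1, g2, g3, g4, g5, g6, g7⟩ := hOO hxO
    have g3' : (Φ x, Λ x.2) = e x := g3
    refine ⟨(Φ x, Λ x.2), ⟨g4.1 hxc, ?_, ?_⟩, ?_⟩
    · rw [g3']; exact e.map_source g1
    · rw [g3']; change e.symm (e x) ∈ O
      rwa [e.left_inv g1]
    · refine Prod.ext ?_ hq.1.symm
      ext w
      obtain ⟨v, rfl⟩ := hsurj w
      have h1 := DFunLike.congr_fun (g5 hxc) v
      have h2 := DFunLike.congr_fun hq.2 v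
      exact h1.symm.trans h2.symm
  · rintro ⟨y, ⟨hyc, hyt, hyO⟩, hy⟩
    obtain ⟨g1, g2, g3, g4, g5, g6, g7⟩ := hOO hyO
    set x := e.symm y with hx
    have g3' : (Φ x, Λ x.2) = y := by
      have : (Φ x, Λ x.2) = e x := g3
      rw [this, hx, e.right_inv hyt]
    have hxc : x ∈ critSet F := g4.2 (by rw [g3']; exact hyc)
    have h2 : x.2 = q.2 := by
      have h3 : Λ x.2 = Λ q.2 := by
        rw [← hq.1, ← hy]; exact congrArg Prod.snd g3'
      rw [← hql, ← h3]; exact g6.symm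
    refine ⟨x, ⟨hxc, hyO⟩, Prod.ext ?_ h2⟩
    rw [g5 hxc, g3', hy, h2, hq.2]

/-- Equivalent odd families generate equivalent Lagrangian germs. -/
theorem SymLagrangianEquiv.of_roddEquiv {L L' : Set (Cot m)} (hFG : RoddEquiv F l₀ G l₁)
    (hF : Generates F l₀ L) (hG : Generates G l₁ L')
    (hGs : ∀ᶠ x in 𝓝 ((0 : Euc n), l₁), ContDiffAt ℝ ∞ G x) :
    SymLagrangianEquiv L (0, l₀) L' (0, l₁) := by
  obtain ⟨Φ, Λ, H, hFGe⟩ := roddEquiv_iff.1 hFG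
  have hq2 : Tendsto (Prod.snd : Cot m → Euc m) (𝓝 (0, l₀)) (𝓝 l₀) := continuous_snd.tendsto _
  set Θ : Cot m → Cot m := fun q => (q.1.comp (fderiv ℝ Λ q.2).inverse, Λ q.2) with hΘ
  have hlift : IsCotLift Θ Λ l₀ := by
    filter_upwards [hq2.eventually H.eventually_base_invertible] with q hq
    obtain ⟨A, hA⟩ := hq
    refine ⟨rfl, ?_⟩
    simp only [hΘ]
    rw [← hA, ContinuousLinearMap.inverse_equiv]
    ext v
    simp
  have hΘs : ∀ᶠ q in 𝓝 ((0, l₀) : Cot m), ContDiffAt ℝ ∞ Θ q := by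
    filter_upwards [hq2.eventually H.eventually_base_invertible,
      hq2.eventually H.base_smooth] with q hq1 hq2
    obtain ⟨A, hA⟩ := hq1
    have h1 : ContDiffAt ℝ ∞ (fun l => (fderiv ℝ Λ l).inverse) q.2 := by
      have h2 := contDiffAt_map_inverse (n := ∞) A
      rw [hA] at h2
      exact h2.comp q.2 (contDiffAt_fderiv hq2)
    exact (contDiffAt_fst.clm_comp (h1.comp q contDiffAt_snd)).prodMk (hq2.comp q contDiffAt_snd)
  have hΘ0 : Θ (0, l₀) = (0, l₁) := by simp [hΘ, H.base_eq]
  have ht : Tendsto Θ (𝓝 (0, l₀)) (𝓝 (0, l₁)) := by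
    have := hΘs.self_of_nhds.continuousAt.tendsto
    rwa [hΘ0] at this
  have hsymp : ∀ᶠ q in 𝓝 ((0, l₀) : Cot m), ∀ v w : Cot m,
      symp (fderiv ℝ Θ q v) (fderiv ℝ Θ q w) = symp v w := by
    filter_upwards [hΘs, hlift.eventually_nhds, hq2.eventually H.base_smooth] with q h1 h2 h3 v w
    have hd := (differentiableAt_of_smooth h1).hasFDerivAt
    have hd2 : HasFDerivAt (fun q : Cot m => fderiv ℝ Λ q.2)
        ((fderiv ℝ (fderiv ℝ Λ) q.2).comp (ContinuousLinearMap.snd ℝ _ _)) q :=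
      (differentiableAt_of_smooth (contDiffAt_fderiv h3)).hasFDerivAt.comp q hasFDerivAt_snd
    have h4 : ∀ v, (fderiv ℝ Θ q v).2 = fderiv ℝ Λ q.2 v.2 := by
      intro v
      have e1 : HasFDerivAt (fun q => (Θ q).2) _ q := hd.snd
      have e2 : HasFDerivAt (fun q => (Θ q).2) _ q :=
        ((differentiableAt_of_smooth h3).hasFDerivAt.comp q hasFDerivAt_snd).congr_of_eventuallyEq
          (h2.mono fun q hq => hq.1)
      exact DFunLike.congr_fun (e1.unique e2) v
    -- Differentiating the defining relation of the lift produces an error term in the second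
    -- derivative of `Λ`; it is symmetric in `v` and `w` and cancels in the symplectic form.
    have h5 : ∀ v w : Cot m, (fderiv ℝ Θ q v).1 (fderiv ℝ Λ q.2 w.2) =
        v.1 w.2 - (Θ q).1 (fderiv ℝ (fderiv ℝ Λ) q.2 v.2 w.2) := by
      intro v w
      have e1 : HasFDerivAt (fun q => (Θ q).1 (fderiv ℝ Λ q.2 w.2)) _ q :=
        hd.fst.clm_apply (hd2.clm_apply (hasFDerivAt_const w.2 q))
      have e2 : HasFDerivAt (fun q : Cot m => q.1 w.2) _ q :=
        (hasFDerivAt_fst (𝕜 := ℝ) (p := q)).clm_apply (hasFDerivAt_const w.2 q)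
      have e3 := DFunLike.congr_fun (e1.unique (e2.congr_of_eventuallyEq
        (h2.mono fun q hq => DFunLike.congr_fun hq.2 w.2))) v
      simp at e3
      linarith
    have h6 : fderiv ℝ (fderiv ℝ Λ) q.2 v.2 w.2 = fderiv ℝ (fderiv ℝ Λ) q.2 w.2 v.2 :=
      (h3.isSymmSndFDerivAt (by
        simpa using (show ((2 : ℕ∞) : WithTop ℕ∞) ≤ ∞ from WithTop.coe_le_coe.2 le_top))).eq _ _
    simp only [symp, h4, h5, h6]
    ring
  refine ⟨Θ, isDiffeoGerm_iff.2 ⟨hΘ0, hΘs, isInvertible_of_injective rfl fun v hv => ?_⟩,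
    ⟨Λ, hlift.mono fun q hq => hq.1⟩, hsymp, Eventually.of_forall fun q => ?_, ?_⟩
  · have h1 : ∀ w, symp v w = 0 := by
      intro w
      rw [← hsymp.self_of_nhds v w, hv]
      simp [symp]
    have hv1 : v.1 = 0 := by
      ext w
      have := h1 (0, w)
      simpa [symp] using this
    have hv2 : ∀ κ : StrongDual ℝ (Euc m), κ v.2 = 0 := by
      intro κ
      have := h1 (κ, 0)
      simpa [symp] using this
    refine Prod.ext hv1 ?_
    have := hv2 (rho m v.2)
    exact inner_self_eq_zero (𝕜 := ℝ).1 this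
  · simp only [hΘ, zeta]
    refine Prod.ext ?_ rfl
    ext v; simp
  · have hgen := hG.transport hGs H hFGe hlift ht
    filter_upwards [hF.unique hgen] with q hq using iff_of_eq hq

/-- A symmetric Lagrangian equivalence is the lift of a diffeomorphism of the base. -/
theorem SymLagrangianEquiv.exists_cotLift {L L' : Set (Cot m)}
    (h : SymLagrangianEquiv L (0, l₀) L' (0, l₁)) :
    ∃ (Θ : Cot m → Cot m) (φ : Euc m → Euc m), IsDiffeoGerm Θ (0, l₀) (0, l₁) ∧
      (∀ᶠ l in 𝓝 l₀, ContDiffAt ℝ ∞ φ l) ∧ φ l₀ = l₁ ∧ (∀ v, fderiv ℝ φ l₀ v = 0 → v = 0) ∧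
      IsCotLift Θ φ l₀ ∧ ∀ᶠ q in 𝓝 ((0, l₀) : Cot m), q ∈ L ↔ Θ q ∈ L' := by
  obtain ⟨Θ, hΘ, ⟨φ', hφ'⟩, hsymp, hodd, hL⟩ := h
  obtain ⟨hΘ0, hΘs, hΘi⟩ := isDiffeoGerm_iff.1 hΘ
  have hq2 : Tendsto (Prod.snd : Cot m → Euc m) (𝓝 (0, l₀)) (𝓝 l₀) := continuous_snd.tendsto _
  have hin : Tendsto (fun l : Euc m => ((0, l) : Cot m)) (𝓝 l₀) (𝓝 (0, l₀)) :=
    (Continuous.prodMk_right (0 : StrongDual ℝ (Euc m))).tendsto l₀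
  set φ : Euc m → Euc m := fun l => (Θ (0, l)).2 with hφ
  have hφs : ∀ᶠ l in 𝓝 l₀, ContDiffAt ℝ ∞ φ l := by
    filter_upwards [hin.eventually hΘs] with l hl
    exact (ContDiffAt.comp (g := Θ) (f := fun l : Euc m => ((0, l) : Cot m)) l hl
      (contDiffAt_const.prodMk contDiffAt_id)).snd
  have hΘφ : ∀ᶠ q in 𝓝 ((0, l₀) : Cot m), (Θ q).2 = φ q.2 := by
    filter_upwards [hφ', hq2.eventually (hin.eventually hφ')] with q h1 h2
    rw [h1, hφ]; exact h2.symm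
  have hd2 : ∀ᶠ q in 𝓝 ((0, l₀) : Cot m), ∀ v, (fderiv ℝ Θ q v).2 = fderiv ℝ φ q.2 v.2 := by
    filter_upwards [hΘφ.eventually_nhds, hΘs, hq2.eventually hφs] with q h1 h2 h3 v
    have e1 : HasFDerivAt (fun q => (Θ q).2) _ q := (differentiableAt_of_smooth h2).hasFDerivAt.snd
    have e2 : HasFDerivAt (fun q => (Θ q).2) _ q :=
      ((differentiableAt_of_smooth h3).hasFDerivAt.comp q hasFDerivAt_snd).congr_of_eventuallyEq h1
    exact DFunLike.congr_fun (e1.unique e2) v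
  have hφinj : ∀ v, fderiv ℝ φ l₀ v = 0 → v = 0 := by
    have hsurj : Function.Surjective (fderiv ℝ φ l₀ : Euc m →ₗ[ℝ] Euc m) := by
      intro w
      obtain ⟨A, hA⟩ := hΘi
      have h4 := DFunLike.congr_fun hA (A.symm (0, w))
      simp only [ContinuousLinearEquiv.coe_coe, ContinuousLinearEquiv.apply_symm_apply] at h4
      refine ⟨(A.symm (0, w)).2, ?_⟩
      have h5 := hd2.self_of_nhds (A.symm (0, w))
      rw [← h4] at h5
      exact h5.symm
    exact (injective_iff_map_eq_zero _).1 (LinearMap.injective_iff_surjective.2 hsurj)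
  refine ⟨Θ, φ, hΘ, hφs, congrArg Prod.snd hΘ0, hφinj, ?_, hL⟩
  obtain ⟨ε, hε, hball⟩ := Metric.eventually_nhds_iff_ball.1 (hsymp.and (hd2.and hΘs))
  -- Commuting with the involution sends fixed points to fixed points, hence the zero section to the
  -- zero section. This excludes the fibre translations by closed one-forms that general fibred
  -- symplectomorphisms allow.
  have hz : ∀ᶠ l in 𝓝 l₀, (Θ (0, l)).1 = 0 := by
    filter_upwards [hin.eventually hodd] with l hl
    have h1 := congrArg Prod.fst hl
    simp only [zeta, neg_zero] at h1
    exact eq_zero_of_eq_neg h1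
  filter_upwards [hΘφ, Metric.ball_mem_nhds _ hε, hq2.eventually hz] with q h1 h2 h3
  refine ⟨h1, ?_⟩
  obtain ⟨κ, l⟩ := q
  rw [← ball_prod_same, Set.mem_prod] at h2
  ext w
  -- Testing the symplectic condition on the vertical vector `(k, 0)` and on `(0, w)` shows that `f`
  -- has zero derivative on the fibre; its value at `κ = 0` is zero because the zero section is
  -- preserved.
  set f : StrongDual ℝ (Euc m) → ℝ := fun κ => (Θ (κ, l)).1 (fderiv ℝ φ l w) - κ w with hf
  have hfd : ∀ κ ∈ Metric.ball (0 : StrongDual ℝ (Euc m)) ε, HasFDerivAt f (0 : StrongDual ℝ (Euc m) →L[ℝ] ℝ) κ := by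
    intro κ hκ
    obtain ⟨g1, g2, g3⟩ := hball (κ, l) (by
      rw [← ball_prod_same]; exact ⟨hκ, h2.2⟩)
    have e1 : HasFDerivAt (fun κ : StrongDual ℝ (Euc m) => Θ (κ, l)) _ κ :=
      HasFDerivAt.comp (g := Θ) κ (differentiableAt_of_smooth g3).hasFDerivAt
        (hasFDerivAt_prodMk_left κ l)
    have e2 : HasFDerivAt f _ κ :=
      ((ContinuousLinearMap.apply ℝ ℝ (fderiv ℝ φ l w)).hasFDerivAt.comp κ e1.fst).sub
        ((ContinuousLinearMap.apply ℝ ℝ w).hasFDerivAt (x := κ))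
    refine e2.congr_fderiv (ContinuousLinearMap.ext fun k => ?_)
    have h4 := g1 (k, 0) (0, w)
    simp only [symp, g2] at h4
    simp only [_root_.map_zero, sub_zero] at h4
    simp
    rw [h4, sub_self]
  have h4 := Metric.isOpen_ball.is_const_of_fderiv_eq_zero (𝕜 := ℝ) (f := f)
    (convex_ball _ ε).isPreconnected
    (fun z hz => (hfd z hz).differentiableAt.differentiableWithinAt)
    (fun z hz => (hfd z hz).fderiv) h2.1 (Metric.mem_ball_self hε)
  simp only [hf] at h4
  have h5 : (Θ (0, l)).1 = 0 := h3
  rw [h5] at h4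
  simp only [_root_.zero_apply, sub_zero] at h4
  exact sub_eq_zero.1 h4

variable {Q : Type} [NormedAddCommGroup Q] [NormedSpace ℝ Q] [FiniteDimensional ℝ Q]
  {T : Euc m ≃L[ℝ] Euc n × Q} {S S' : Euc n × Q → ℝ}

theorem hasDerivAt_eval {X : Type} [NormedAddCommGroup X] [NormedSpace ℝ X] {f : ℝ → X →L[ℝ] ℝ}
    {f' : X →L[ℝ] ℝ} {t : ℝ} (h : HasDerivAt f f' t) (w : X) :
    HasDerivAt (fun t => f t w) (f' w) t :=
  (ContinuousLinearMap.apply ℝ ℝ w).hasFDerivAt.comp_hasDerivAt t h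

theorem hasDerivAt_segment {E R : Type} [NormedAddCommGroup E] [NormedSpace ℝ E]
    [NormedAddCommGroup R] [NormedSpace ℝ R] (b : E) (r : R) :
    HasDerivAt (fun t : ℝ => (t • b, r)) (b, 0) 0 := by
  have := ((hasDerivAt_id (0 : ℝ)).smul_const b).prodMk (hasDerivAt_const (0 : ℝ) r)
  simpa using this

theorem IsOddGenFun.hasDerivAt_line (hS : IsOddGenFun T S l₀) (b : Euc n) :
    HasDerivAt (fun t : ℝ => lagParam T S (t • b, (T l₀).2))
      (fderiv ℝ (lagParam T S) (0, (T l₀).2) (b, 0)) 0 := by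
  have hlagd := (differentiableAt_of_smooth
    (contDiffAt_lagParam T hS.smooth.self_of_nhds)).hasFDerivAt
  have h0 : ((0 : ℝ) • b, (T l₀).2) = (0, (T l₀).2) := by simp
  rw [← h0] at hlagd
  have := hlagd.comp_hasDerivAt (0 : ℝ) (hasDerivAt_segment b (T l₀).2)
  rwa [h0] at this

/-- The base component of `lagParam T S` is even in the first variable, so the velocity in an odd
direction is vertical. -/
theorem IsOddGenFun.fderiv_lagParam_snd (hS : IsOddGenFun T S l₀) (b : Euc n) :
    (fderiv ℝ (lagParam T S) (0, (T l₀).2) (b, 0)).2 = 0 := by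
  have h1 := fderiv_even (f := fun y => (lagParam T S y).2) (x := (0, (T l₀).2))
    (hS.odd.eventually_nhds.mono fun y hy => by rw [lagParam_flip T hy]; rfl) (b, 0)
  have hfl : flip ((0 : Euc n), (T l₀).2) = (0, (T l₀).2) := by simp [flip]
  have h2 : HasFDerivAt (fun y => (lagParam T S y).2) _ (0, (T l₀).2) :=
    (differentiableAt_of_smooth (contDiffAt_lagParam T hS.smooth.self_of_nhds)).hasFDerivAt.snd
  rw [hfl, h2.fderiv] at h1
  have h3 : flip (b, (0 : Q)) = -(b, 0) := by simp [flip]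
  rw [h3, _root_.map_neg] at h1
  exact eq_zero_of_eq_neg h1

theorem IsOddGenFun.lin_fderiv_lagParam (hS : IsOddGenFun T S l₀) (b : Euc n) :
    lin T (fderiv ℝ (lagParam T S) (0, (T l₀).2) (b, 0)) = (b, 0) := by
  have h1 : HasDerivAt (fun t : ℝ => lin T (lagParam T S (t • b, (T l₀).2))) _ 0 :=
    (lin T).hasFDerivAt.comp_hasDerivAt (0 : ℝ) (hS.hasDerivAt_line b)
  simp only [lin_lagParam] at h1
  exact h1.unique (hasDerivAt_segment b (T l₀).2)

/-- The mixed derivatives of a normal form after a change of the parameters. -/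
theorem hessian_normalFamily_comp {φ : Euc m → Euc m} (hS : IsOddGenFun T S l₁)
    (hφ : ContDiffAt ℝ ∞ φ l₀) (hφ0 : φ l₀ = l₁)
    (hG : ContDiffAt ℝ ∞ (fun x : Euc n × Euc m => normalFamily T S (x.1, φ x.2)) (0, l₀))
    (b : Euc n) (w : Euc m) :
    fderiv ℝ (fderiv ℝ (fun x : Euc n × Euc m => normalFamily T S (x.1, φ x.2))) (0, l₀)
      (b, 0) (0, w) = (fderiv ℝ (lagParam T S) (0, (T l₁).2) (b, 0)).1 (fderiv ℝ φ l₀ w) := by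
  set G : Euc n × Euc m → ℝ := fun x => normalFamily T S (x.1, φ x.2) with hGdef
  have h0 : ((0 : ℝ) • b, l₀) = (0, l₀) := by simp
  have e1 : HasDerivAt (fun t : ℝ => fderiv ℝ G (t • b, l₀) (0, w))
      (fderiv ℝ (fderiv ℝ G) (0, l₀) (b, 0) (0, w)) 0 := by
    have h1 : HasFDerivAt (fderiv ℝ G) (fderiv ℝ (fderiv ℝ G) (0, l₀)) ((0 : ℝ) • b, l₀) := by
      rw [h0]
      exact (differentiableAt_of_smooth (contDiffAt_fderiv hG)).hasFDerivAt
    exact hasDerivAt_eval (h1.comp_hasDerivAt (0 : ℝ) (hasDerivAt_segment b l₀)) _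
  have e2 : HasDerivAt (fun t : ℝ => (lagParam T S (t • b, (T l₁).2)).1 (fderiv ℝ φ l₀ w))
      _ 0 := hasDerivAt_eval (hS.hasDerivAt_line b).fst _
  refine e1.unique (e2.congr_of_eventuallyEq ?_)
  have ht : Tendsto (fun t : ℝ => (t • b, (T l₁).2)) (𝓝 0) (𝓝 (0, (T l₁).2)) := by
    have := (hasDerivAt_segment b (T l₁).2).continuousAt.tendsto
    rwa [show ((0 : ℝ) • b, (T l₁).2) = (0, (T l₁).2) by simp] at this
  filter_upwards [ht.eventually hS.smooth] with t ht'
  have hdS : DifferentiableAt ℝ S (t • b, (T l₁).2) := differentiableAt_of_smooth ht'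
  have h3 := fderiv_comp_fibred (G := normalFamily T S) (F := G) (Φ := Prod.fst) (Λ := φ)
    (x := (t • b, l₀)) (by
      rw [hφ0]
      exact (hasFDerivAt_normalFamily T (x := (t • b, l₁)) hdS 0).1)
    contDiffAt_fst hφ (Eventually.of_forall fun _ => rfl) (0, w)
  rw [h3, fderiv_fst]
  simp only [ContinuousLinearMap.coe_fst', _root_.map_zero, zero_add, hφ0]
  rw [genMap_normalFamily_fst T (x := (t • b, l₁)) hdS]

/-- The derivative of a cotangent lift at a point of the zero section. -/
theorem IsCotLift.fderiv_apply {φ : Euc m → Euc m} (h : IsCotLift Θ φ l₀)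
    (hΘ : ContDiffAt ℝ ∞ Θ (0, l₀)) (hΘ0 : Θ (0, l₀) = (0, l₁)) (hφ : ContDiffAt ℝ ∞ φ l₀)
    (d : Cot m) : (fderiv ℝ Θ (0, l₀) d).2 = fderiv ℝ φ l₀ d.2 ∧
      ∀ w, d.1 w = (fderiv ℝ Θ (0, l₀) d).1 (fderiv ℝ φ l₀ w) := by
  have hd := (differentiableAt_of_smooth hΘ).hasFDerivAt
  constructor
  · have e1 : HasFDerivAt (fun q => (Θ q).2) _ (0, l₀) := hd.snd
    have e2 : HasFDerivAt (fun q => (Θ q).2) _ (0, l₀) :=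
      (HasFDerivAt.comp (g := φ) ((0, l₀) : Cot m)
        (differentiableAt_of_smooth hφ).hasFDerivAt
        hasFDerivAt_snd).congr_of_eventuallyEq (h.mono fun q hq => hq.1)
    exact DFunLike.congr_fun (e1.unique e2) d
  · intro w
    have hq2 : HasFDerivAt (fun q : Cot m => fderiv ℝ φ q.2) _ (0, l₀) :=
      HasFDerivAt.comp (g := fderiv ℝ φ) ((0, l₀) : Cot m)
        (differentiableAt_of_smooth (contDiffAt_fderiv hφ)).hasFDerivAt hasFDerivAt_snd
    have e1 : HasFDerivAt (fun q => (Θ q).1 (fderiv ℝ φ q.2 w)) _ (0, l₀) :=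
      hd.fst.clm_apply (hq2.clm_apply (hasFDerivAt_const w _))
    have e2 : HasFDerivAt (fun q : Cot m => q.1 w) _ (0, l₀) :=
      (hasFDerivAt_fst (𝕜 := ℝ) (p := ((0, l₀) : Cot m))).clm_apply (hasFDerivAt_const w _)
    have e3 := DFunLike.congr_fun (e1.unique (e2.congr_of_eventuallyEq
      (h.mono fun q hq => DFunLike.congr_fun hq.2 w))) d
    have h4 : (Θ (0, l₀)).1 = 0 := by rw [hΘ0]
    simp [h4] at e3
    exact e3.symm

/-- A velocity in the submanifold of `S` vanishes if its image under `lin T` does. -/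
theorem IsOddGenFun.eq_zero_of_lin (hS : IsOddGenFun T S l₀) {δ : ℝ → Cot m} {d : Cot m}
    (hδ : HasDerivAt δ d 0) (hδ0 : δ 0 = (0, l₀)) (hd : lin T d = 0)
    (h : ∀ᶠ t in 𝓝 0, lagParam T S (lin T (δ t)) = δ t) : d = 0 := by
  have h1 : HasDerivAt (fun t => lin T (δ t)) 0 0 := by
    have := (lin T).hasFDerivAt.comp_hasDerivAt (0 : ℝ) hδ
    rwa [hd] at this
  have h2 : HasFDerivAt (lagParam T S) (fderiv ℝ (lagParam T S) (0, (T l₀).2))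
      (lin T (δ 0)) := by
    rw [hδ0, lin_zero]
    exact (differentiableAt_of_smooth
      (contDiffAt_lagParam T hS.smooth.self_of_nhds)).hasFDerivAt
  have h3 := h2.comp_hasDerivAt (0 : ℝ) h1
  rw [_root_.map_zero] at h3
  exact hδ.unique (h3.congr_of_eventuallyEq (h.mono fun t ht => ht.symm))

/-- Normal forms of equivalent Lagrangian germs are equivalent as families. -/
theorem roddEquiv_of_symLagrangianEquiv {L L' : Set (Cot m)} (hS : IsOddGenFun T S l₀)
    (hS' : IsOddGenFun T S' l₁) (hL : Repr T S L (0, l₀)) (hL' : Repr T S' L' (0, l₁))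
    (h : SymLagrangianEquiv L (0, l₀) L' (0, l₁)) :
    RoddEquiv (normalFamily T S) l₀ (normalFamily T S') l₁ := by
  obtain ⟨Θ, φ, hΘ, hφs, hφ0, hφi, hlift, hLL⟩ := h.exists_cotLift
  obtain ⟨hΘ0, hΘs, hΘi⟩ := isDiffeoGerm_iff.1 hΘ
  have H : IsFibredOddGerm (Prod.fst : Euc n × Euc m → Euc n) φ l₀ l₁ :=
    ⟨Eventually.of_forall fun _ => contDiffAt_fst, hφs, hφ0, Eventually.of_forall fun _ => rfl,
      fun b hb => by rwa [fderiv_fst] at hb, hφi⟩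
  have hNo := hS'.isOddGerm
  -- The normal form of `L'`, pulled back along the base map `φ`, generates `L`. If its Legendre map
  -- in the coordinates `T` is nondegenerate, its Legendre transform must be `S` by uniqueness.
  have hGo : IsOddGerm (fun x : Euc n × Euc m => normalFamily T S' (x.1, φ x.2)) l₀ :=
    hNo.comp H (Eventually.of_forall fun _ => rfl)
  -- Let `b` be degenerate for the mixed Hessian of the pull-back. It gives a tangent vector `k` of
  -- `L'`, which is vertical; its preimage `d` under `Θ` is tangent to `L` and has `lin T d = 0` by
  -- the degeneracy. Tangent vectors of the graph `L` are determined by their `lin T` coordinates,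
  -- so `d`, `k` and `b` vanish.
  have hinv : (fderiv ℝ (legMap T (fun x : Euc n × Euc m =>
      normalFamily T S' (x.1, φ x.2))) (0, l₀)).IsInvertible := by
    refine legMap_isInvertible hGo fun b hb => ?_
    set k := fderiv ℝ (lagParam T S') (0, (T l₁).2) (b, 0) with hk
    have hc := hS'.hasDerivAt_line b
    set c : ℝ → Cot m := fun t => lagParam T S' (t • b, (T l₁).2) with hcdef
    have hc0 : c 0 = (0, l₁) := by simp only [hcdef, zero_smul]; exact hS'.base
    -- the corresponding curve in `L`
    obtain ⟨Ξ, hΞ, -, hΞr⟩ := hΘ.exists_inverse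
    obtain ⟨hΞ0, hΞs, -⟩ := isDiffeoGerm_iff.1 hΞ
    set δ : ℝ → Cot m := fun t => Ξ (c t) with hδ
    have hδ0 : δ 0 = (0, l₀) := by simp only [hδ, hc0, hΞ0]
    have hδd : HasDerivAt δ (fderiv ℝ Ξ (0, l₁) k) 0 := by
      have h1 : HasFDerivAt Ξ (fderiv ℝ Ξ (0, l₁)) (c 0) := by
        rw [hc0]; exact (differentiableAt_of_smooth hΞs.self_of_nhds).hasFDerivAt
      exact h1.comp_hasDerivAt (0 : ℝ) hc
    set d := fderiv ℝ Ξ (0, l₁) k with hd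
    have hct : Tendsto c (𝓝 0) (𝓝 (0, l₁)) := by
      have := hc.continuousAt.tendsto
      rwa [hc0] at this
    have hδt : Tendsto δ (𝓝 0) (𝓝 (0, l₀)) := by
      have := hδd.continuousAt.tendsto
      rwa [hδ0] at this
    have hΘk : fderiv ℝ Θ (0, l₀) d = k := by
      have h1 : HasFDerivAt Θ (fderiv ℝ Θ (0, l₀)) (δ 0) := by
        rw [hδ0]; exact (differentiableAt_of_smooth hΘs.self_of_nhds).hasFDerivAt
      refine (h1.comp_hasDerivAt (0 : ℝ) hδd).unique (hc.congr_of_eventuallyEq ?_)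
      filter_upwards [hct.eventually hΞr] with t ht using ht
    obtain ⟨hd2, hd1⟩ := hlift.fderiv_apply hΘs.self_of_nhds hΘ0 hφs.self_of_nhds d
    rw [hΘk, hS'.fderiv_lagParam_snd] at hd2
    have hlind : lin T d = 0 := by
      refine Prod.ext ?_ ?_
      · refine (rho n).injective ?_
        ext a
        rw [rho_lin_fst, hd1, hΘk, ← hessian_normalFamily_comp hS' hφs.self_of_nhds hφ0
          hGo.smooth.self_of_nhds, hb]
        simp
      · rw [lin_snd, hφi _ hd2.symm, _root_.map_zero]
    have hd0 : d = 0 := by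
      refine hS.eq_zero_of_lin hδd hδ0 hlind ?_
      filter_upwards [hδt.eventually hL, hδt.eventually hLL, hct.eventually hΞr,
        hct.eventually hL'] with t g1 g2 g3 g4
      have g3' : Θ (δ t) = c t := g3
      have g5 : δ t ∈ L := by
        rw [g2, g3', g4, hcdef, lin_lagParam]
      exact g1.1 g5
    have hk0 : k = 0 := by rw [← hΘk, hd0, _root_.map_zero]
    have h2 := hS'.lin_fderiv_lagParam b
    rw [← hk, hk0, _root_.map_zero] at h2
    exact (congrArg Prod.fst h2).symm
  obtain ⟨g, R, hR⟩ := exists_isLegendre hGo hinv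
  -- The pull-back generates the preimage of `L'` under `Θ`, and this is `L`. Hence its Legendre
  -- transform `R` and `S` generate the same germ and coincide.
  have hgen := (hS'.isLegendre.generates.transport hNo.smooth H
    (Eventually.of_forall fun _ => rfl) hlift hΘ.tendsto).congr (L' := L) (by
      filter_upwards [hLL, hΘ.tendsto.eventually hL'] with q h1 h2
      exact propext ((h1.trans h2).symm))
  have hSR := hS.unique hR.isOddGenFun hL (hR.repr hgen)
  have hE : RoddEquiv (fun x : Euc n × Euc m => normalFamily T S' (x.1, φ x.2)) l₀
      (normalFamily T S') l₁ := roddEquiv_iff.2 ⟨_, _, H, Eventually.of_forall fun _ => rfl⟩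
  exact (hR.roddEquiv.symm.congr_left (normalFamily_congr hSR.symm)).trans hE

end Transport

end OddLagrangian

namespace OddLagrangian

set_option maxSynthPendingDepth 3
set_option linter.unusedSectionVars false

/-! ### Cutoff functions -/

theorem dist_flip {E X : Type} [NormedAddCommGroup E] [NormedAddCommGroup X] (l : X) (y : E × X) :
    dist (flip y) (0, l) = dist y (0, l) := by
  simp only [Prod.dist_eq, flip, dist_zero_right, norm_neg]

/-- Smooth cutoff functions that are even in the first factor. -/
theorem exists_even_cutoff {E X : Type} [NormedAddCommGroup E] [NormedSpace ℝ E]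
    [NormedAddCommGroup X] [NormedSpace ℝ X] [FiniteDimensional ℝ E] [FiniteDimensional ℝ X]
    (l : X) {a b : ℝ} (ha : 0 < a) (hab : a < b) : ∃ χ : E × X → ℝ, ContDiff ℝ ∞ χ ∧
      (∀ y ∈ Metric.closedBall (0, l) a, χ y = 1) ∧ (∀ y ∉ Metric.closedBall (0, l) b, χ y = 0) ∧
      ∀ y, χ (flip y) = χ y := by
  let f : ContDiffBump ((0, l) : E × X) := ⟨a, b, ha, hab⟩
  refine ⟨fun y => (1 / 2 : ℝ) * (f y + f (flip y)), ?_, fun y hy => ?_, fun y hy => ?_,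
    fun y => ?_⟩
  · exact contDiff_const.mul (f.contDiff.add (f.contDiff.comp (flipL E X).contDiff))
  · have hy' : flip y ∈ Metric.closedBall ((0, l) : E × X) a := by
      rw [Metric.mem_closedBall, dist_flip]; exact hy
    have h1 : f y = 1 := f.one_of_mem_closedBall hy
    have h2 : f (flip y) = 1 := f.one_of_mem_closedBall hy'
    simp only [h1, h2]
    norm_num
  · rw [Metric.mem_closedBall, not_le] at hy
    have h1 : f y = 0 := f.zero_of_le_dist hy.le
    have h2 : f (flip y) = 0 := f.zero_of_le_dist (by rw [dist_flip]; exact hy.le)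
    simp only [h1, h2]
    norm_num
  · simp only [flip_flip, add_comm]

/-! ### Lagrangian submanifolds with generating functions -/

section Embedding

variable {n m : ℕ} {Q : Type} [NormedAddCommGroup Q] [NormedSpace ℝ Q]
  {T : Euc m ≃L[ℝ] Euc n × Q} {S : Euc n × Q → ℝ} {B : Set (Euc n × Q)}

/-- This is the symmetry of the Hessian of `S`. -/
theorem symp_fderiv_lagParam {y : Euc n × Q} (h : ContDiffAt ℝ ∞ S y) (v w : Euc n × Q) :
    symp (fderiv ℝ (lagParam T S) y v) (fderiv ℝ (lagParam T S) y w) = 0 := by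
  have h1 : HasFDerivAt (lagParam T S) _ y := (lagLin T).hasFDerivAt.comp y
    ((hasFDerivAt_id y).prodMk (differentiableAt_of_smooth (contDiffAt_fderiv h)).hasFDerivAt)
  set A := fderiv ℝ (fderiv ℝ S) y with hA
  have hd : ∀ v, fderiv ℝ (lagParam T S) y v = lagLin T (v, A v) := fun v => by
    rw [h1.fderiv]; rfl
  have h2 : ∀ v w, (lagLin T (v, A v)).1 (lagLin T (w, A w)).2 =
      -A w (v.1, 0) + A v (0, w.2) := by
    intro v w
    change rho n v.1 (T (T.symm (-(rho n).symm ((A w).comp (ContinuousLinearMap.inl ℝ (Euc n) Q)),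
      w.2))).1 + A v (0, (T (T.symm (_, w.2))).2) = _
    simp only [ContinuousLinearEquiv.apply_symm_apply]
    rw [rho_comm, map_neg, ContinuousLinearEquiv.apply_symm_apply]
    rfl
  have hs : ∀ v w, A v w = A v (w.1, 0) + A v (0, w.2) := fun v w => by
    rw [← map_add]; simp
  have h3 := hessian_symm h v w
  rw [← hA] at h3
  have h4 := hs v w
  have h5 := hs w v
  simp only [symp, hd, h2]
  linarith

/-- The left inverse `lin T` makes the parametrization an immersion and an embedding, and the
oddness of `S` makes the image symmetric. -/
theorem isSymLagrangianEmbedding_lagParam (hB : IsOpen B) (hBf : ∀ y ∈ B, flip y ∈ B)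
    (hS : ∀ y ∈ B, ContDiffAt ℝ ∞ S y) (hodd : ∀ y ∈ B, S (flip y) = -S y) :
    IsSymLagrangianEmbedding (T ⁻¹' B) (fun u => lagParam T S (T u)) := by
  have hs : ∀ u ∈ T ⁻¹' B, ContDiffAt ℝ ∞ (fun u => lagParam T S (T u)) u := fun u hu =>
    (contDiffAt_lagParam T (hS _ hu)).comp u T.contDiff.contDiffAt
  have hd : ∀ u ∈ T ⁻¹' B, ∀ v, fderiv ℝ (fun u => lagParam T S (T u)) u v =
      fderiv ℝ (lagParam T S) (T u) (T v) := by
    intro u hu v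
    have h1 := (differentiableAt_of_smooth (contDiffAt_lagParam T (hS _ hu))).hasFDerivAt.comp u
      T.hasFDerivAt
    have h2 : fderiv ℝ (fun u => lagParam T S (T u)) u = _ := h1.fderiv
    rw [h2]; rfl
  have hUo : IsOpen (T ⁻¹' B) := hB.preimage T.continuous
  refine ⟨⟨hUo, fun u hu => (hs u hu).contDiffWithinAt, fun u hu => ?_, ?_, fun u hu v w => ?_⟩, ?_⟩
  · have h1 : HasFDerivAt (fun u => lin T (lagParam T S (T u))) _ u :=
      (lin T).hasFDerivAt.comp u (differentiableAt_of_smooth (hs u hu)).hasFDerivAt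
    simp only [lin_lagParam] at h1
    have h2 := h1.unique T.hasFDerivAt
    have h3 : Function.Injective ((lin T).comp (fderiv ℝ (fun u => lagParam T S (T u)) u)) := by
      rw [h2]; exact T.injective
    exact Function.Injective.of_comp (f := lin T) h3
  · refine IsEmbedding.of_comp (g := lin T) ?_ (lin T).continuous ?_
    · exact continuousOn_iff_continuous_domRestrict.1 fun u hu => (hs u hu).continuousAt.continuousWithinAt
    · have : (lin T) ∘ (fun u : T ⁻¹' B => lagParam T S (T u)) = T ∘ Subtype.val := by
        ext1 u
        simp
      rw [this]
      exact T.toHomeomorph.isEmbedding.comp IsEmbedding.subtypeVal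
  · rw [hd u hu, hd u hu]
    exact symp_fderiv_lagParam (hS _ hu) _ _
  · rintro q ⟨u, hu, rfl⟩
    refine ⟨T.symm (flip (T u)), ?_, ?_⟩
    · change T (T.symm (flip (T u))) ∈ B
      rw [ContinuousLinearEquiv.apply_symm_apply]
      exact hBf _ hu
    · simp only [ContinuousLinearEquiv.apply_symm_apply]
      refine lagParam_flip T ?_
      filter_upwards [hB.mem_nhds hu] with y hy using hodd y hy

theorem repr_image {l : Euc m} (hB : IsOpen B) (hl : (0, (T l).2) ∈ B) :
    Repr T S ((fun u => lagParam T S (T u)) '' (T ⁻¹' B)) (0, l) := by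
  have hlin : Tendsto (lin T) (𝓝 ((0, l) : Cot m)) (𝓝 ((0 : Euc n), (T l).2)) := by
    have := (lin T).continuous.tendsto ((0, l) : Cot m)
    rwa [lin_zero] at this
  filter_upwards [hlin.eventually (hB.mem_nhds hl)] with q hq
  constructor
  · rintro ⟨u, hu, rfl⟩
    simp
  · intro h
    refine ⟨T.symm (lin T q), ?_, ?_⟩
    · change T (T.symm _) ∈ B
      rwa [ContinuousLinearEquiv.apply_symm_apply]
    · simp only [ContinuousLinearEquiv.apply_symm_apply, h]

theorem Repr.unique {L L' : Set (Cot m)} {p : Cot m} (h : Repr T S L p) (h' : Repr T S L' p) :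
    L =ᶠ[𝓝 p] L' := by
  filter_upwards [h, h'] with q h1 h2 using propext (h1.trans h2.symm)

theorem Repr.congr {S' : Euc n × Q → ℝ} {L : Set (Cot m)} {p : Cot m} (h : Repr T S L p)
    (hS : S =ᶠ[𝓝 (lin T p)] S') : Repr T S' L p := by
  filter_upwards [h, (lin T).continuous.continuousAt.eventually hS.eventuallyEq_nhds] with q h1 h2
  rw [h1, lagParam, h2.fderiv_eq]; rfl

end Embedding

/-- Symmetric Lagrangian equivalences preserve the fixed points of the involution. -/
theorem SymLagrangianEquiv.zeta_eq {m : ℕ} {L L' : Set (Cot m)} {p p' : Cot m}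
    (h : SymLagrangianEquiv L p L' p') (hp : zeta p = p) : zeta p' = p' := by
  obtain ⟨Φ, hΦ, -, -, h1, -⟩ := h
  have h2 := h1.self_of_nhds
  rw [hp, (isDiffeoGerm_iff.1 hΦ).1] at h2
  exact h2.symm

theorem fst_eq_zero_of_zeta_eq {m : ℕ} {p : Cot m} (hp : zeta p = p) : p.1 = 0 :=
  eq_zero_of_eq_neg (congrArg Prod.fst hp).symm

theorem Generates.congr_family {n m : ℕ} {F G : Euc n × Euc m → ℝ} {l : Euc m} {L : Set (Cot m)}
    (h : Generates F l L) (hFG : F =ᶠ[𝓝 (0, l)] G) : Generates G l L := by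
  obtain ⟨O₁, hO₁, h⟩ := h
  refine ⟨_, inter_mem hO₁ hFG.eventuallyEq_nhds, fun O hO hOO => ?_⟩
  refine EventuallyEq.trans (Eq.eventuallyEq ?_) (h O hO (hOO.trans inter_subset_left))
  have hd : ∀ x ∈ O, fderiv ℝ F x = fderiv ℝ G x := fun x hx =>
    Filter.EventuallyEq.fderiv_eq (show F =ᶠ[𝓝 x] G from (hOO hx).2)
  ext q
  constructor
  · rintro ⟨x, ⟨hxc, hx⟩, rfl⟩
    refine ⟨x, ⟨?_, hx⟩, ?_⟩
    · change fibreDeriv F x = 0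
      rw [fibreDeriv, hd x hx]; exact hxc
    · simp only [genMap, baseDeriv, hd x hx]
  · rintro ⟨x, ⟨hxc, hx⟩, rfl⟩
    refine ⟨x, ⟨?_, hx⟩, ?_⟩
    · change fibreDeriv G x = 0
      rw [fibreDeriv, ← hd x hx]; exact hxc
    · simp only [genMap, baseDeriv, hd x hx]

theorem IsOddFamilyOn.isOddGerm {n m : ℕ} {F : Euc n × Euc m → ℝ} {V : Set (Euc n × Euc m)}
    (h : IsOddFamilyOn F V) {l : Euc m} (hl : (0, l) ∈ V) (hc : (0, l) ∈ critSet F) :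
    IsOddGerm F l := by
  have hV := h.isOpen.mem_nhds hl
  refine ⟨?_, ?_, hc⟩
  · filter_upwards [hV] with x hx using h.smooth.contDiffAt (h.isOpen.mem_nhds hx)
  · filter_upwards [hV] with x hx using h.odd x hx

/-! ### Legendre transforms on open sets -/

section LegendreOn

variable {n m : ℕ} {Q : Type} [NormedAddCommGroup Q] [NormedSpace ℝ Q]

/-- The Legendre transform of a family `G` whose critical set is parametrized by `h`. -/
noncomputable def legTransform (T : Euc m ≃L[ℝ] Euc n × Q) (G : Euc n × Euc m → ℝ)
    (h : Euc n × Q → Euc n × Euc m) (y : Euc n × Q) : ℝ := G (h y) - rho n (T (h y).2).1 y.1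

/-- `h` parametrizes over `B` the critical set in `O` of the odd family `G`. -/
structure IsLegendreOn (T : Euc m ≃L[ℝ] Euc n × Q) (G : Euc n × Euc m → ℝ)
    (h : Euc n × Q → Euc n × Euc m) (O : Set (Euc n × Euc m)) (B : Set (Euc n × Q)) : Prop where
  isOpen : IsOpen O
  isOpen_base : IsOpen B
  flip_mem : ∀ x ∈ O, flip x ∈ O
  flip_mem_base : ∀ y ∈ B, flip y ∈ B
  smooth : ∀ x ∈ O, ContDiffAt ℝ ∞ G x
  odd : ∀ x ∈ O, G (flip x) = -G x
  injOn : InjOn (legMap T G) O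
  invertible : ∀ x ∈ O, (fderiv ℝ (legMap T G) x).IsInvertible
  mem : ∀ y ∈ B, h y ∈ O
  smooth_inv : ∀ y ∈ B, ContDiffAt ℝ ∞ h y
  leg : ∀ y ∈ B, legMap T G (h y) = (y, 0)

namespace IsLegendreOn

variable {T : Euc m ≃L[ℝ] Euc n × Q} {G : Euc n × Euc m → ℝ} {h : Euc n × Q → Euc n × Euc m}
  {O : Set (Euc n × Euc m)} {B : Set (Euc n × Q)} (H : IsLegendreOn T G h O B)

include H

theorem eventually_odd {x : Euc n × Euc m} (hx : x ∈ O) : ∀ᶠ z in 𝓝 x, G (flip z) = -G z :=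
  (H.isOpen.eventually_mem hx).mono H.odd

theorem flip_inv {y : Euc n × Q} (hy : y ∈ B) : h (flip y) = flip (h y) := by
  refine H.injOn (H.mem _ (H.flip_mem_base y hy)) (H.flip_mem _ (H.mem y hy)) ?_
  rw [H.leg _ (H.flip_mem_base y hy), legMap_flip T (H.eventually_odd (H.mem y hy)), H.leg y hy]

theorem smooth_val {y : Euc n × Q} (hy : y ∈ B) : ContDiffAt ℝ ∞ (legTransform T G h) y := by
  refine ((H.smooth _ (H.mem y hy)).comp y (H.smooth_inv y hy)).sub
    (ContDiffAt.clm_apply ?_ contDiffAt_fst)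
  exact (rho n).contDiff.contDiffAt.comp y
    (T.contDiff.contDiffAt.comp y (H.smooth_inv y hy).snd).fst

theorem odd_val {y : Euc n × Q} (hy : y ∈ B) :
    legTransform T G h (flip y) = -legTransform T G h y := by
  simp only [legTransform, H.flip_inv hy, H.odd _ (H.mem y hy)]
  simp only [flip, map_neg]
  ring

theorem lagParam_val {y : Euc n × Q} (hy : y ∈ B) :
    lagParam T (legTransform T G h) y = genMap G (h y) :=
  lagParam_legendre T (differentiableAt_of_smooth (H.smooth_inv y hy))
    (differentiableAt_of_smooth (H.smooth _ (H.mem y hy)))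
    ((H.isOpen_base.eventually_mem hy).mono H.leg)
    (Eventually.of_forall fun _ => rfl)

/-- `h` commutes with `flip`, so it preserves `β = 0`; the base component is read off the Lagrangian
submanifold. -/
theorem base_eq {l : Euc m} (hl : (0, (T l).2) ∈ B)
    (hp : (lagParam T (legTransform T G h) (0, (T l).2)).2 = l) : h (0, (T l).2) = (0, l) := by
  rw [H.lagParam_val hl] at hp
  refine Prod.ext ?_ hp
  have h1 := H.flip_inv hl
  have h2 : flip ((0 : Euc n), (T l).2) = (0, (T l).2) := by simp [flip]
  rw [h2] at h1
  exact eq_zero_of_eq_neg (congrArg Prod.fst h1)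

theorem isLegendre {l : Euc m} (hl : (0, (T l).2) ∈ B) (hb : h (0, (T l).2) = (0, l)) :
    IsLegendre T G l h (legTransform T G h) := by
  have hm : (0, l) ∈ O := hb ▸ H.mem _ hl
  have hO := H.isOpen.mem_nhds hm
  refine ⟨⟨?_, H.eventually_odd hm, ?_⟩, H.invertible _ hm, (H.smooth_inv _ hl).continuousAt, hb,
    ?_, Eventually.of_forall fun _ => rfl⟩
  · filter_upwards [hO] with x hx using H.smooth x hx
  · have h1 := H.leg _ hl
    rw [hb] at h1
    exact fibreGrad_eq_zero.1 (congrArg Prod.snd h1)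
  · filter_upwards [H.isOpen_base.mem_nhds hl] with y hy using H.leg y hy

end IsLegendreOn

end LegendreOn

end OddLagrangian

namespace OddLagrangian

set_option maxSynthPendingDepth 3
set_option linter.unusedSectionVars false

/-! ### Perturbations of generating functions -/

section Cutoff

variable {J : Type} {D : PointedFilter J} {n m : ℕ} {Q : Type} [NormedAddCommGroup Q]
  [NormedSpace ℝ Q] {T : Euc m ≃L[ℝ] Euc n × Q}

theorem lagParam_add {S d : Euc n × Q → ℝ} {y : Euc n × Q} {K : Set (Euc n × Q)}
    (hK : IsClosed K) (h0 : ∀ y ∉ K, d y = 0) (hS : y ∈ K → DifferentiableAt ℝ S y)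
    (hd : y ∈ K → DifferentiableAt ℝ d y) : lagParam T (fun y => S y + d y) y =
      lagParam T S y + lagLin T (0, fderiv ℝ d y) := by
  have h1 : fderiv ℝ (fun y => S y + d y) y = fderiv ℝ S y + fderiv ℝ d y := by
    by_cases hy : y ∈ K
    · exact fderiv_add (hS hy) (hd hy)
    · have h2 : d =ᶠ[𝓝 y] fun _ => 0 := by
        filter_upwards [hK.isOpen_compl.mem_nhds hy] with z hz using h0 z hz
      have h3 : (fun y => S y + d y) =ᶠ[𝓝 y] S := by
        filter_upwards [h2] with z hz
        rw [hz, add_zero]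
      rw [h3.fderiv_eq, h2.fderiv_eq]
      simp
  rw [lagParam, lagParam, h1, ← map_add]
  simp

/-- A perturbation of a generating function with compact support is a small perturbation of the
Lagrangian submanifold. -/
theorem eventually_lagParam_mem_whitney {S : Euc n × Q → ℝ} {d : J → Euc n × Q → ℝ}
    {K B : Set (Euc n × Q)} (hK : IsCompact K) (hKB : K ⊆ B)
    (hS : ∀ y ∈ B, ContDiffAt ℝ ∞ S y) (hd : ∀ y ∈ K, FamSmooth D d y)
    (h0 : ∀ j, ∀ y ∉ K, d j y = 0) (hb : d D.base = fun _ => 0)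
    {W : Set (Euc m → Cot m)} (hW : IsWhitneyNhd (T ⁻¹' B) (fun u => lagParam T S (T u)) W) :
    ∀ᶠ j in D.l, (fun u => lagParam T (fun y => S y + d j y) (T u)) ∈ W := by
  have hK' : IsCompact (T ⁻¹' K) := T.toHomeomorph.isCompact_preimage.2 hK
  -- `lagParam` is linear in the derivative of the generating function, so the perturbation of the
  -- submanifold is `lagLin` applied to the derivative of `d j` and has the same compact support.
  have h1 := eventually_mem_whitney (D := D) (K := T ⁻¹' K) (V := T ⁻¹' B)
    (f := fun u => lagParam T S (T u)) (d := fun j u => lagLin T (0, fderiv ℝ (d j) (T u)))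
    hK' (preimage_mono hKB)
    (fun u hu => ((contDiffAt_lagParam T (hS _ hu)).comp u
      T.contDiff.contDiffAt).contDiffWithinAt)
    (fun u hu => by
      have h2 : FamSmooth D (fun j u => fderiv ℝ (d j) (T u)) u :=
        FamSmooth.comp (f := fun _ u => T u) (g := fun j => fderiv ℝ (d j)) (hd _ hu).fderiv
          (FamSmooth.of_contDiff T.contDiff)
      exact FamSmooth.clm (lagLin T) ((FamSmooth.of_contDiff contDiff_const).prodMk h2))
    (fun j u hu => by
      have h2 : d j =ᶠ[𝓝 (T u)] fun _ => 0 := by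
        filter_upwards [hK.isClosed.isOpen_compl.mem_nhds hu] with z hz using h0 j z hz
      rw [h2.fderiv_eq, fderiv_fun_const]
      exact map_zero (lagLin T))
    (by
      ext1 u
      simp only [hb, fderiv_fun_const]
      exact map_zero (lagLin T)) hW
  have h2 : ∀ᶠ j in D.l, ∀ y ∈ K, ContDiffAt ℝ ∞ (d j) y :=
    eventually_forall_of_isCompact (R := fun j y => ContDiffAt ℝ ∞ (d j) y) hK
      fun y hy => (hd y hy).smooth
  filter_upwards [h1, h2] with j hj hj2
  convert hj using 1
  ext1 u
  exact lagParam_add hK.isClosed (h0 j)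
    (fun hy => differentiableAt_of_smooth (hS _ (hKB hy)))
    (fun hy => differentiableAt_of_smooth (hj2 _ hy))

end Cutoff

/-! ### Lagrangian stability implies stability of the family -/

section LagrangianToFamily

variable {n m k : ℕ} {l₀ : Euc m} {T : Euc m ≃L[ℝ] Euc n × Euc k}

theorem ball_prod_mem {A C : Type} [PseudoMetricSpace A] [PseudoMetricSpace C] {y z : A} {c : C}
    {r : ℝ} (hr : 0 < r) (h : z ∈ Metric.ball y r) : (z, c) ∈ Metric.ball (y, c) r := by
  rw [← ball_prod_same]
  exact ⟨h, Metric.mem_ball_self hr⟩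

/-- The Legendre transforms of the odd families near a given one. -/
theorem exists_legendre_family {F : Euc n × Euc m → ℝ} {V N : Set (Euc n × Euc m)}
    (hF : IsOddFamilyOn F V) (hl : (0, l₀) ∈ V) (hN : N ∈ 𝓝 ((0 : Euc n), l₀))
    (hG : IsOddGerm F l₀) (hinv : (fderiv ℝ (legMap T F) (0, l₀)).IsInvertible) :
    ∃ (O : Set (Euc n × Euc m)) (r : ℝ)
      (h : {G // IsOddFamilyOn G V} → Euc n × Euc k → Euc n × Euc m), O ⊆ V ∩ N ∧ 0 < r ∧
      h ⟨F, hF⟩ (0, (T l₀).2) = (0, l₀) ∧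
      (∀ y ∈ Metric.ball ((0 : Euc n), (T l₀).2) r,
        FamSmooth (whitneyAt V F (IsOddFamilyOn · V) hF.smooth hF)
          (fun j => legTransform T j.1 (h j)) y) ∧
      ∀ᶠ j in (whitneyAt V F (IsOddFamilyOn · V) hF.smooth hF).l,
        IsLegendreOn T j.1 (h j) O (Metric.ball ((0 : Euc n), (T l₀).2) r) := by
  set D := whitneyAt V F (IsOddFamilyOn · V) hF.smooth hF with hD
  have hbase : D.base = ⟨F, hF⟩ := rfl
  have hfs : ∀ x ∈ V, FamSmooth D (fun j => j.1) x := fun x hx =>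
    famSmooth_whitneyAt hF.isOpen hF.smooth hF (fun g hg => hg.smooth) hx
  have hleg : ∀ x ∈ V ∩ N, FamSmooth D (fun j => legMap T j.1) x := fun x hx =>
    FamSmooth.clm (legLin T) ((hfs x hx.1).fderiv.prodMk (FamSmooth.of_contDiff contDiff_id))
  -- One neighbourhood and one radius serve for all nearby families; restricting the inverse maps to
  -- the slice `(y, 0)` parametrizes their critical sets.
  obtain ⟨ε, r, h', hO, HI⟩ := exists_famInverse (D := D) (f := fun j => legMap T j.1)
    (inter_mem (hF.isOpen.mem_nhds hl) hN) hleg (by rw [hbase]; exact hinv)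
  have hcen : legMap T D.base.1 (0, l₀) = ((0, (T l₀).2), 0) := legMap_zero T hG.odd hG.crit
  have hB : ∀ y ∈ Metric.ball ((0 : Euc n), (T l₀).2) r,
      (y, (0 : Euc n)) ∈ Metric.ball (legMap T D.base.1 (0, l₀)) r := by
    intro y hy
    rw [hcen]
    exact ball_prod_mem HI.r_pos hy
  have hLeg : ∀ᶠ j in D.l, IsLegendreOn T j.1 (fun y => h' j (y, 0)) (Metric.ball (0, l₀) ε)
      (Metric.ball ((0 : Euc n), (T l₀).2) r) := by
    filter_upwards [HI.injOn, HI.invertible, HI.mem, HI.smooth_inv, HI.right_inv]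
      with j h1 h2 h3 h4 h5
    refine ⟨Metric.isOpen_ball, Metric.isOpen_ball, fun x hx => ?_, fun y hy => ?_,
      fun x hx => ?_, fun x hx => ?_, h1, h2, fun y hy => h3 _ (hB y hy), fun y hy => ?_,
      fun y hy => h5 _ (hB y hy)⟩
    · rw [Metric.mem_ball, dist_flip]; exact hx
    · rw [Metric.mem_ball, dist_flip]; exact hy
    · exact j.2.smooth.contDiffAt (j.2.isOpen.mem_nhds (hO hx).1)
    · exact j.2.odd x (hO hx).1
    · exact ContDiffAt.comp (g := h' j) (f := fun y => (y, (0 : Euc n))) y (h4 _ (hB y hy))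
        (contDiffAt_id.prodMk contDiffAt_const)
  refine ⟨Metric.ball (0, l₀) ε, r, fun j y => h' j (y, 0), hO, HI.r_pos, ?_, ?_, hLeg⟩
  · have hb := D.le HI.left_inv (0, l₀) (Metric.mem_ball_self HI.eps_pos)
      (Metric.mem_ball_self HI.r_pos)
    rw [hcen] at hb
    exact hb
  · intro y hy
    have h1 : FamSmooth D (fun j y => h' j (y, 0)) y :=
      FamSmooth.comp (f := fun _ y => (y, (0 : Euc n))) (g := h') (HI.famSmooth _ (hB y hy))
        (FamSmooth.of_contDiff (contDiff_id.prodMk contDiff_const))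
    have h2 : h' D.base (y, 0) ∈ V := (hO (HI.base_mem _ (hB y hy))).1
    have h3 : FamSmooth D (fun j y => j.1 (h' j (y, 0))) y :=
      FamSmooth.comp (f := fun j y => h' j (y, 0)) (g := fun j => j.1) (hfs _ h2) h1
    have h4 : FamSmooth D (fun j y => rho n (T (h' j (y, 0)).2).1) y :=
      h1.clm ((rho n : Euc n →L[ℝ] StrongDual ℝ (Euc n)).comp
        ((ContinuousLinearMap.fst ℝ (Euc n) (Euc k)).comp ((T : Euc m →L[ℝ] Euc n × Euc k).comp
          (ContinuousLinearMap.snd ℝ (Euc n) (Euc m)))))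
    exact h3.sub (FamSmooth.bilin (ContinuousLinearMap.id ℝ (StrongDual ℝ (Euc n))) h4
      (FamSmooth.of_contDiff contDiff_fst))

/-- A family near `F'` has a Legendre transform near `S₀`. Stability is applied to the
representative of `L` parametrized by `S₀`, perturbed by the cut-off difference of the two
transforms; the equivalence of Lagrangian germs it returns becomes an equivalence of normal forms.
-/
theorem isRoddStable_of_isSymLagrangianStable {F : Euc n × Euc m → ℝ} {L : Set (Cot m)}
    (hF : IsOddGeneratingFamilyOf F l₀ L) (hL : IsSymLagrangianStable L (0, l₀)) :
    IsRoddStable F l₀ := by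
  intro V F' hV hF' hFF' N hN
  obtain ⟨-, hc, hgen⟩ := hF
  have hgen' : Generates F' l₀ L := Generates.congr_family hgen hFF'.symm
  have hc' : (0, l₀) ∈ critSet F' := by
    change fibreDeriv F' _ = 0
    rw [fibreDeriv, hFF'.fderiv_eq]; exact hc
  have hG := hF'.isOddGerm hV hc'
  obtain ⟨k, T, hinv⟩ := exists_adapted hG (hF'.regular _ ⟨hV, hc'⟩)
  obtain ⟨O, r, h, hO, hr, hbase, hfam, hev⟩ := exists_legendre_family hF' hV hN hG hinv
  set D := whitneyAt V F' (IsOddFamilyOn · V) hF'.smooth hF' with hD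
  set y₀ : Euc n × Euc k := (0, (T l₀).2) with hy₀
  set B := Metric.ball y₀ r with hB
  have hy₀B : y₀ ∈ B := Metric.mem_ball_self hr
  have H₀ : IsLegendreOn T F' (h ⟨F', hF'⟩) O B := D.le hev
  have Hl₀ := H₀.isLegendre hy₀B hbase
  set S₀ := legTransform T F' (h ⟨F', hF'⟩) with hS₀
  have hRepr₀ : Repr T S₀ L (0, l₀) := Hl₀.repr hgen'
  -- the perturbations
  obtain ⟨χ, hχs, hχ1, hχ0, hχf⟩ := exists_even_cutoff (E := Euc n) (T l₀).2
    (show 0 < r / 4 by positivity) (show r / 4 < r / 2 by linarith)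
  -- The bump function is `1` up to radius `r / 4` and `0` beyond `r / 2`, so the support lies well
  -- inside the ball `B` where all transforms are defined. It is even, so the sum `S₀ + d j` stays
  -- odd.
  set d : {G // IsOddFamilyOn G V} → Euc n × Euc k → ℝ := fun j y =>
    χ y * (legTransform T j.1 (h j) y - S₀ y) with hd
  set K := Metric.closedBall y₀ (r / 2) with hK
  have hKB : K ⊆ B := Metric.closedBall_subset_ball (by linarith)
  have hd0 : ∀ j, ∀ y ∉ K, d j y = 0 := fun j y hy => by simp only [hd, hχ0 y hy, zero_mul]
  have hdb : d D.base = fun _ => 0 := by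
    ext1 y
    change χ y * (S₀ y - S₀ y) = 0
    rw [sub_self, mul_zero]
  have hds : ∀ y ∈ K, FamSmooth D d y := fun y hy =>
    FamSmooth.bilin (ContinuousLinearMap.mul ℝ ℝ) (FamSmooth.of_contDiff hχs)
      ((hfam y (hKB hy)).sub (FamSmooth.of_const (hfam y (hKB hy)).base))
  have hemb₀ := isSymLagrangianEmbedding_lagParam (T := T) H₀.isOpen_base H₀.flip_mem_base
    (fun y hy => H₀.smooth_val hy) (fun y hy => H₀.odd_val hy)
  set u₀ := T.symm y₀ with hu₀
  have hTu₀ : T u₀ = y₀ := T.apply_symm_apply y₀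
  obtain ⟨W, hW, hWs⟩ := hL (T ⁻¹' B) (fun u => lagParam T S₀ (T u)) u₀ hemb₀
    (by rw [mem_preimage, hTu₀]; exact hy₀B)
    (by rw [hTu₀]; exact Hl₀.lagParam_base)
    ((repr_image H₀.isOpen_base hy₀B).unique hRepr₀)
    (T ⁻¹' (Metric.ball y₀ (r / 4)))
    (T.continuous.continuousAt.preimage_mem_nhds (by
      rw [hTu₀]; exact Metric.ball_mem_nhds _ (by positivity)))
  refine exists_whitneyNhd_of_eventually (hf := hF'.smooth) (hgood := hF')
    (good := (IsOddFamilyOn · V)) (R := fun G => ∃ l₁ : Euc m, (0, l₁) ∈ V ∩ N ∧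
      RoddEquiv F l₀ G l₁) ?_
  have hdsm : ∀ᶠ j in D.l, ContDiff ℝ ∞ (d j) :=
    eventually_contDiff_of_compact_support (isCompact_closedBall _ _) hds hd0
  filter_upwards [hev, hdsm, eventually_lagParam_mem_whitney (isCompact_closedBall _ _) hKB
    (fun y hy => H₀.smooth_val hy) hds hd0 hdb hW] with j H hdj hjW
  set S := legTransform T j.1 (h j) with hS
  have hsm : ∀ y ∈ B, ContDiffAt ℝ ∞ (fun y => S₀ y + d j y) y := fun y hy =>
    (H₀.smooth_val hy).add hdj.contDiffAt
  have hodd : ∀ y ∈ B, S₀ (flip y) + d j (flip y) = -(S₀ y + d j y) := by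
    intro y hy
    have h1 : S₀ (flip y) = -S₀ y := H₀.odd_val hy
    have h2 : legTransform T j.1 (h j) (flip y) = -legTransform T j.1 (h j) y := H.odd_val hy
    simp only [hd, hχf, h1, h2]
    ring
  have hemb := isSymLagrangianEmbedding_lagParam (T := T) H.isOpen_base H.flip_mem_base hsm hodd
  obtain ⟨u₁, ⟨hu₁, hu₁'⟩, hequiv⟩ := hWs _ hjW hemb
  set y₁ := T u₁ with hy₁
  have hu₁B : y₁ ∈ B := hu₁
  have hy₁' : y₁ ∈ Metric.ball y₀ (r / 4) := hu₁'
  -- The point found by stability is not known in advance to be symmetric. The equivalence carries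
  -- the fixed point `(0, l₀)` to it, so it lies on the zero section, and its coordinates have first
  -- component `0`.
  have hzeta := hequiv.zeta_eq (by simp [zeta])
  set l₁ := (lagParam T (fun y => S₀ y + d j y) y₁).2 with hl₁
  have hp₁ : lagParam T (fun y => S₀ y + d j y) y₁ = (0, l₁) :=
    Prod.ext (fst_eq_zero_of_zeta_eq hzeta) rfl
  have hy₁l : y₁ = (0, (T l₁).2) := by
    rw [← lin_zero, ← hp₁, lin_lagParam]
  -- Near `y₁` the bump function is `1`, so the perturbed germ is generated by the uncut Legendre
  -- transform of the given family.
  have hSS : (fun y => S₀ y + d j y) =ᶠ[𝓝 y₁] S := by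
    filter_upwards [Metric.isOpen_ball.mem_nhds hy₁'] with y hy
    simp only [hd, hχ1 y (Metric.ball_subset_closedBall hy), hS]
    ring
  have hp₁' : lagParam T S y₁ = (0, l₁) := by
    rw [← hp₁, lagParam, lagParam, hSS.fderiv_eq]
  rw [hy₁l] at hp₁' hSS hu₁B
  have hb₁ : h j (0, (T l₁).2) = (0, l₁) := H.base_eq hu₁B (by rw [← hS, hp₁'])
  have Hl₁ := H.isLegendre hu₁B hb₁
  refine ⟨l₁, hO (hb₁ ▸ H.mem _ hu₁B), ?_⟩
  have hRepr₁ : Repr T S ((fun u => lagParam T (fun y => S₀ y + d j y) (T u)) '' (T ⁻¹' B))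
      (0, l₁) := by
    refine (repr_image H.isOpen_base hu₁B).congr ?_
    rw [lin_zero]; exact hSS
  have hequiv' : SymLagrangianEquiv L (0, l₀)
      ((fun u => lagParam T (fun y => S₀ y + d j y) (T u)) '' (T ⁻¹' B)) (0, l₁) := by
    rw [← hp₁]; exact hequiv
  have hN := roddEquiv_of_symLagrangianEquiv Hl₀.isOddGenFun Hl₁.isOddGenFun hRepr₀ hRepr₁ hequiv'
  exact ((Hl₀.roddEquiv.trans hN).trans Hl₁.roddEquiv.symm).congr_left hFF'

end LagrangianToFamily

end OddLagrangian

namespace OddLagrangian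

set_option maxSynthPendingDepth 3
set_option linter.unusedSectionVars false

/-! ### Generating functions of Lagrangian embeddings -/

section Primitive

variable {n m : ℕ} {Q : Type} [NormedAddCommGroup Q] [NormedSpace ℝ Q]
  (T : Euc m ≃L[ℝ] Euc n × Q)

/-- The covector that the generating function of a Lagrangian submanifold through `q` has as
derivative at `lin T q`. -/
noncomputable def genForm : Cot m →L[ℝ] StrongDual ℝ (Euc n × Q) :=
  ((ContinuousLinearMap.compL ℝ (Euc n × Q) (Euc m) ℝ).flip
    ((T.symm : Euc n × Q →L[ℝ] Euc m).comp
      ((ContinuousLinearMap.inr ℝ (Euc n) Q).comp (ContinuousLinearMap.snd ℝ (Euc n) Q)))).comp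
    (ContinuousLinearMap.fst ℝ (StrongDual ℝ (Euc m)) (Euc m)) -
  ((ContinuousLinearMap.compL ℝ (Euc n × Q) (Euc n) ℝ).flip
    (ContinuousLinearMap.fst ℝ (Euc n) Q)).comp
    ((rho n : Euc n →L[ℝ] StrongDual ℝ (Euc n)).comp ((ContinuousLinearMap.fst ℝ (Euc n) Q).comp
      ((T : Euc m →L[ℝ] Euc n × Q).comp
        (ContinuousLinearMap.snd ℝ (StrongDual ℝ (Euc m)) (Euc m)))))

theorem genForm_apply (q : Cot m) (w : Euc n × Q) :
    genForm T q w = q.1 (T.symm (0, w.2)) - rho n (T q.2).1 w.1 := rfl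

theorem genForm_zeta (q : Cot m) (w : Euc n × Q) :
    genForm T (zeta q) (flip w) = -genForm T q w := by
  simp only [genForm_apply, zeta, flip, _root_.neg_apply, map_neg]
  ring

variable {T}

theorem lagParam_eq_of_genForm {R : Euc n × Q → ℝ} {q : Cot m} {y : Euc n × Q}
    (hq : lin T q = y) (hR : fderiv ℝ R y = genForm T q) : lagParam T R y = q := by
  refine cot_ext_of_lin T hq (fun z => ?_) fun b => ?_
  · rw [hR, genForm_apply]; simp
  · rw [hR, genForm_apply]
    have : T.symm ((0 : Euc n), (0 : Q)) = 0 := map_zero T.symm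
    simp [this]

/-- The form is closed on isotropic submanifolds. -/
theorem genForm_symm {q : Euc n × Q → Cot m} {y : Euc n × Q} (hq : DifferentiableAt ℝ q y)
    (hlin : ∀ᶠ z in 𝓝 y, lin T (q z) = z)
    (hiso : ∀ v w, symp (fderiv ℝ q y v) (fderiv ℝ q y w) = 0) (v w : Euc n × Q) :
    fderiv ℝ (fun z => genForm T (q z)) y v w = fderiv ℝ (fun z => genForm T (q z)) y w v := by
  set d : Euc n × Q →L[ℝ] Cot m := fderiv ℝ q y with hd
  have h1 : fderiv ℝ (fun z => genForm T (q z)) y = (genForm T).comp d :=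
    ((genForm T).hasFDerivAt.comp y hq.hasFDerivAt).fderiv
  have h2 : ∀ v, lin T (d v) = v := by
    intro v
    have e1 : HasFDerivAt (fun z => lin T (q z)) _ y := (lin T).hasFDerivAt.comp y hq.hasFDerivAt
    have e2 : HasFDerivAt (fun z => lin T (q z)) (ContinuousLinearMap.id ℝ (Euc n × Q)) y :=
      (hasFDerivAt_id y).congr_of_eventuallyEq hlin
    exact DFunLike.congr_fun (e1.unique e2) v
  have h3 : ∀ v w, (d v).1 (d w).2 = rho n v.1 (T (d w).2).1 + (d v).1 (T.symm (0, w.2)) := by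
    intro v w
    have e1 := rho_lin_fst T (d v) (T (d w).2).1
    rw [h2] at e1
    have e2 : (T (d w).2).2 = w.2 := by rw [← lin_snd, h2]
    conv_lhs => rw [symm_split T (d w).2, map_add, ← e1, e2]
  have h4 := hiso v w
  simp only [symp, h3] at h4
  rw [h1]
  simp only [ContinuousLinearMap.comp_apply, genForm_apply]
  rw [rho_comm (T (d v).2).1, rho_comm (T (d w).2).1]
  linarith

theorem contDiffAt_of_hasFDerivAt {X : Type} [NormedAddCommGroup X] [NormedSpace ℝ X]
    {f : X → ℝ} {f' : X → StrongDual ℝ X} {B : Set X} (hB : IsOpen B)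
    (h : ∀ x ∈ B, HasFDerivAt f (f' x) x) (h' : ∀ x ∈ B, ContDiffAt ℝ ∞ f' x) {x : X}
    (hx : x ∈ B) : ContDiffAt ℝ ∞ f x := by
  refine ((contDiffOn_infty_iff_fderiv_of_isOpen hB).2
    ⟨fun y hy => (h y hy).differentiableAt.differentiableWithinAt, ?_⟩).contDiffAt
    (hB.mem_nhds hx)
  refine ContDiffOn.congr (fun y hy => (h' y hy).contDiffWithinAt) fun y hy => (h y hy).fderiv

/-- Primitives of a smooth family of closed forms on a ball. -/
theorem famSmooth_primitive {J : Type} {D : PointedFilter J} {X : Type} [NormedAddCommGroup X]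
    [NormedSpace ℝ X] [FiniteDimensional ℝ X] {y₀ : X} {r : ℝ} {α : J → X → StrongDual ℝ X}
    (hα : ∀ y ∈ Metric.ball y₀ r, FamSmooth D α y) {R : J → X → ℝ}
    (hsm : ∀ᶠ j in D.l, ∀ y ∈ Metric.ball y₀ r, ContDiffAt ℝ ∞ (α j) y)
    (hR : ∀ᶠ j in D.l, R j y₀ = 0 ∧ ∀ y ∈ Metric.ball y₀ r, HasFDerivAt (R j) (α j y) y)
    {y : X} (hy : y ∈ Metric.ball y₀ r) : FamSmooth D R y := by
  have hB : ∀ᶠ p in D.l ×ˢ 𝓝 y, p.2 ∈ Metric.ball y₀ r :=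
    eventually_of_base (Metric.isOpen_ball.mem_nhds hy)
  refine FamSmooth.of_fderiv ?_ ?_ ?_
  · filter_upwards [hB, tendsto_fst.eventually hsm, tendsto_fst.eventually hR] with p h1 h2 h3
    exact contDiffAt_of_hasFDerivAt Metric.isOpen_ball h3.2 h2 h1
  · obtain ⟨hb0, hbd⟩ := D.le hR
    obtain ⟨ρ, hρ, hρr⟩ := exists_between (Metric.mem_ball.1 hy)
    have hρ0 : 0 < ρ := dist_nonneg.trans_lt hρ
    have hKB : Metric.closedBall y₀ ρ ⊆ Metric.ball y₀ r := Metric.closedBall_subset_ball hρr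
    have hcont : Tendsto (fun p : J × X => R D.base p.2) (D.l ×ˢ 𝓝 y) (𝓝 (R D.base y)) :=
      (hbd y hy).continuousAt.tendsto.comp tendsto_snd
    -- Mean value inequality on the closed ball of radius `ρ`: the primitives agree at `y₀` and
    -- their derivatives are uniformly close there. The bound `ε / (ρ + 1)` for the derivatives
    -- leaves a strict inequality after multiplication by `ρ`.
    have hdiff : Tendsto (fun p : J × X => R p.1 p.2 - R D.base p.2) (D.l ×ˢ 𝓝 y) (𝓝 0) := by
      rw [Metric.tendsto_nhds]
      intro ε hε
      have hδ : 0 < ε / (ρ + 1) := by positivity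
      have h1 : ∀ᶠ j in D.l, ∀ z ∈ Metric.closedBall y₀ ρ, ‖α j z - α D.base z‖ < ε / (ρ + 1) := by
        refine eventually_forall_of_isCompact
          (R := fun j z => ‖α j z - α D.base z‖ < ε / (ρ + 1)) (isCompact_closedBall y₀ ρ)
          fun z hz => ?_
        have h2 := ((hα z (hKB hz)).sub (FamSmooth.of_const (hα z (hKB hz)).base)).tendsto
        simp only [sub_self] at h2
        filter_upwards [(Metric.tendsto_nhds.1 h2) _ hδ] with p hp
        simpa using hp
      have h2 : ∀ᶠ p in D.l ×ˢ 𝓝 y, p.2 ∈ Metric.closedBall y₀ ρ :=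
        eventually_of_base (Metric.closedBall_mem_nhds_of_mem (Metric.mem_ball.2 hρ))
      filter_upwards [tendsto_fst.eventually h1, h2, tendsto_fst.eventually hR] with p h1 h2 h3
      have h4 := (convex_closedBall y₀ ρ).norm_image_sub_le_of_norm_hasFDerivWithin_le
        (f := fun z => R p.1 z - R D.base z) (f' := fun z => α p.1 z - α D.base z)
        (fun z hz => ((h3.2 z (hKB hz)).sub (hbd z (hKB hz))).hasFDerivWithinAt)
        (fun z hz => (h1 z hz).le) (Metric.mem_closedBall_self hρ0.le) h2
      rw [h3.1, hb0, sub_self, sub_zero] at h4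
      rw [dist_zero_right]
      refine h4.trans_lt ?_
      have h5 : ‖p.2 - y₀‖ ≤ ρ := by rw [← dist_eq_norm]; exact h2
      calc ε / (ρ + 1) * ‖p.2 - y₀‖ ≤ ε / (ρ + 1) * ρ := by gcongr
        _ < ε := by
          rw [div_mul_eq_mul_div, div_lt_iff₀ (by positivity)]
          nlinarith
    simpa using hdiff.add hcont
  · refine (hα y hy).congr ?_
    filter_upwards [hB.and (tendsto_fst.eventually hR)] with p hp
    exact (hp.2.2 p.2 hp.1).fderiv.symm

end Primitive

theorem eventually_norm_sub_lt {X Y : Type} [NormedAddCommGroup X] [NormedSpace ℝ X]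
    [NormedAddCommGroup Y] [NormedSpace ℝ Y] {V : Set X} {f : X → Y} {good : (X → Y) → Prop}
    {hf : ContDiffOn ℝ ∞ f V} {hgood : good f} {ε : ℝ} (hε : 0 < ε) :
    ∀ᶠ g in (whitneyAt V f good hf hgood).l, ∀ x ∈ V, ‖g.1 x - f x‖ < ε := by
  have hW : {g : X → Y | ∀ x ∈ V, ‖g x - f x‖ < ε} ∈ whitney V f := by
    refine ⟨0, fun _ => ε, continuousOn_const, fun _ _ => hε, fun g _ hg' x hx => ?_⟩
    have := hg' x hx 0 le_rfl
    rwa [norm_iteratedFDeriv_zero] at this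
  exact Filter.preimage_mem_comap hW

/-- An embedding carries the subspace topology, so no distant part of the domain returns near `f x`.
For an immersion this could fail. -/
theorem exists_ball_preimage {X Y : Type} [PseudoMetricSpace X] [PseudoMetricSpace Y] {U : Set X}
    {f : X → Y} (hf : IsEmbedding fun u : U => f u) {x : X} (hx : x ∈ U) {ε : ℝ} (hε : 0 < ε) :
    ∃ η : ℝ, 0 < η ∧ ∀ u ∈ U, dist (f u) (f x) < η → u ∈ Metric.ball x ε := by
  have h1 : Metric.ball (⟨x, hx⟩ : U) ε ∈ 𝓝 (⟨x, hx⟩ : U) := Metric.ball_mem_nhds _ hε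
  rw [hf.toIsInducing.nhds_eq_comap, mem_comap] at h1
  obtain ⟨A, hA, hAU⟩ := h1
  obtain ⟨η, hη, hηA⟩ := Metric.mem_nhds_iff.1 hA
  exact ⟨η, hη, fun u hu hd => @hAU ⟨u, hu⟩ (hηA hd)⟩

/-- Points of nearby embeddings close to a point of a given embedding have close parameters. -/
theorem eventually_separated {m : ℕ} {U : Set (Euc m)} {ι : Euc m → Cot m} {u₀ : Euc m}
    (hι : IsSymLagrangianEmbedding U ι) (hu₀ : u₀ ∈ U) {ε : ℝ} (hε : 0 < ε) :
    ∃ η : ℝ, 0 < η ∧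
      ∀ᶠ j in (whitneyAt U ι (IsSymLagrangianEmbedding U) hι.smooth hι).l, ∀ u ∈ U,
        dist (j.1 u) (ι u₀) < η → u ∈ Metric.ball u₀ ε := by
  obtain ⟨η, hη, h⟩ := exists_ball_preimage hι.isEmbedding hu₀ hε
  refine ⟨η / 2, half_pos hη, ?_⟩
  filter_upwards [eventually_norm_sub_lt (hf := hι.smooth) (hgood := hι) (half_pos hη)]
    with j hj u hu hd
  have h3 := hj u hu
  refine h u hu ?_
  rw [← dist_eq_norm, dist_comm] at h3
  have h4 := dist_triangle (ι u) (j.1 u) (ι u₀)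
  have h5 := add_lt_add h3 hd
  rw [add_halves] at h5
  exact h4.trans_lt h5

end OddLagrangian

namespace OddLagrangian

set_option maxSynthPendingDepth 3
set_option linter.unusedSectionVars false

/-! ### Odd generating functions of nearby symmetric Lagrangian embeddings -/

section FamilyOfEmbeddings

variable {n m : ℕ} {Q : Type} [NormedAddCommGroup Q] [NormedSpace ℝ Q] [FiniteDimensional ℝ Q]
  {T : Euc m ≃L[ℝ] Euc n × Q}

theorem exists_primitive {q : Euc n × Q → Cot m} {y₀ : Euc n × Q} {r : ℝ}
    (hq : ∀ y ∈ Metric.ball y₀ r, ContDiffAt ℝ ∞ q y)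
    (hlin : ∀ y ∈ Metric.ball y₀ r, lin T (q y) = y)
    (hiso : ∀ y ∈ Metric.ball y₀ r, ∀ v w, symp (fderiv ℝ q y v) (fderiv ℝ q y w) = 0) :
    ∃ R : Euc n × Q → ℝ, R y₀ = 0 ∧
      ∀ y ∈ Metric.ball y₀ r, HasFDerivAt R (genForm T (q y)) y := by
  have hd : DifferentiableOn ℝ (fun y => genForm T (q y)) (Metric.ball y₀ r) := fun y hy =>
    ((genForm T).differentiableAt.comp y
      (differentiableAt_of_smooth (hq y hy))).differentiableWithinAt
  obtain ⟨R, hR⟩ := (convex_ball y₀ r).exists_forall_hasFDerivAt_of_fderiv_symmetric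
    Metric.isOpen_ball hd
    (fun y hy v w => genForm_symm (differentiableAt_of_smooth (hq y hy))
      ((Metric.isOpen_ball.eventually_mem hy).mono hlin) (hiso y hy) v w)
  exact ⟨fun y => R y - R y₀, sub_self _, fun y hy => (hR y hy).sub_const _⟩

theorem symp_fderiv_comp {ι : Euc m → Cot m} {g : Euc n × Q → Euc m} {y : Euc n × Q}
    (hι : DifferentiableAt ℝ ι (g y)) (hg : DifferentiableAt ℝ g y)
    (h : ∀ v w, symp (fderiv ℝ ι (g y) v) (fderiv ℝ ι (g y) w) = 0) (v w : Euc n × Q) :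
    symp (fderiv ℝ (fun y => ι (g y)) y v) (fderiv ℝ (fun y => ι (g y)) y w) = 0 := by
  have h1 : fderiv ℝ (fun y => ι (g y)) y = (fderiv ℝ ι (g y)).comp (fderiv ℝ g y) :=
    (hι.hasFDerivAt.comp y hg.hasFDerivAt).fderiv
  rw [h1]
  exact h _ _

/-- The form changes sign under the involution, so the sum of `R` and its flip has zero derivative;
it vanishes at the centre by normalisation. -/
theorem odd_of_genForm {R : Euc n × Q → ℝ} {q : Euc n × Q → Cot m} {l : Q} {r : ℝ}
    (hR0 : R (0, l) = 0)
    (hR : ∀ y ∈ Metric.ball ((0 : Euc n), l) r, HasFDerivAt R (genForm T (q y)) y)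
    (hq : ∀ y ∈ Metric.ball ((0 : Euc n), l) r, q (flip y) = zeta (q y))
    {y : Euc n × Q} (hy : y ∈ Metric.ball ((0 : Euc n), l) r) : R (flip y) = -R y := by
  have hr : 0 < r := dist_nonneg.trans_lt (Metric.mem_ball.1 hy)
  have hd : ∀ z ∈ Metric.ball ((0 : Euc n), l) r, HasFDerivAt (fun z => R (flip z) + R z)
      (0 : Euc n × Q →L[ℝ] ℝ) z := by
    intro z hz
    have hz' : flip z ∈ Metric.ball ((0 : Euc n), l) r := by
      rw [Metric.mem_ball, dist_flip]; exact hz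
    have h1 : HasFDerivAt (fun z => R (flip z)) _ z :=
      HasFDerivAt.comp (g := R) (f := flip) z (hR _ hz') (flipL (Euc n) Q).hasFDerivAt
    refine (h1.add (hR z hz)).congr_fderiv (ContinuousLinearMap.ext fun v => ?_)
    change genForm T (q (flip z)) (flip v) + genForm T (q z) v = 0
    rw [hq z hz, genForm_zeta]
    ring
  have h1 := Metric.isOpen_ball.is_const_of_fderiv_eq_zero (𝕜 := ℝ)
    (convex_ball ((0 : Euc n), l) r).isPreconnected
    (fun z hz => (hd z hz).differentiableAt.differentiableWithinAt)
    (fun z hz => (hd z hz).fderiv) hy (Metric.mem_ball_self hr)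
  have h2 : flip ((0 : Euc n), l) = (0, l) := by simp [flip]
  rw [h2, hR0, add_zero] at h1
  linarith

theorem tendsto_zeta (l : Euc m) : Tendsto (zeta : Cot m → Cot m) (𝓝 (0, l)) (𝓝 (0, l)) :=
  tendsto_flip l

/-- The generating functions of the symmetric Lagrangian embeddings near a given one. -/
theorem exists_genFun_family {U N : Set (Euc m)} {ι : Euc m → Cot m} {u₀ l₀ : Euc m}
    (hι : IsSymLagrangianEmbedding U ι) (hu₀ : u₀ ∈ U) (hp : ι u₀ = (0, l₀)) (hN : N ∈ 𝓝 u₀)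
    (hinv : (fderiv ℝ (fun u => lin T (ι u)) u₀).IsInvertible) :
    ∃ (r : ℝ) (R : {ι' // IsSymLagrangianEmbedding U ι'} → Euc n × Q → ℝ)
      (g : {ι' // IsSymLagrangianEmbedding U ι'} → Euc n × Q → Euc m), 0 < r ∧
      g ⟨ι, hι⟩ (0, (T l₀).2) = u₀ ∧
      (∀ y ∈ Metric.ball ((0 : Euc n), (T l₀).2) r,
        FamSmooth (whitneyAt U ι (IsSymLagrangianEmbedding U) hι.smooth hι) R y) ∧
      ∀ᶠ j in (whitneyAt U ι (IsSymLagrangianEmbedding U) hι.smooth hι).l,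
        ∀ y ∈ Metric.ball ((0 : Euc n), (T l₀).2) r, ContDiffAt ℝ ∞ (R j) y ∧
          R j (flip y) = -R j y ∧ g j y ∈ U ∩ N ∧ lagParam T (R j) y = j.1 (g j y) ∧
          Repr T (R j) (j.1 '' U) (j.1 (g j y)) := by
  classical
  set D := whitneyAt U ι (IsSymLagrangianEmbedding U) hι.smooth hι with hD
  set y₀ : Euc n × Q := (0, (T l₀).2) with hy₀
  have hbase : D.base = ⟨ι, hι⟩ := rfl
  have hfs : ∀ u ∈ U, FamSmooth D (fun j => j.1) u := fun u hu =>
    famSmooth_whitneyAt hι.isOpen hι.smooth hι (fun g hg => hg.smooth) hu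
  obtain ⟨ε, r, g, hO, HI⟩ := exists_famInverse (D := D) (f := fun j u => lin T (j.1 u))
    (inter_mem (hι.isOpen.mem_nhds hu₀) hN) (fun u hu => (hfs u hu.1).clm (lin T))
    (by rw [hbase]; exact hinv)
  have hcen : lin T (D.base.1 u₀) = y₀ := by
    change lin T (ι u₀) = y₀
    rw [hp, lin_zero]
  have hg0 : g D.base y₀ = u₀ := by
    have hb := D.le HI.left_inv u₀ (Metric.mem_ball_self HI.eps_pos)
      (Metric.mem_ball_self HI.r_pos)
    simp only [hcen] at hb
    exact hb
  obtain ⟨hε, hr, hbm, hgf, -, -, hli, -, hgm, hri, hgs⟩ := HI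
  simp only [hcen] at hbm hgf hli hgm hri hgs
  set B := Metric.ball y₀ r with hB
  have hy₀B : y₀ ∈ B := Metric.mem_ball_self hr
  obtain ⟨η, hη, hsep⟩ := eventually_separated hι hu₀ hε
  set q : {ι' // IsSymLagrangianEmbedding U ι'} → Euc n × Q → Cot m := fun j y => j.1 (g j y)
    with hq
  have hqf : ∀ y ∈ B, FamSmooth D q y := fun y hy =>
    FamSmooth.comp (f := g) (g := fun j => j.1) (hfs _ (hO (hbm y hy)).1) (hgf y hy)
  have hq0 : q D.base y₀ = (0, l₀) := by
    simp only [hq, hg0]; exact hp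
  have hqs : ∀ᶠ j in D.l, ∀ y ∈ B, ContDiffAt ℝ ∞ (q j) y := by
    filter_upwards [hgs, hgm] with j h1 h2 y hy
    exact (j.2.smooth.contDiffAt (j.2.isOpen.mem_nhds (hO (h2 y hy)).1)).comp y (h1 y hy)
  have hex : ∀ᶠ j in D.l, ∃ R : Euc n × Q → ℝ, R y₀ = 0 ∧
      ∀ y ∈ B, HasFDerivAt R (genForm T (q j y)) y := by
    filter_upwards [hgs, hgm, hqs, hri] with j h1 h2 h3 h4
    refine exists_primitive h3 h4 fun y hy => ?_
    have hU : g j y ∈ U := (hO (h2 y hy)).1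
    exact symp_fderiv_comp (differentiableAt_of_smooth
      (j.2.smooth.contDiffAt (j.2.isOpen.mem_nhds hU))) (differentiableAt_of_smooth (h1 y hy))
      (j.2.isotropic _ hU)
  choose! R hR using fun (j : {ι' // IsSymLagrangianEmbedding U ι'})
    (h : ∃ R : Euc n × Q → ℝ, R y₀ = 0 ∧ ∀ y ∈ B, HasFDerivAt R (genForm T (q j y)) y) => h
  have hR' : ∀ᶠ j in D.l, R j y₀ = 0 ∧ ∀ y ∈ B, HasFDerivAt (R j) (genForm T (q j y)) y :=
    hex.mono hR
  have hsm : ∀ᶠ j in D.l, ∀ y ∈ B, ContDiffAt ℝ ∞ (fun y => genForm T (q j y)) y :=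
    hqs.mono fun j hj y hy => (genForm T).contDiff.contDiffAt.comp y (hj y hy)
  have hRf : ∀ y ∈ B, FamSmooth D R y := fun y hy =>
    famSmooth_primitive (α := fun j y => genForm T (q j y))
      (fun y hy => (hqf y hy).clm (genForm T)) hsm hR' hy
  -- the points of the submanifolds over a small ball are close to the base point
  have hnear : ∃ r' : ℝ, 0 < r' ∧ r' ≤ r ∧ ∀ᶠ j in D.l, ∀ y ∈ Metric.ball y₀ r',
      dist (q j y) (ι u₀) < η ∧ dist (zeta (q j y)) (ι u₀) < η := by
    have h1 := (hqf y₀ hy₀B).tendsto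
    rw [hq0] at h1
    have h2 := h1.eventually (Metric.ball_mem_nhds _ hη)
    have h3 := ((tendsto_zeta l₀).comp h1).eventually (Metric.ball_mem_nhds _ hη)
    obtain ⟨A, hA, C, hC, hAC⟩ := Filter.eventually_prod_iff.1 (h2.and h3)
    obtain ⟨r₁, hr₁, hC⟩ := Metric.eventually_nhds_iff_ball.1 hC
    refine ⟨min r r₁, lt_min hr hr₁, min_le_left _ _, hA.mono fun j hj y hy => ?_⟩
    rw [hp]
    exact hAC hj (hC y (Metric.ball_subset_ball (min_le_right _ _) hy))
  obtain ⟨r', hr', hrr, hnear⟩ := hnear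
  have hB' : Metric.ball y₀ r' ⊆ B := Metric.ball_subset_ball hrr
  refine ⟨r', R, g, hr', hg0, fun y hy => hRf y (hB' hy), ?_⟩
  filter_upwards [hR', hsm, hgm, hnear, hsep, hli, hri] with j h1 h2 h3 h4 h5 h6 h7
  have hlag : ∀ y ∈ B, lagParam T (R j) y = q j y := fun y hy =>
    lagParam_eq_of_genForm (h7 y hy) (h1.2 y hy).fderiv
  -- The mirror image of `q j y` lies on the same submanifold, but a priori under some distant
  -- parameter. It is close to the base point, so separation puts the parameter into the ball where
  -- `g j` inverts the coordinates, and it must be `g j (flip y)`.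
  have hqflip : ∀ y ∈ Metric.ball y₀ r', q j (flip y) = zeta (q j y) := by
    intro y hy
    obtain ⟨u, hu, hu'⟩ := j.2.symm (q j y) ⟨_, (hO (h3 y (hB' hy))).1, rfl⟩
    have hue := h5 u hu (by rw [hu']; exact (h4 y hy).2)
    have hlu : lin T (j.1 u) = flip y := by
      rw [hu', lin_zeta]
      exact congrArg flip (h7 y (hB' hy))
    have h8 := h6 u hue (by
      rw [hlu, hB, Metric.mem_ball, dist_flip]
      exact hB' hy)
    rw [hlu] at h8
    simp only [hq]
    rw [h8, hu']
  intro y hy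
  refine ⟨contDiffAt_of_hasFDerivAt Metric.isOpen_ball h1.2 h2 (hB' hy),
    odd_of_genForm h1.1 (fun y hy => h1.2 y (hB' hy)) hqflip hy, hO (h3 y (hB' hy)),
    hlag y (hB' hy), ?_⟩
  have hy7 : lin T (q j y) = y := h7 y (hB' hy)
  -- Separation also excludes other sheets: every point of the image close enough to `q j y` has its
  -- parameter in the ball and therefore lies on the graph of `R j`.
  filter_upwards [Metric.isOpen_ball.mem_nhds (show q j y ∈ Metric.ball (ι u₀) η from (h4 y hy).1),
    (lin T).continuous.continuousAt.preimage_mem_nhds (Metric.isOpen_ball.mem_nhds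
      (show lin T (q j y) ∈ B by rw [hy7]; exact hB' hy))] with z hz hz'
  constructor
  · rintro ⟨u, hu, rfl⟩
    have h8 := h6 u (h5 u hu hz) hz'
    rw [hlag _ hz']
    simp only [hq]
    rw [h8]
  · intro hz''
    exact ⟨g j (lin T z), (hO (h3 _ hz')).1, by rw [← hz'', lin_lagParam, hlag _ hz']⟩

end FamilyOfEmbeddings

end OddLagrangian

namespace OddLagrangian

set_option maxSynthPendingDepth 3
set_option linter.unusedSectionVars false

/-! ### Stability of the family implies Lagrangian stability -/

section FamilyToLagrangian

variable {n m : ℕ} {l₀ l₁ : Euc m}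

theorem IsOddGerm.of_roddEquiv {F G : Euc n × Euc m → ℝ} (hF : IsOddGerm F l₀)
    (h : RoddEquiv F l₀ G l₁) : IsOddGerm G l₁ := by
  obtain ⟨Φ, Λ, H, hG⟩ := roddEquiv_iff.1 h.symm
  exact hF.comp H hG

theorem fibreDeriv_surjective_of_invertible {Q : Type} [NormedAddCommGroup Q] [NormedSpace ℝ Q]
    {T : Euc m ≃L[ℝ] Euc n × Q} {G : Euc n × Euc m → ℝ} {x : Euc n × Euc m}
    (hG : ContDiffAt ℝ ∞ G x) (h : (fderiv ℝ (legMap T G) x).IsInvertible) :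
    Function.Surjective (fderiv ℝ (fibreDeriv G) x) := by
  intro a
  obtain ⟨A, hA⟩ := h
  refine ⟨A.symm (0, (rho n).symm a), ?_⟩
  have h1 := DFunLike.congr_fun hA (A.symm (0, (rho n).symm a))
  rw [fderiv_legMap T hG] at h1
  simp only [ContinuousLinearEquiv.coe_coe, ContinuousLinearEquiv.apply_symm_apply] at h1
  have h2 : (rho n).symm a = (rho n).symm (fibreRestrict n m _) := congrArg Prod.snd h1
  rw [fderiv_fibreDeriv hG]
  exact ((rho n).symm.injective h2).symm

/-- Near `u₀` the embedding factors through its own coordinates, `ι = lagParam T S ∘ lin T ∘ ι`. A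
vector killed by the derivative of the coordinates is thus killed by that of `ι`, which is
injective. -/
theorem isInvertible_lin_embedding {Q : Type} [NormedAddCommGroup Q] [NormedSpace ℝ Q]
    [FiniteDimensional ℝ Q] {T : Euc m ≃L[ℝ] Euc n × Q} {S : Euc n × Q → ℝ} {U : Set (Euc m)}
    {ι : Euc m → Cot m} {u₀ : Euc m} (hι : IsSymLagrangianEmbedding U ι) (hu₀ : u₀ ∈ U)
    (hp : ι u₀ = (0, l₀)) (hS : IsOddGenFun T S l₀) (h : Repr T S (ι '' U) (0, l₀)) :
    (fderiv ℝ (fun u => lin T (ι u)) u₀).IsInvertible := by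
  have hU := hι.isOpen.mem_nhds hu₀
  have hιs := hι.smooth.contDiffAt hU
  have hd := (differentiableAt_of_smooth hιs).hasFDerivAt
  have hl : HasFDerivAt (fun u => lin T (ι u)) _ u₀ := (lin T).hasFDerivAt.comp u₀ hd
  refine isInvertible_of_injective T.toLinearEquiv.finrank_eq fun v hv => ?_
  refine hι.immersion u₀ hu₀ ?_
  rw [map_zero]
  have ht : Tendsto ι (𝓝 u₀) (𝓝 (0, l₀)) := hp ▸ hιs.continuousAt.tendsto
  have h1 : HasFDerivAt (lagParam T S) (fderiv ℝ (lagParam T S) (0, (T l₀).2))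
      (lin T (ι u₀)) := by
    rw [hp, lin_zero]
    exact (differentiableAt_of_smooth (contDiffAt_lagParam T hS.smooth.self_of_nhds)).hasFDerivAt
  have h2 := HasFDerivAt.comp (f := fun u => lin T (ι u)) u₀ h1 hl
  have h3 := hd.unique (h2.congr_of_eventuallyEq (by
    filter_upwards [ht.eventually h, hU] with u hu hu'
    exact (hu.1 ⟨u, hu', rfl⟩).symm))
  rw [h3]
  rw [hl.fderiv] at hv
  change fderiv ℝ (lagParam T S) (0, (T l₀).2) (((lin T).comp (fderiv ℝ ι u₀)) v) = 0
  rw [hv, map_zero]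

/-- A compactly supported small odd perturbation of an odd family on `V` with nondegenerate
Legendre transform is a nearby odd family on `V`. -/
theorem eventually_isOddFamilyOn {J : Type} {D : PointedFilter J} {Q : Type}
    [NormedAddCommGroup Q] [NormedSpace ℝ Q] [FiniteDimensional ℝ Q] {T : Euc m ≃L[ℝ] Euc n × Q}
    {F : Euc n × Euc m → ℝ} {V K : Set (Euc n × Euc m)} {d : J → Euc n × Euc m → ℝ}
    (hF : IsOddFamilyOn F V) (hinv : ∀ x ∈ V, (fderiv ℝ (legMap T F) x).IsInvertible)
    (hK : IsCompact K) (hKV : K ⊆ V) (hd : ∀ x ∈ K, FamSmooth D d x)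
    (h0 : ∀ j, ∀ x ∉ K, d j x = 0) (hb : d D.base = 0)
    (hodd : ∀ᶠ j in D.l, ∀ x ∈ V, d j (flip x) = -d j x) :
    ∀ᶠ j in D.l, IsOddFamilyOn (fun x => F x + d j x) V := by
  have hFs : ∀ x ∈ V, ContDiffAt ℝ ∞ F x := fun x hx => hF.smooth.contDiffAt (hF.isOpen.mem_nhds hx)
  have hFev : ∀ x ∈ V, ∀ᶠ y in 𝓝 x, ContDiffAt ℝ ∞ F y := fun x hx =>
    (hF.isOpen.eventually_mem hx).mono hFs
  have hsum : ∀ x ∈ K, FamSmooth D (fun j => legMap T (fun x => F x + d j x)) x := by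
    intro x hx
    have h1 : FamSmooth D (fun j x => F x + d j x) x :=
      (FamSmooth.of_const (hFev x (hKV hx))).add (hd x hx)
    exact FamSmooth.clm (legLin T) (h1.fderiv.prodMk (FamSmooth.of_contDiff contDiff_id))
  -- The critical points move with the perturbation, so regularity along the critical set alone is
  -- awkward to preserve. Invertibility of the Legendre derivative at every point of `K` is an open
  -- condition, survives by compactness, and implies regularity.
  have hKinv : ∀ᶠ j in D.l, ∀ x ∈ K,
      (fderiv ℝ (legMap T (fun x => F x + d j x)) x).IsInvertible := by
    refine eventually_forall_of_isCompact
      (R := fun j x => (fderiv ℝ (legMap T (fun x => F x + d j x)) x).IsInvertible) hK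
      fun x hx => ?_
    have h1 := (hsum x hx).fderiv.tendsto
    have h2 : (fun x => F x + d D.base x) = F := by
      ext1 x
      rw [hb, Pi.zero_apply, add_zero]
    simp only [h2] at h1
    exact h1.eventually (IsInvertible.eventually (hinv x (hKV hx)))
  filter_upwards [eventually_contDiff_of_compact_support hK hd h0, hKinv, hodd] with j h1 h2 h3
  refine ⟨hF.isOpen, hF.symm, hF.smooth.add h1.contDiffOn, fun x hx => ?_, fun x hx => ?_⟩
  · have h4 : d j (-x.1, x.2) = -d j x := h3 x hx
    simp only [hF.odd x hx, h4]
    ring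
  · have hs : ContDiffAt ℝ ∞ (fun x => F x + d j x) x := (hFs x hx.1).add h1.contDiffAt
    refine fibreDeriv_surjective_of_invertible (T := T) hs ?_
    by_cases hxK : x ∈ K
    · exact h2 x hxK
    · have h5 : (fun x => F x + d j x) =ᶠ[𝓝 x] F := by
        filter_upwards [hK.isClosed.isOpen_compl.mem_nhds hxK] with y hy
        rw [h0 j y hy, add_zero]
      have h6 : legMap T (fun x => F x + d j x) =ᶠ[𝓝 x] legMap T F := by
        filter_upwards [h5.eventuallyEq_nhds] with y hy
        simp only [legMap, hy.fderiv_eq]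
      rw [h6.fderiv_eq]
      exact hinv x hx.1

/-- A symmetric embedding near `ι` has an odd generating function near that of `ι`. Written in the
variables in which `F` has its normal form, the cut-off difference is a small odd perturbation of
`F`; the equivalence returned by the stability of `F` is carried back to Lagrangian germs. -/
theorem isSymLagrangianStable_of_isRoddStable {F : Euc n × Euc m → ℝ} {L : Set (Cot m)}
    (hF : IsOddGeneratingFamilyOf F l₀ L) (hstab : IsRoddStable F l₀) :
    IsSymLagrangianStable L (0, l₀) := by
  intro U ι u₀ hι hu₀ hp hL N hN
  obtain ⟨⟨V₁, hV₁, hFV₁⟩, hc, hgen⟩ := hF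
  have hG := hFV₁.isOddGerm hV₁ hc
  obtain ⟨k, T, hinv⟩ := exists_adapted hG (hFV₁.regular _ ⟨hV₁, hc⟩)
  obtain ⟨h, S, HL⟩ := exists_isLegendre hG hinv
  have hRepr : Repr T S (ι '' U) (0, l₀) := HL.repr (Generates.congr hgen hL.symm)
  obtain ⟨r, R, g, hr, hg0, hRf, hev⟩ := exists_genFun_family (T := T) hι hu₀ hp hN
    (isInvertible_lin_embedding hι hu₀ hp HL.isOddGenFun hRepr)
  set D := whitneyAt U ι (IsSymLagrangianEmbedding U) hι.smooth hι with hD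
  set y₀ : Euc n × Euc k := (0, (T l₀).2) with hy₀
  set B := Metric.ball y₀ r with hB
  have hy₀B : y₀ ∈ B := Metric.mem_ball_self hr
  set R₀ := R ⟨ι, hι⟩ with hR₀
  have hev₀ : ∀ y ∈ B, ContDiffAt ℝ ∞ R₀ y ∧ R₀ (flip y) = -R₀ y ∧ g ⟨ι, hι⟩ y ∈ U ∩ N ∧
      lagParam T R₀ y = ι (g ⟨ι, hι⟩ y) ∧ Repr T R₀ (ι '' U) (ι (g ⟨ι, hι⟩ y)) := D.le hev
  have hgen₀ : IsOddGenFun T R₀ l₀ := by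
    refine ⟨(Metric.isOpen_ball.eventually_mem hy₀B).mono fun y hy => (hev₀ y hy).1,
      (Metric.isOpen_ball.eventually_mem hy₀B).mono fun y hy => (hev₀ y hy).2.1, ?_⟩
    rw [(hev₀ y₀ hy₀B).2.2.2.1, hg0, hp]
  have hSR : S =ᶠ[𝓝 (0, (T l₀).2)] R₀ := by
    refine HL.isOddGenFun.unique hgen₀ hRepr ?_
    have := (hev₀ y₀ hy₀B).2.2.2.2
    rwa [hg0, hp] at this
  obtain ⟨Φ, Λ, H, hFΦ⟩ := roddEquiv_iff.1 HL.roddEquiv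
  -- a small symmetric neighbourhood
  have hs2 : Tendsto (Prod.snd : Euc n × Euc m → Euc m) (𝓝 (0, l₀)) (𝓝 l₀) :=
    continuous_snd.tendsto _
  set P : Euc n × Euc m → Euc n × Euc k := fun x => (Φ x, (T (Λ x.2)).2) with hP
  have hFR : ∀ᶠ x in 𝓝 ((0 : Euc n), l₀), F x = normalFamily T R₀ (Φ x, Λ x.2) := by
    have h1 : normalFamily T S =ᶠ[𝓝 (0, l₀)] normalFamily T R₀ := normalFamily_congr hSR
    filter_upwards [hFΦ, H.tendsto.eventually h1] with x h1 h2
    rw [h1, h2]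
  have hPt : Tendsto P (𝓝 (0, l₀)) (𝓝 y₀) := (tendsto_normalCoord l₀).comp H.tendsto
  have hinvt : ∀ᶠ x in 𝓝 ((0 : Euc n), l₀), (fderiv ℝ (legMap T F) x).IsInvertible :=
    (contDiffAt_fderiv (contDiffAt_legMap T hG.smooth.self_of_nhds)).continuousAt.eventually
      (IsInvertible.eventually hinv)
  -- On a single ball `F` is smooth, odd, has nondegenerate Legendre derivative and equals its
  -- normal form in the variables `(Φ, Λ)`. This ball, symmetric under `flip`, is the domain of the
  -- representative to which stability is applied.
  obtain ⟨ρ, hρ, hball⟩ := Metric.eventually_nhds_iff_ball.1 (hG.smooth.and (hG.odd.and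
    (hinvt.and (H.smooth.and ((hs2.eventually H.base_smooth).and (H.odd.and (hFR.and
      ((hs2.eventually H.eventually_germ).and
        (hPt.eventually (Metric.isOpen_ball.eventually_mem hy₀B))))))))))
  set V := Metric.ball ((0 : Euc n), l₀) ρ with hV
  have hflipV : ∀ x ∈ V, flip x ∈ V := fun x hx => by
    rw [hV, Metric.mem_ball, dist_flip]; exact hx
  have hxV : (0, l₀) ∈ V := Metric.mem_ball_self hρ
  have hFV : IsOddFamilyOn F V := by
    refine ⟨Metric.isOpen_ball, hflipV, fun x hx => (hball x hx).1.contDiffWithinAt,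
      fun x hx => (hball x hx).2.1, fun x hx => ?_⟩
    obtain ⟨h1, -, h3, -⟩ := hball x hx.1
    exact fibreDeriv_surjective_of_invertible h1 h3
  have hPB : ∀ x ∈ V, P x ∈ B := fun x hx => (hball x hx).2.2.2.2.2.2.2.2
  have hPs : ∀ x ∈ V, ContDiffAt ℝ ∞ P x := fun x hx =>
    (hball x hx).2.2.2.1.prodMk
      (T.contDiff.contDiffAt.comp x ((hball x hx).2.2.2.2.1.comp x contDiffAt_snd)).snd
  have hPflip : ∀ x ∈ V, P (flip x) = flip (P x) := fun x hx =>
    Prod.ext (hball x hx).2.2.2.2.2.1 rfl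
  -- the perturbations
  obtain ⟨χ, hχs, hχ1, hχ0, hχf⟩ := exists_even_cutoff (E := Euc n) l₀
    (show 0 < ρ / 4 by positivity) (show ρ / 4 < ρ / 2 by linarith)
  -- Replacing `R₀` by `R j` in the normal form leaves the bilinear term alone, so in the original
  -- variables the difference of the two families is that of the generating functions at `P x`.
  set d : {ι' // IsSymLagrangianEmbedding U ι'} → Euc n × Euc m → ℝ := fun j x =>
    χ x * (R j (P x) - R₀ (P x)) with hd
  set K := Metric.closedBall ((0 : Euc n), l₀) (ρ / 2) with hK
  have hKV : K ⊆ V := Metric.closedBall_subset_ball (by linarith)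
  have hd0 : ∀ j, ∀ x ∉ K, d j x = 0 := fun j x hx => by simp only [hd, hχ0 x hx, zero_mul]
  have hdb : d D.base = 0 := by
    ext1 x
    change χ x * (R₀ (P x) - R₀ (P x)) = 0
    rw [sub_self, mul_zero]
  have hds : ∀ x ∈ K, FamSmooth D d x := by
    intro x hx
    have h1 : FamSmooth D (fun _ x => P x) x := FamSmooth.of_const
      ((Metric.isOpen_ball.eventually_mem (hKV hx)).mono hPs)
    have h2 : FamSmooth D (fun j y => R j y - R₀ y) (P x) :=
      (hRf _ (hPB x (hKV hx))).sub (FamSmooth.of_const (hRf _ (hPB x (hKV hx))).base)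
    exact FamSmooth.bilin (ContinuousLinearMap.mul ℝ ℝ) (FamSmooth.of_contDiff hχs)
      (FamSmooth.comp (f := fun _ x => P x) (g := fun j y => R j y - R₀ y) h2 h1)
  have hdodd : ∀ᶠ j in D.l, ∀ x ∈ V, d j (flip x) = -d j x := by
    filter_upwards [hev] with j hj x hx
    simp only [hd, hχf, hPflip x hx, (hj _ (hPB x hx)).2.1, (hev₀ _ (hPB x hx)).2.1]
    ring
  obtain ⟨W, hW, hWs⟩ := hstab V F hxV hFV EventuallyEq.rfl _
    (Metric.ball_mem_nhds ((0 : Euc n), l₀) (show 0 < ρ / 4 by positivity))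
  refine exists_whitneyNhd_of_eventually (hf := hι.smooth) (hgood := hι)
    (good := IsSymLagrangianEmbedding U) (R := fun ι' => ∃ u₁ ∈ U ∩ N,
      SymLagrangianEquiv L (0, l₀) (ι' '' U) (ι' u₁)) ?_
  filter_upwards [hev, eventually_isOddFamilyOn hFV (fun x hx => (hball x hx).2.2.1)
    (isCompact_closedBall _ _) hKV hds hd0 hdb hdodd,
    eventually_mem_whitney (isCompact_closedBall _ _) hKV hFV.smooth hds hd0 hdb hW]
    with j hj hGj hjW
  obtain ⟨l₁, ⟨hl₁V, hl₁⟩, hequiv⟩ := hWs _ hjW hGj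
  obtain ⟨-, -, -, -, -, -, -, hgerm, -⟩ := hball _ hl₁V
  have hgerm' : IsFibredOddGerm Φ Λ l₁ (Λ l₁) := hgerm
  set l₂ := Λ l₁ with hl₂
  -- Where the bump function is `1`, the perturbed family is the normal form of `R j` in the
  -- variables `(Φ, Λ)`; at the point `l₁` these still form a fibred odd diffeomorphism germ.
  have hGR : RoddEquiv (fun x => F x + d j x) l₁ (normalFamily T (R j)) l₂ := by
    refine roddEquiv_iff.2 ⟨Φ, Λ, hgerm', ?_⟩
    filter_upwards [Metric.isOpen_ball.mem_nhds hl₁, Metric.isOpen_ball.mem_nhds hl₁V]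
      with x hx hxV
    have h1 := (hball x hxV).2.2.2.2.2.2.1
    simp only [hd, hχ1 x (Metric.ball_subset_closedBall hx), h1, normalFamily, hP]
    ring
  have hFR' : RoddEquiv F l₀ (normalFamily T (R j)) l₂ := hequiv.trans hGR
  have hNo := hG.of_roddEquiv hFR'
  have hP₁ : P (0, l₁) = (0, (T l₂).2) := Prod.ext hgerm'.map_zero rfl
  have hy₂ : ((0 : Euc n), (T l₂).2) ∈ B := hP₁ ▸ hPB _ hl₁V
  obtain ⟨g1, g2, g3, g4, g5⟩ := hj _ hy₂
  have hBev : ∀ᶠ y in 𝓝 ((0 : Euc n), (T l₂).2), y ∈ B := Metric.isOpen_ball.eventually_mem hy₂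
  -- `(0, l₂)` is critical for the normal form because equivalences preserve criticality, which
  -- gives the base component. The momentum vanishes because `R j` is odd.
  have hlag : lagParam T (R j) (0, (T l₂).2) = (0, l₂) := by
    have h1 := (mem_critSet_normalFamily T (x := ((0 : Euc n), l₂))
      (differentiableAt_of_smooth g1)).1 hNo.crit
    have h2 := lagParam_flip T (hBev.mono fun y hy => (hj y hy).2.1)
    have h3 : flip ((0 : Euc n), (T l₂).2) = (0, (T l₂).2) := by simp [flip]
    rw [h3] at h2
    exact Prod.ext (fst_eq_zero_of_zeta_eq h2.symm) h1
  have hgf : IsOddGenFun T (R j) l₂ :=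
    ⟨hBev.mono fun y hy => (hj y hy).1, hBev.mono fun y hy => (hj y hy).2.1, hlag⟩
  have hpt : j.1 (g j (0, (T l₂).2)) = (0, l₂) := by rw [← g4, hlag]
  refine ⟨g j (0, (T l₂).2), g3, ?_⟩
  rw [hpt] at g5 ⊢
  refine SymLagrangianEquiv.of_roddEquiv hFR' hgen (hgf.isLegendre.generates.congr ?_) hNo.smooth
  filter_upwards [g5] with q hq using propext hq.symm

end FamilyToLagrangian

end OddLagrangian

theorem mainTheorem2 (n m : ℕ) (L : Set (OddLagrangian.Cot m)) (p : OddLagrangian.Cot m)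
    (hL : OddLagrangian.IsSymLagrangianGerm L p)
    (F : OddLagrangian.Euc n × OddLagrangian.Euc m → ℝ)
    (hF : OddLagrangian.IsOddGeneratingFamilyOf F p.2 L) :
    OddLagrangian.IsSymLagrangianStable L p ↔ OddLagrangian.IsRoddStable F p.2 := by
  -- A fixed point of the involution lies on the zero section.
  have hp : p = (0, p.2) := Prod.ext (OddLagrangian.fst_eq_zero_of_zeta_eq hL.fixed) rfl
  constructor
  · intro h
    rw [hp] at h
    exact OddLagrangian.isRoddStable_of_isSymLagrangianStable hF h
  · intro h
    rw [hp]
    exact OddLagrangian.isSymLagrangianStable_of_isRoddStable hF h
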